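/- Let $D\ge 1$, $L\ge 1$ and let $T_1,\dots,T_d$ be complex $D\times D$ matrices defining a translation-invariant MPS. For a chain $A$ of length $m$ let $V_m:\mathbb C^D\otimes\mathbb C^D\to(\mathbb C^d)^{\otimes m}$ be the linear map $$V_m|X\rangle=\sum_{s_1,\dots,s_m}\Big(\sum_{a,b}(T_{s_1}\cdots T_{s_m})_{ab}X_{ab}\Big)|s_1,\dots,s_m\rangle ,$$ and let $\rho_m:=V_m^\dagger V_m$ be the boundary state of $A$ (up to entrywise complex conjugation, this is the Choi matrix of the $m$-th power of the transfer operator $\mathbb E(f)=\sum_jT_jfT_j^\dagger$). Assume that the MPS is injective on chains of length $L$, i.e. that $V_L$ is injective. Below, $\|\cdot\|$ is the operator norm, $\|\cdot\|_1$ the trace norm, and $X^{-1/2}$ is taken on the support of $X$. (a) There are an invertible matrix $Z$ and $\mu>0$ such that, if $\rho_m$ now denotes the boundary states of the MPS in the gauge $T_j'=\mu ZT_jZ^{-1}$, there exist a full-rank state $\sigma$ on $\mathbb C^D$ (i.e. $\sigma>0$, $\operatorname{tr}\sigma=1$), with smallest eigenvalue $\sigma_{\min}$, and constants $c>0$, $\gamma\in(0,1)$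 and $c'>0$ for which the following hold. 1. For every $m\ge 0$, $\ \|\rho_m-\sigma\otimes\mathbb 1\|_1\le c\,\gamma^m$. 2. For every $m\ge 0$, $\ \|\rho_m^{1/2}(\sigma^{-1}\otimes\mathbb 1)\rho_m^{1/2}-\mathbb 1\|\le c\,\sigma_{\min}^{-1}\gamma^m$. 3. For every $m\ge L$, $\ \|\rho_m^{-1/2}(\sigma\otimes\mathbb 1)\rho_m^{-1/2}-\mathbb 1\|\le c'\,\sigma_{\min}^{-1}\gamma^m$. 4. For all consecutive chains $A,B,C$ of lengths $k,m,n$ with $m\ge L$, the boundary states are $\epsilon$-approximately factorizable with $\epsilon=c'\sigma_{\min}^{-1}\gamma^m$: there are invertible $D\times D$ matrices $\Delta_a,\Delta_b,\Omega_c,\Omega_d$ such that, with $\sigma_{ABC}=\Delta_a\otimes\Delta_b$, $\sigma_{AB}=\Delta_a\otimes\Omega_c$, $\sigma_{BC}=\Omega_d\otimes\Delta_b$, $\sigma_B=\Omega_d\otimes\Omega_c$ (first factor on the left, second on the right boundary bond), one has $\|\rho_R^{1/2}\sigma_R^{-1}\rho_R^{1/2}-\mathbb 1\|\le\epsilon$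 for $R\in\{ABC,AB,BC\}$ and $\|\rho_B^{-1/2}\sigma_B\rho_B^{-1/2}-\mathbb 1\|\le\epsilon$. Here $\rho_R$ is the boundary state of $R$, i.e. $\rho_m$ with $m$ replaced by the length of $R$. (b) Group the sites of the original MPS into blocks of $L$ sites, so that the MPS is injective on each single (block) site, and let $H_N=\sum_{i=1}^{N-1}h_{i,i+1}$ be the parent Hamiltonian on an open chain of $N\ge 1$ block sites, where $h_{i,i+1}$ is the orthogonal projector onto the orthogonal complement of $\operatorname{Im}V_{\{i,i+1\}}$, the image of the map $V$ of the two neighbouring block sites $i,i+1$. Then the parent Hamiltonian is gapped: there is $\delta>0$ such that, for every $N$ for which $H_N$ has at least two distinct eigenvalues, the two smallest distinct eigenvalues of $H_N$ differ by at least $\delta$. -/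

import Mathlib

open scoped Kronecker ComplexOrder

noncomputable section

namespace MPS

variable {ι : Type} [Fintype ι] {D : ℕ}

/-! A translation-invariant MPS is a family `T` of `D × D` matrices indexed by the basis `ι` of the
one-site physical space.  Operators on the two boundary bonds of a chain are matrices indexed by
`Fin D × Fin D` (left bond, right bond). -/

/-- The product `T_{s₁} ⋯ T_{sₘ}` attached to a basis configuration `s` of a chain of length `m`.
As a family indexed by `s`, it is also the MPS tensor obtained by coarse graining `m` sites. -/
def chainTensor (T : ι → Matrix (Fin D) (Fin D) ℂ) (m : ℕ) (s : Fin m → ι) :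
    Matrix (Fin D) (Fin D) ℂ :=
  (List.ofFn fun i => T (s i)).prod

/-- The matrix of the map `V_A` from the boundary bonds to the physical space of a chain `A` of
length `m`: `V_A |X⟩ = ∑_s (∑_{a,b} (T_{s₁} ⋯ T_{sₘ})_{a b} X_{a b}) |s⟩`. -/
def boundaryMap (T : ι → Matrix (Fin D) (Fin D) ℂ) (m : ℕ) :
    Matrix (Fin m → ι) (Fin D × Fin D) ℂ :=
  Matrix.of fun s p => chainTensor T m s p.1 p.2

/-- The MPS is injective on chains of length `m`: the map `V_A` is injective. -/
def InjectiveOn (T : ι → Matrix (Fin D) (Fin D) ℂ) (m : ℕ) : Prop :=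
  Function.Injective (boundaryMap T m).mulVec

/-- The boundary state `ρ_{∂A} = V_A† V_A` of a chain of length `m`. -/
def boundaryState (T : ι → Matrix (Fin D) (Fin D) ℂ) (m : ℕ) :
    Matrix (Fin D × Fin D) (Fin D × Fin D) ℂ :=
  (boundaryMap T m).conjTranspose * boundaryMap T m

/-- The transfer operator `f ↦ ∑_j T_j f T_j†`. -/
def transferOp (T : ι → Matrix (Fin D) (Fin D) ℂ) :
    Module.End ℂ (Matrix (Fin D) (Fin D) ℂ) :=
  ∑ j, LinearMap.mulLeftRight ℂ (T j, (T j).conjTranspose)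

/-- The Choi matrix `(Φ ⊗ id)(|Ω⟩⟨Ω|) = ∑_{k,l} Φ(|k⟩⟨l|) ⊗ |k⟩⟨l|`. -/
def choi (Φ : Module.End ℂ (Matrix (Fin D) (Fin D) ℂ)) :
    Matrix (Fin D × Fin D) (Fin D × Fin D) ℂ :=
  Matrix.of fun p q => Φ (Matrix.single p.2 q.2 1) p.1 q.1

theorem transferOp_pow_apply (T : ι → Matrix (Fin D) (Fin D) ℂ) (m : ℕ)
    (f : Matrix (Fin D) (Fin D) ℂ) :
    (transferOp T ^ m) f =
      ∑ s : Fin m → ι, chainTensor T m s * f * (chainTensor T m s).conjTranspose := by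
  induction m with
  | zero => simp [chainTensor]
  | succ m ih =>
    rw [pow_succ', Module.End.mul_apply, ih, ← (Fin.consEquiv fun _ => ι).sum_comp,
      Fintype.sum_prod_type]
    simp only [transferOp, LinearMap.sum_apply, LinearMap.mulLeftRight_apply, chainTensor,
      Fin.consEquiv_apply, List.ofFn_succ, Fin.cons_zero, Fin.cons_succ, List.prod_cons,
      Matrix.conjTranspose_mul, Finset.mul_sum, Finset.sum_mul, Matrix.mul_assoc]

/-- The boundary state is the Choi matrix of the `m`-th power of the transfer operator, up to the
entrywise complex conjugation that comes from turning kets on the bonds into bras. -/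
theorem boundaryState_eq_choi (T : ι → Matrix (Fin D) (Fin D) ℂ) (m : ℕ) :
    boundaryState T m = (choi (transferOp T ^ m)).map star := by
  ext p q
  simp [boundaryState, boundaryMap, choi, transferOp_pow_apply, Matrix.mul_apply,
    Matrix.sum_apply, Matrix.single_apply, ite_and]

/-- A change of gauge `T_j ↦ μ Z T_j Z⁻¹`; the factor `μ` only changes the normalization of
the state. -/
def gauge (Z : (Matrix (Fin D) (Fin D) ℂ)ˣ) (μ : ℝ) (T : ι → Matrix (Fin D) (Fin D) ℂ) :
    ι → Matrix (Fin D) (Fin D) ℂ :=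
  fun j => (μ : ℂ) • ((Z : Matrix (Fin D) (Fin D) ℂ) * T j * (↑Z⁻¹ : Matrix (Fin D) (Fin D) ℂ))

/-- The trace norm (sum of the singular values). -/
def traceNorm {n : Type} [Fintype n] [DecidableEq n] (X : Matrix n n ℂ) : ℝ :=
  ∑ i, Real.sqrt ((Matrix.isHermitian_conjTranspose_mul_self X).eigenvalues i)

/-- The operator norm with respect to the Euclidean (Hilbert space) norm. -/
def opNorm {n : Type} [Fintype n] [DecidableEq n] (X : Matrix n n ℂ) : ℝ :=
  ‖Matrix.toEuclideanCLM (n := n) (𝕜 := ℂ) X‖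

/-- The square root of a positive semidefinite matrix. -/
def psdSqrt {n : Type} [Fintype n] [DecidableEq n] (X : Matrix n n ℂ) : Matrix n n ℂ :=
  cfc Real.sqrt X

/-- `X^{-1/2}` for a positive semidefinite matrix, the inverse being taken on the support
(the eigenvalue `0` is sent to `0`). -/
def psdInvSqrt {n : Type} [Fintype n] [DecidableEq n] (X : Matrix n n ℂ) : Matrix n n ℂ :=
  cfc (fun x : ℝ => (Real.sqrt x)⁻¹) X

/-- The smallest eigenvalue of a Hermitian matrix. -/
def minEigenvalue {n : Type} [Fintype n] [DecidableEq n] (X : Matrix n n ℂ) : ℝ :=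
  sInf (spectrum ℝ X)

/-- `ε`-approximate factorization for three consecutive chains `A`, `B`, `C` of lengths `k`, `m`,
`n`.  The boundary of a chain consists of a left and a right bond, so the four invertible matrices
live on the left bond of `A` (`Δa`), the right bond of `C` (`Δb`), the right bond of `B` (`Ωc`)
and the left bond of `B` (`Ωd`), and
`σ_{∂ABC} = Δa ⊗ Δb`, `σ_{∂AB} = Δa ⊗ Ωc`, `σ_{∂BC} = Ωd ⊗ Δb`, `σ_{∂B} = Ωd ⊗ Ωc`. -/
def ApproxFactorizable (T : ι → Matrix (Fin D) (Fin D) ℂ) (k m n : ℕ) (ε : ℝ) : Prop :=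
  ∃ Δa Δb Ωc Ωd : Matrix (Fin D) (Fin D) ℂ,
    IsUnit Δa ∧ IsUnit Δb ∧ IsUnit Ωc ∧ IsUnit Ωd ∧
    opNorm (psdSqrt (boundaryState T (k + m + n)) * (Δa ⊗ₖ Δb)⁻¹
      * psdSqrt (boundaryState T (k + m + n)) - 1) ≤ ε ∧
    opNorm (psdSqrt (boundaryState T (k + m)) * (Δa ⊗ₖ Ωc)⁻¹
      * psdSqrt (boundaryState T (k + m)) - 1) ≤ ε ∧
    opNorm (psdSqrt (boundaryState T (m + n)) * (Ωd ⊗ₖ Δb)⁻¹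
      * psdSqrt (boundaryState T (m + n)) - 1) ≤ ε ∧
    opNorm (psdInvSqrt (boundaryState T m) * (Ωd ⊗ₖ Ωc)
      * psdInvSqrt (boundaryState T m) - 1) ≤ ε

variable [DecidableEq ι]

/-- The two-site term of the parent Hamiltonian: the orthogonal projector onto the orthogonal
complement of `Im V_{a,b}`, for neighbouring sites `a`, `b`. -/
def localTerm (T : ι → Matrix (Fin D) (Fin D) ℂ) : Matrix (Fin 2 → ι) (Fin 2 → ι) ℂ :=
  (Matrix.toEuclideanCLM (n := Fin 2 → ι) (𝕜 := ℂ)).symm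
    (LinearMap.range (Matrix.toEuclideanLin (boundaryMap T 2)))ᗮ.starProjection

/-- The two-site operator `h` acting on the sites `i`, `i + 1` of a chain of `N + 1` sites, tensored
with the identity on all other sites. -/
def onEdge (h : Matrix (Fin 2 → ι) (Fin 2 → ι) ℂ) {N : ℕ} (i : Fin N) :
    Matrix (Fin (N + 1) → ι) (Fin (N + 1) → ι) ℂ :=
  Matrix.of fun s t =>
    if ∀ x, x ≠ i.castSucc → x ≠ i.succ → s x = t x then
      h ![s i.castSucc, s i.succ] ![t i.castSucc, t i.succ]
    else 0

/-- The parent Hamiltonian of a chain of `N + 1` sites: the sum of the local terms over the edges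
contained in the chain. -/
def parentHamiltonian (T : ι → Matrix (Fin D) (Fin D) ℂ) (N : ℕ) :
    Matrix (Fin (N + 1) → ι) (Fin (N + 1) → ι) ℂ :=
  ∑ i : Fin N, onEdge (localTerm T) i

/-- The family of parent Hamiltonians over all finite chains is gapped: the difference of the two
smallest distinct eigenvalues (whenever there are two) has a positive lower bound independent of
the length of the chain. -/
def ParentGapped (T : ι → Matrix (Fin D) (Fin D) ℂ) : Prop :=
  ∃ δ : ℝ, 0 < δ ∧ ∀ (N : ℕ) (E₀ E₁ : ℝ),
    IsLeast (spectrum ℝ (parentHamiltonian T N)) E₀ →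
    IsLeast (spectrum ℝ (parentHamiltonian T N) \ {E₀}) E₁ →
    δ ≤ E₁ - E₀

end MPS

end

noncomputable section

namespace MPS

open Matrix Filter Topology
open scoped Matrix.Norms.L2Operator MatrixOrder

set_option linter.unusedSectionVars false

/-! ### Norm and order estimates for matrices and their square roots -/

section MatrixBounds

variable {n : Type} [Fintype n] [DecidableEq n]

/-! Part (a) is Perron–Frobenius theory. Injectivity says that the products `chainTensor T L s` span
all matrices, so the transfer operator and its dual `dualOp` are primitive: their `L`-th powers send
nonzero positive semidefinite matrices to positive definite ones. The Perron eigenvector of the dual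
(`exists_perron_eigenvector`) supplies the gauge in which the dual is unital; the Perron eigenvector
of the transfer operator in that gauge is a stationary state `τ`. An eigenvector `f` of the dual
with `tr(τ f) = 0` and eigenvalue of modulus at least 1 would leave no defect in the Kadison–Schwarz
inequality weighted by `τ`. This forces `f` to commute with every matrix, hence to be a scalar,
hence zero (`InjectiveOn.norm_eigenvalue_lt_one`). By Gelfand's formula the powers of the dual
converge exponentially to `f ↦ tr(τ f) 1`. The boundary state is a reshuffling of such a power, so
it converges to `σ ⊗ 1` with `σ = τᵀ`. The limit is invertible, so the inverses of the boundary
states stay bounded, and the estimates with square roots are perturbation bounds. The factorization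
takes `σ ⊗ 1` for all four regions.

Part (b) is a martingale-type argument for the blocked MPS, which is injective on one site. Its
parent Hamiltonian depends only on the ranges of `V`, so it may be studied in the good gauge. If `u`
lies in the ground space of `AB`, `v` in that of `BC`, and `u` is orthogonal to the range of `V` on
`ABC`, then their overlap would vanish if the boundary states of `B` and `AB` were exactly `σ ⊗ 1`;
in general it is exponentially small in the length of `B` (`norm_overlap_le`). For the projectors
`P`, `Q` onto the complements of the two ground spaces this means `(P + Q)² ≥ (1 - ε)(P + Q)`.
Covering the chain by blocks of which only neighbours overlap gives a coarse Hamiltonian `H'` with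
`H'² ≥ (1 - 2ε) H'` (`smul_sum_le_sum_mul_sum`). The intersection property
(`InjectiveOn.exists_boundaryMap_eq`) identifies the kernel of the parent Hamiltonian with the range
of `V`. Hence `H'` is bounded by a constant times the parent Hamiltonian, uniformly in the length of
the chain, and the gap passes from one to the other (`gap_of_comparison`). The finitely many short
chains are gapped because their spectra are finite. -/

theorem traceNorm_le_card_mul_norm (X : Matrix n n ℂ) :
    traceNorm X ≤ Fintype.card n * ‖X‖ := by
  have h : ∀ i, Real.sqrt ((isHermitian_conjTranspose_mul_self X).eigenvalues i) ≤ ‖X‖ := by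
    intro i
    refine Real.sqrt_le_iff.2 ⟨norm_nonneg _, ?_⟩
    have h1 := (isHermitian_conjTranspose_mul_self X).eigenvalues_mem_spectrum_real i
    have h2 := spectrum.norm_le_norm_mul_of_mem h1
    have : Nonempty n := ⟨i⟩
    have h3 : ‖(1 : Matrix n n ℂ)‖ = 1 := by
      have : Nontrivial (Matrix n n ℂ) := inferInstance
      exact CStarRing.norm_one
    rw [h3, mul_one, l2_opNorm_conjTranspose_mul_self] at h2
    exact (le_abs_self _).trans (by simpa [sq] using h2)
  calc traceNorm X ≤ ∑ _i : n, ‖X‖ := Finset.sum_le_sum fun i _ => h i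
    _ = _ := by simp

theorem nonneg_iff {A : Matrix n n ℂ} : 0 ≤ A ↔ A.PosSemidef := nonneg_iff_posSemidef

theorem exists_smul_one_le {A : Matrix n n ℂ} (hA : A.PosDef) :
    ∃ κ : ℝ, 0 < κ ∧ κ • 1 ≤ A := by
  have h := hA.isStrictlyPositive
  rcases isEmpty_or_nonempty n with h0 | h0
  · exact ⟨1, one_pos, le_of_eq (Subsingleton.elim _ _)⟩
  have : Nontrivial (Matrix n n ℂ) := inferInstance
  obtain ⟨r, hr, h2⟩ := (CFC.exists_pos_algebraMap_le_iff (A := Matrix n n ℂ) (a := A)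
    h.isSelfAdjoint).2 fun x hx => h.spectrum_pos hx
  exact ⟨r, hr, by rwa [Algebra.algebraMap_eq_smul_one] at h2⟩

theorem le_norm_smul_one {A : Matrix n n ℂ} (hA : A.IsHermitian) : A ≤ ‖A‖ • 1 := by
  have := IsSelfAdjoint.le_algebraMap_norm_self (a := A) hA
  rwa [Algebra.algebraMap_eq_smul_one] at this

theorem psdSqrt_isHermitian (A : Matrix n n ℂ) : (psdSqrt A).IsHermitian :=
  cfc_predicate (R := ℝ) _ A

theorem psdInvSqrt_isHermitian (A : Matrix n n ℂ) : (psdInvSqrt A).IsHermitian :=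
  cfc_predicate (R := ℝ) _ A

theorem psdSqrt_mul_self {A : Matrix n n ℂ} (hA : A.PosSemidef) : psdSqrt A * psdSqrt A = A := by
  have := nonneg_iff_posSemidef.2 hA
  unfold psdSqrt
  rw [← cfc_mul ..]
  conv_rhs => rw [← cfc_id ℝ A]
  refine cfc_congr fun x hx => ?_
  exact Real.mul_self_sqrt (spectrum_nonneg_of_nonneg this hx)

theorem continuousOn_spectrum (f : ℝ → ℝ) (A : Matrix n n ℂ) : ContinuousOn f (spectrum ℝ A) :=
  (finite_real_spectrum (A := A)).continuousOn f

/-- The product of the two roots is the support projector, so no invertibility of `A` is needed. -/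
theorem mul_psdInvSqrt_mul_psdSqrt {A : Matrix n n ℂ} (hA : A.PosSemidef) :
    A * (psdInvSqrt A * psdSqrt A) = A := by
  have := nonneg_iff_posSemidef.2 hA
  unfold psdSqrt psdInvSqrt
  rw [← cfc_mul _ _ A (continuousOn_spectrum _ _) (continuousOn_spectrum _ _)]
  conv_lhs => enter [1]; rw [← cfc_id ℝ A]
  rw [← cfc_mul _ _ A (continuousOn_spectrum _ _) (continuousOn_spectrum _ _)]
  conv_rhs => rw [← cfc_id ℝ A]
  refine cfc_congr fun x hx => ?_
  rcases (spectrum_nonneg_of_nonneg this hx).eq_or_lt with h | h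
  · simp [← h]
  · have := (Real.sqrt_pos.2 h).ne'
    simp [inv_mul_cancel₀ this]

theorem psdInvSqrt_mul_psdSqrt {A : Matrix n n ℂ} (hA : A.PosDef) :
    psdInvSqrt A * psdSqrt A = 1 := by
  have h := mul_psdInvSqrt_mul_psdSqrt hA.posSemidef
  exact hA.isUnit.mul_left_cancel (h.trans (mul_one A).symm)

theorem psdSqrt_mul_psdInvSqrt {A : Matrix n n ℂ} (hA : A.PosDef) :
    psdSqrt A * psdInvSqrt A = 1 :=
  mul_eq_one_comm.1 (psdInvSqrt_mul_psdSqrt hA)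

theorem psdInvSqrt_mul_mul_psdInvSqrt {A : Matrix n n ℂ} (hA : A.PosDef) :
    psdInvSqrt A * A * psdInvSqrt A = 1 := by
  conv_lhs => enter [1, 2]; rw [← psdSqrt_mul_self hA.posSemidef]
  rw [← mul_assoc, psdInvSqrt_mul_psdSqrt hA, one_mul, psdSqrt_mul_psdInvSqrt hA]

theorem psdSqrt_mul_inv_mul_psdSqrt {A : Matrix n n ℂ} (hA : A.PosDef) :
    psdSqrt A * A⁻¹ * psdSqrt A = 1 := by
  have h : A⁻¹ = psdInvSqrt A * psdInvSqrt A := by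
    refine Matrix.inv_eq_right_inv ?_
    conv_lhs => enter [1]; rw [← psdSqrt_mul_self hA.posSemidef]
    rw [mul_assoc, ← mul_assoc (psdSqrt A) (psdInvSqrt A), psdSqrt_mul_psdInvSqrt hA, one_mul,
      psdSqrt_mul_psdInvSqrt hA]
  rw [h, ← mul_assoc, psdSqrt_mul_psdInvSqrt hA, one_mul, psdInvSqrt_mul_psdSqrt hA]

theorem norm_psdSqrt_sq {A : Matrix n n ℂ} (hA : A.PosSemidef) :
    ‖psdSqrt A‖ * ‖psdSqrt A‖ = ‖A‖ := by
  rw [← l2_opNorm_conjTranspose_mul_self, (psdSqrt_isHermitian A).eq, psdSqrt_mul_self hA]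

theorem norm_psdInvSqrt_sq {A : Matrix n n ℂ} (hA : A.PosDef) :
    ‖psdInvSqrt A‖ * ‖psdInvSqrt A‖ = ‖A⁻¹‖ := by
  rw [← l2_opNorm_conjTranspose_mul_self, (psdInvSqrt_isHermitian A).eq]
  congr 1
  refine (Matrix.inv_eq_right_inv ?_).symm
  conv_lhs => enter [1]; rw [← psdSqrt_mul_self hA.posSemidef]
  rw [mul_assoc, ← mul_assoc (psdSqrt A) (psdInvSqrt A), psdSqrt_mul_psdInvSqrt hA, one_mul,
      psdSqrt_mul_psdInvSqrt hA]

/-- Conjugating `A` itself by `A^{-1/2}` gives `1`, so the difference is the conjugate of `S - A`;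
the two outer factors together cost `‖A⁻¹‖`. -/
theorem norm_psdInvSqrt_mul_mul_sub_one_le {A : Matrix n n ℂ} (hA : A.PosDef)
    (S : Matrix n n ℂ) : ‖psdInvSqrt A * S * psdInvSqrt A - 1‖ ≤ ‖A⁻¹‖ * ‖A - S‖ := by
  have h : psdInvSqrt A * S * psdInvSqrt A - 1 = psdInvSqrt A * (S - A) * psdInvSqrt A := by
    rw [mul_sub, sub_mul, psdInvSqrt_mul_mul_psdInvSqrt hA]
  rw [h, ← norm_psdInvSqrt_sq hA, norm_sub_rev A S]
  calc _ ≤ ‖psdInvSqrt A‖ * ‖S - A‖ * ‖psdInvSqrt A‖ :=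
        (norm_mul_le _ _).trans (by gcongr; exact norm_mul_le _ _)
    _ = _ := by ring

/-- The resolvent identity `S⁻¹ - A⁻¹ = S⁻¹ (A - S) A⁻¹`, conjugated by `A^{1/2}`. -/
theorem norm_psdSqrt_mul_inv_mul_sub_one_le {A S : Matrix n n ℂ} (hA : A.PosDef) (hS : IsUnit S) :
    ‖psdSqrt A * S⁻¹ * psdSqrt A - 1‖ ≤ ‖A‖ * ‖A⁻¹‖ * ‖S⁻¹‖ * ‖A - S‖ := by
  have h1 : S⁻¹ - A⁻¹ = S⁻¹ * (A - S) * A⁻¹ := by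
    have hs := (Matrix.isUnit_iff_isUnit_det S).1 hS
    have ha := (Matrix.isUnit_iff_isUnit_det A).1 hA.isUnit
    rw [mul_sub, sub_mul, mul_assoc, Matrix.mul_nonsing_inv A ha, Matrix.nonsing_inv_mul S hs,
      mul_one, one_mul]
  have h : psdSqrt A * S⁻¹ * psdSqrt A - 1 = psdSqrt A * (S⁻¹ * (A - S) * A⁻¹) * psdSqrt A := by
    rw [← h1, mul_sub, sub_mul, psdSqrt_mul_inv_mul_psdSqrt hA]
  rw [h, ← norm_psdSqrt_sq hA.posSemidef]
  calc _ ≤ ‖psdSqrt A‖ * (‖S⁻¹‖ * ‖A - S‖ * ‖A⁻¹‖) * ‖psdSqrt A‖ := by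
        refine (norm_mul_le _ _).trans ?_
        gcongr
        refine (norm_mul_le _ _).trans ?_
        gcongr
        refine (norm_mul_le _ _).trans ?_
        gcongr
        exact norm_mul_le _ _
    _ = _ := by ring

theorem minEigenvalue_pos [Nonempty n] {A : Matrix n n ℂ} (hA : A.PosDef) :
    0 < minEigenvalue A := by
  have h := hA.isStrictlyPositive
  have hne : (spectrum ℝ A).Nonempty :=
    ⟨_, hA.isHermitian.eigenvalues_mem_spectrum_real (Classical.arbitrary n)⟩
  exact h.spectrum_pos (hne.csInf_mem finite_real_spectrum)

/-- A positive semidefinite matrix dominates, up to a constant, every Hermitian matrix vanishing on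
its kernel. -/
theorem exists_le_smul_of_ker_le {A Q : Matrix n n ℂ} (hA : A.PosSemidef) (hQ : Q.IsHermitian)
    (hker : ∀ x : n → ℂ, A *ᵥ x = 0 → Q *ᵥ x = 0) : ∃ C : ℝ, 0 < C ∧ Q ≤ C • A := by
  set W := psdSqrt A
  set R := psdInvSqrt A
  have hW : W.IsHermitian := psdSqrt_isHermitian A
  have hR : R.IsHermitian := psdInvSqrt_isHermitian A
  have h1 : Q * (R * W) = Q := by
    have h0 : A * (1 - R * W) = 0 := by
      rw [mul_sub, mul_psdInvSqrt_mul_psdSqrt hA, mul_one, sub_self]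
    have h2 : Q * (1 - R * W) = 0 := by
      ext i j
      have := congrFun (hker (fun k => (1 - R * W) k j) (funext fun i => congrFun (congrFun h0 i) j)) i
      exact this
    rw [mul_sub, mul_one, sub_eq_zero] at h2
    exact h2.symm
  have h3 : (W * R) * Q = Q := by
    have := congrArg conjTranspose h1
    rwa [conjTranspose_mul, conjTranspose_mul, hW.eq, hR.eq, hQ.eq] at this
  -- `W R` is the support projector of `A`, which fixes `Q`. Bounding the inner factor by its norm
  -- leaves a multiple of `W² = A`.
  have h4 : Q = star W * (R * Q * R) * W := by
    rw [star_eq_conjTranspose, hW.eq]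
    calc Q = W * R * (Q * (R * W)) := by rw [h1, h3]
      _ = _ := by simp only [mul_assoc]
  have hB : (R * Q * R).IsHermitian := by
    have := isHermitian_conjTranspose_mul_mul R hQ
    rwa [hR.eq] at this
  have h5 : Q ≤ ‖R * Q * R‖ • A := by
    have := star_left_conjugate_le_conjugate (le_norm_smul_one hB) W
    rw [← h4, star_eq_conjTranspose, hW.eq, mul_smul_comm, smul_mul_assoc, mul_one] at this
    rwa [psdSqrt_mul_self hA] at this
  -- The added 1 keeps the constant positive when `Q = 0`.
  refine ⟨‖R * Q * R‖ + 1, by positivity, h5.trans ?_⟩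
  rw [add_smul, one_smul]
  exact le_add_of_nonneg_right (nonneg_iff.2 hA)

end MatrixBounds

/-! ### Products of tensors, the dual transfer operator, and injectivity -/

section Chains

variable {ι : Type} [Fintype ι] {D : ℕ}

theorem chainTensor_one (T : ι → Matrix (Fin D) (Fin D) ℂ) (s : Fin 1 → ι) :
    chainTensor T 1 s = T (s 0) := by simp [chainTensor]

theorem chainTensor_cons (T : ι → Matrix (Fin D) (Fin D) ℂ) (m : ℕ) (j : ι) (s : Fin m → ι) :
    chainTensor T (m + 1) (Fin.cons j s : Fin (m + 1) → ι) = T j * chainTensor T m s := by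
  simp [chainTensor, List.ofFn_succ]

theorem exists_cons {m : ℕ} (s : Fin (m + 1) → ι) :
    ∃ (j : ι) (t : Fin m → ι), s = (Fin.cons j t : Fin (m + 1) → ι) :=
  ⟨s 0, Fin.tail s, (Fin.cons_self_tail s).symm⟩

theorem sum_cons {M : Type*} [AddCommMonoid M] {m : ℕ} (f : (Fin (m + 1) → ι) → M) :
    ∑ s, f s = ∑ t : Fin m → ι, ∑ j : ι, f (Fin.cons j t : Fin (m + 1) → ι) := by
  rw [← (Fin.consEquiv fun _ => ι).sum_comp, Fintype.sum_prod_type_right]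
  rfl

theorem chainTensor_append (T : ι → Matrix (Fin D) (Fin D) ℂ) (k m : ℕ) (s : Fin k → ι)
    (t : Fin m → ι) :
    chainTensor T (k + m) (Fin.append s t) = chainTensor T k s * chainTensor T m t := by
  unfold chainTensor
  rw [← List.prod_append, ← List.ofFn_fin_append]
  congr 2
  ext i
  refine Fin.addCases (fun i => ?_) (fun i => ?_) i <;> simp

/-- The Heisenberg-picture transfer operator `f ↦ ∑_j T_j† f T_j`. -/
def dualOp (T : ι → Matrix (Fin D) (Fin D) ℂ) : Module.End ℂ (Matrix (Fin D) (Fin D) ℂ) :=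
  ∑ j, LinearMap.mulLeftRight ℂ ((T j)ᴴ, T j)

theorem dualOp_apply (T : ι → Matrix (Fin D) (Fin D) ℂ) (f : Matrix (Fin D) (Fin D) ℂ) :
    dualOp T f = ∑ j, (T j)ᴴ * f * T j := by
  simp [dualOp]

theorem transferOp_apply (T : ι → Matrix (Fin D) (Fin D) ℂ) (f : Matrix (Fin D) (Fin D) ℂ) :
    transferOp T f = ∑ j, T j * f * (T j)ᴴ := by
  simp [transferOp]

theorem dualOp_pow_apply (T : ι → Matrix (Fin D) (Fin D) ℂ) (m : ℕ)
    (f : Matrix (Fin D) (Fin D) ℂ) :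
    (dualOp T ^ m) f = ∑ s : Fin m → ι, (chainTensor T m s)ᴴ * f * chainTensor T m s := by
  induction m generalizing f with
  | zero => simp [chainTensor]
  | succ m ih =>
    rw [pow_succ, Module.End.mul_apply, ih, sum_cons]
    simp only [dualOp_apply, chainTensor_cons,
      Matrix.conjTranspose_mul, Finset.mul_sum, Finset.sum_mul, Matrix.mul_assoc]

/-- The left bond is the input and the right bond the output of the dual map. Under this reshuffling
the map `f ↦ tr(τ f) 1` becomes `τᵀ ⊗ 1`. -/
theorem boundaryState_apply (T : ι → Matrix (Fin D) (Fin D) ℂ) (m : ℕ) (p q : Fin D × Fin D) :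
    boundaryState T m p q = (dualOp T ^ m) (Matrix.single p.1 q.1 1) p.2 q.2 := by
  simp [boundaryState, boundaryMap, dualOp_pow_apply, Matrix.mul_apply,
    Matrix.sum_apply, Matrix.single_apply, ite_and]

theorem InjectiveOn.boundaryState_posDef {T : ι → Matrix (Fin D) (Fin D) ℂ} {m : ℕ}
    (h : InjectiveOn T m) : (boundaryState T m).PosDef :=
  PosDef.conjTranspose_mul_self _ h

/-- Linear maps are determined by their values on the tensors of an injective chain. -/
theorem InjectiveOn.linearMap_eq_zero {T : ι → Matrix (Fin D) (Fin D) ℂ} {m : ℕ}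
    (h : InjectiveOn T m) (F : Matrix (Fin D) (Fin D) ℂ →ₗ[ℂ] ℂ)
    (hF : ∀ s, F (chainTensor T m s) = 0) : F = 0 := by
  have key : ∀ M, F M = ∑ p : Fin D × Fin D, M p.1 p.2 * F (Matrix.single p.1 p.2 1) := by
    intro M
    conv_lhs => rw [Matrix.matrix_eq_sum_single M]
    simp only [map_sum, Fintype.sum_prod_type]
    refine Finset.sum_congr rfl fun i _ => Finset.sum_congr rfl fun j _ => ?_
    rw [← smul_eq_mul, ← map_smul, smul_single, smul_eq_mul, mul_one]
  have h0 : (fun p : Fin D × Fin D => F (Matrix.single p.1 p.2 1)) = 0 := by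
    refine h ?_
    rw [mulVec_zero]
    ext s
    rw [Pi.zero_apply, ← hF s, key]
    rfl
  ext M
  rw [key]
  simp [fun p => congrFun h0 p]

theorem InjectiveOn.linearMap_matrix_eq_zero {T : ι → Matrix (Fin D) (Fin D) ℂ} {m : ℕ}
    (h : InjectiveOn T m) {α β : Type} (F : Matrix (Fin D) (Fin D) ℂ →ₗ[ℂ] Matrix α β ℂ)
    (hF : ∀ s, F (chainTensor T m s) = 0) (M : Matrix (Fin D) (Fin D) ℂ) : F M = 0 := by
  ext a b
  have := h.linearMap_eq_zero (Matrix.entryLinearMap ℂ ℂ a b ∘ₗ F) (fun s => by simp [hF s])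
  exact congrFun (congrArg DFunLike.coe this) M

/-- A boundary vector is a linear functional on matrices, and `V` evaluates it on the chain tensors.
This is the converse of `InjectiveOn.linearMap_eq_zero`. -/
theorem injectiveOn_of_linearMap {T : ι → Matrix (Fin D) (Fin D) ℂ} {m : ℕ}
    (h : ∀ F : Matrix (Fin D) (Fin D) ℂ →ₗ[ℂ] ℂ, (∀ s, F (chainTensor T m s) = 0) → F = 0) :
    InjectiveOn T m := by
  intro X Y hXY
  rw [← sub_eq_zero] at hXY ⊢
  rw [← mulVec_sub] at hXY
  have := h (∑ p : Fin D × Fin D, (X - Y) p • Matrix.entryLinearMap ℂ ℂ p.1 p.2) (fun s => by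
    have := congrFun hXY s
    simpa [boundaryMap, mulVec, dotProduct, mul_comm] using this)
  ext p
  have h2 := congrArg (fun F => F (Matrix.single p.1 p.2 1)) this
  have h3 : ∀ q : Fin D × Fin D, (Matrix.single p.1 p.2 (1 : ℂ)) q.1 q.2 = if p = q then 1 else 0 := by
    intro q; simp [Matrix.single_apply, Prod.ext_iff]
  simpa [h3] using h2

/-- A functional vanishing on length `m + 1` vanishes on every `T j * N`, since the tensors of
length `m` span. Each tensor of length `m ≥ 1` starts with some `T j`, so the functional also
vanishes on all products `chainTensor T m s * M`, and by spanning again everywhere. For `m = 0`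
there is no first letter to split off. -/
theorem InjectiveOn.succ {T : ι → Matrix (Fin D) (Fin D) ℂ} {m : ℕ} (hm : 0 < m)
    (h : InjectiveOn T m) : InjectiveOn T (m + 1) := by
  refine injectiveOn_of_linearMap fun F hF => ?_
  have h1 : ∀ j, F ∘ₗ LinearMap.mulLeft ℂ (T j) = 0 := fun j =>
    h.linearMap_eq_zero _ fun s => by
      have := hF (Fin.cons j s : Fin (m + 1) → ι)
      rwa [chainTensor_cons] at this
  have h2 : ∀ M, F ∘ₗ LinearMap.mulRight ℂ M = 0 := fun M =>
    h.linearMap_eq_zero _ fun s => by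
      obtain ⟨m, rfl⟩ := Nat.exists_eq_succ_of_ne_zero hm.ne'
      obtain ⟨j, t, rfl⟩ := exists_cons s
      have := LinearMap.congr_fun (h1 j) (chainTensor T m t * M)
      simpa [chainTensor_cons, mul_assoc] using this
  ext M
  simpa using LinearMap.congr_fun (h2 M) 1

theorem InjectiveOn.mono {T : ι → Matrix (Fin D) (Fin D) ℂ} {m n : ℕ} (hm : 0 < m)
    (h : InjectiveOn T m) (hmn : m ≤ n) : InjectiveOn T n := by
  induction n, hmn using Nat.le_induction with
  | base => exact h
  | succ n hn ih => exact ih.succ (hm.trans_le hn)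

theorem chainTensor_gauge (T : ι → Matrix (Fin D) (Fin D) ℂ) (Z : (Matrix (Fin D) (Fin D) ℂ)ˣ)
    (μ : ℝ) (m : ℕ) (s : Fin m → ι) :
    chainTensor (gauge Z μ T) m s =
      ((μ ^ m : ℝ) : ℂ) • ((Z : Matrix (Fin D) (Fin D) ℂ) * chainTensor T m s * (↑Z⁻¹ : Matrix (Fin D) (Fin D) ℂ)) := by
  induction m with
  | zero => simp [chainTensor]
  | succ m ih =>
    obtain ⟨j, t, rfl⟩ := exists_cons s
    simp only [chainTensor_cons, ih]
    simp only [gauge, smul_mul_assoc, mul_smul_comm, smul_smul, mul_assoc, Units.inv_mul_cancel_left]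
    congr 1
    push_cast; ring

theorem InjectiveOn.gauge {T : ι → Matrix (Fin D) (Fin D) ℂ} {m : ℕ} (h : InjectiveOn T m)
    (Z : (Matrix (Fin D) (Fin D) ℂ)ˣ) {μ : ℝ} (hμ : μ ≠ 0) : InjectiveOn (gauge Z μ T) m := by
  refine injectiveOn_of_linearMap fun F hF => ?_
  have h1 := h.linearMap_eq_zero (F ∘ₗ LinearMap.mulLeftRight ℂ
    ((Z : Matrix (Fin D) (Fin D) ℂ), (↑Z⁻¹ : Matrix (Fin D) (Fin D) ℂ))) fun s => by
      have := hF s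
      rw [chainTensor_gauge, map_smul, smul_eq_zero] at this
      have h0 : ((μ ^ m : ℝ) : ℂ) ≠ 0 := by exact_mod_cast pow_ne_zero m hμ
      simpa using this.resolve_left h0
  ext M
  have := LinearMap.congr_fun h1 ((↑Z⁻¹ : Matrix (Fin D) (Fin D) ℂ) * M * Z)
  simpa [mul_assoc] using this

end Chains

/-! ### Perron eigenvectors of primitive positive maps -/

section Perron

variable {D : ℕ}

theorem real_smul_nonneg {n : Type} [Fintype n] [DecidableEq n] {r : ℝ} (hr : 0 ≤ r)
    {A : Matrix n n ℂ} (hA : 0 ≤ A) : 0 ≤ r • A :=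
  nonneg_iff.2 ((nonneg_iff.1 hA).smul hr)

theorem real_smul_le_smul {n : Type} [Fintype n] [DecidableEq n] {r : ℝ} (hr : 0 ≤ r)
    {A B : Matrix n n ℂ} (h : A ≤ B) : r • A ≤ r • B := by
  have := real_smul_nonneg hr (sub_nonneg.2 h)
  rwa [smul_sub, sub_nonneg] at this

theorem norm_le_trace {n : Type} [Fintype n] [DecidableEq n] {X : Matrix n n ℂ}
    (hX : X.PosSemidef) : ‖X‖ ≤ X.trace.re := by
  have htr : X.trace.re = ∑ i, hX.isHermitian.eigenvalues i := by
    rw [hX.isHermitian.trace_eq_sum_eigenvalues]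
    simp
  have h0 : 0 ≤ X.trace.re := by
    rw [htr]; exact Finset.sum_nonneg fun i _ => hX.eigenvalues_nonneg i
  rw [CStarAlgebra.norm_le_iff_le_algebraMap X h0 (nonneg_iff.2 hX)]
  refine le_algebraMap_of_spectrum_le ?_ hX.isHermitian
  intro x hx
  rw [hX.isHermitian.spectrum_real_eq_range_eigenvalues] at hx
  obtain ⟨i, rfl⟩ := hx
  rw [htr]
  exact Finset.single_le_sum (fun i _ => hX.eigenvalues_nonneg i) (Finset.mem_univ i)

theorem isCompact_states (n : Type) [Fintype n] [DecidableEq n] :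
    IsCompact {X : Matrix n n ℂ | 0 ≤ X ∧ X.trace = 1} := by
  have : ProperSpace (Matrix n n ℂ) := FiniteDimensional.proper ℂ _
  refine Metric.isCompact_of_isClosed_isBounded ?_ ?_
  · refine IsClosed.inter (CStarAlgebra.isClosed_nonneg) ?_
    have : Continuous (Matrix.traceLinearMap n ℂ ℂ) := LinearMap.continuous_of_finiteDimensional _
    exact isClosed_eq this continuous_const
  · refine (Metric.isBounded_closedBall (x := 0) (r := 1)).subset fun X hX => ?_
    have := norm_le_trace (nonneg_iff.1 hX.1)
    rw [hX.2] at this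
    simpa using this

theorem trace_re_pos {n : Type} [Fintype n] [DecidableEq n] {X : Matrix n n ℂ}
    (hX : 0 ≤ X) (h0 : X ≠ 0) : 0 < X.trace.re := by
  have h := nonneg_iff.1 hX
  have h1 := h.trace_nonneg
  have h2 : X.trace ≠ 0 := fun h3 => h0 (h.trace_eq_zero_iff.1 h3)
  rcases lt_or_eq_of_le (Complex.le_def.1 h1).1 with h3 | h3
  · exact h3
  · exact absurd (Complex.ext h3.symm (Complex.le_def.1 h1).2.symm) h2

theorem trace_eq_re {n : Type} [Fintype n] [DecidableEq n] {X : Matrix n n ℂ}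
    (hX : 0 ≤ X) : X.trace = (X.trace.re : ℂ) := by
  have h1 := (nonneg_iff.1 hX).trace_nonneg
  exact Complex.ext rfl (Complex.le_def.1 h1).2.symm

/-- Perron eigenvector of a primitive positive map (Collatz–Wielandt argument). -/
theorem exists_perron_eigenvector (hD : 0 < D) (Φ : Module.End ℂ (Matrix (Fin D) (Fin D) ℂ))
    (hpos : ∀ f, 0 ≤ f → 0 ≤ Φ f) {L : ℕ} (hL : 0 < L)
    (hprim : ∀ f, 0 ≤ f → f ≠ 0 → ((Φ ^ L) f).PosDef) :
    ∃ r : ℝ, 0 < r ∧ ∃ X : Matrix (Fin D) (Fin D) ℂ, X.PosDef ∧ Φ X = r • X := by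
  have : NeZero D := ⟨hD.ne'⟩
  have hΦ : Continuous Φ := LinearMap.continuous_of_finiteDimensional _
  have htr : Continuous (Matrix.traceLinearMap (Fin D) ℂ ℂ) :=
    LinearMap.continuous_of_finiteDimensional _
  have hsmul : ∀ (r : ℝ) X, Φ (r • X) = r • Φ X := fun r X => by
    rw [← Complex.coe_smul, map_smul, Complex.coe_smul]
  have hsmulL : ∀ (r : ℝ) X, (Φ ^ L) (r • X) = r • (Φ ^ L) X := fun r X => by
    rw [← Complex.coe_smul, map_smul, Complex.coe_smul]
  have hposL : ∀ f, 0 ≤ f → 0 ≤ (Φ ^ L) f := by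
    intro f hf
    clear hprim hL hsmulL
    induction L generalizing f with
    | zero => simpa
    | succ n ih => rw [pow_succ, Module.End.mul_apply]; exact ih _ (hpos _ hf)
  set K := {X : Matrix (Fin D) (Fin D) ℂ | 0 ≤ X ∧ X.trace = 1} with hKdef
  have hK : IsCompact K := isCompact_states (Fin D)
  -- Taking traces in `r X ≤ Φ X` bounds `r` by the trace of `Φ X`, which is bounded on the compact
  -- set of states.
  obtain ⟨c, hc⟩ := (hK.image (f := fun X => (Φ X).trace.re)
    (Complex.continuous_re.comp (htr.comp hΦ))).bddAbove
  have hbound : ∀ (r : ℝ) X, X ∈ K → r • X ≤ Φ X → r ≤ c := by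
    intro r X hX h
    refine le_trans ?_ (hc ⟨X, hX, rfl⟩)
    have := (nonneg_iff.1 (sub_nonneg.2 h)).trace_nonneg
    rw [trace_sub, trace_smul, hX.2] at this
    have := (Complex.le_def.1 this).1
    simpa using this
  have hC : IsCompact {p : ℝ × Matrix (Fin D) (Fin D) ℂ |
      (p.1 ∈ Set.Icc 0 c ∧ p.2 ∈ K) ∧ 0 ≤ Φ p.2 - p.1 • p.2} := by
    refine (isCompact_Icc.prod hK).inter_right ?_
    refine (CStarAlgebra.isClosed_nonneg (A := Matrix (Fin D) (Fin D) ℂ)).preimage ?_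
    exact (hΦ.comp continuous_snd).sub (continuous_fst.smul continuous_snd)
  have hne : ∃ X, X ∈ K := by
    refine ⟨(D : ℝ)⁻¹ • 1, real_smul_nonneg (by positivity) (nonneg_iff.2 PosSemidef.one), ?_⟩
    rw [trace_smul, trace_one, Fintype.card_fin, ← Complex.coe_smul]
    have : (D : ℂ) ≠ 0 := by exact_mod_cast hD.ne'
    simp [this]
  obtain ⟨X₀, hX₀⟩ := hne
  have hc0 : 0 ≤ c := hbound 0 X₀ hX₀ (by simpa using hpos _ hX₀.1)
  -- The Collatz–Wielandt number: the largest `r` for which some state satisfies `r X ≤ Φ X`.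
  obtain ⟨⟨r, X⟩, ⟨⟨hr, hX⟩, hrX⟩, hmax⟩ := hC.exists_isMaxOn
    ⟨(0, X₀), ⟨⟨⟨le_rfl, hc0⟩, hX₀⟩, by simpa using hpos _ hX₀.1⟩⟩ continuous_fst.continuousOn
  simp only at hr hX hrX
  have hmax' : ∀ (r' : ℝ) X', 0 ≤ r' → 0 ≤ X' → X' ≠ 0 → r' • X' ≤ Φ X' → r' ≤ r := by
    intro r' X' h0 hX' hne h
    have ht := trace_re_pos hX' hne
    have hY : (X'.trace.re)⁻¹ • X' ∈ K := by
      refine ⟨real_smul_nonneg (inv_nonneg.2 ht.le) hX', ?_⟩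
      rw [trace_smul, trace_eq_re hX', ← Complex.coe_smul]
      have : (X'.trace.re : ℂ) ≠ 0 := by exact_mod_cast ht.ne'
      simp [this]
    have hle : r' • ((X'.trace.re)⁻¹ • X') ≤ Φ ((X'.trace.re)⁻¹ • X') := by
      rw [hsmul, smul_comm]
      exact real_smul_le_smul (inv_nonneg.2 ht.le) h
    have hb := hbound _ _ hY hle
    generalize (X'.trace.re)⁻¹ • X' = Y at hY hle hb
    exact isMaxOn_iff.1 hmax (r', Y) ⟨⟨⟨h0, hb⟩, hY⟩, sub_nonneg.2 hle⟩
  have hX0 : X ≠ 0 := by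
    rintro rfl
    simpa using hX.2
  have heq : Φ X = r • X := by
    -- A nonzero defect `Φ X - r X` becomes positive definite under `Φ ^ L`, so `X' = (Φ ^ L) X`
    -- satisfies the inequality with a strictly larger `r`, against maximality.
    by_contra hne
    have h1 := hprim _ hrX (sub_ne_zero.2 hne)
    have h2 := hprim X hX.1 hX0
    obtain ⟨κ, hκ, h3⟩ := exists_smul_one_le h1
    have h4 : Φ ((Φ ^ L) X) - r • (Φ ^ L) X = (Φ ^ L) (Φ X - r • X) := by
      rw [map_sub, hsmulL, ← Module.End.mul_apply, ← Module.End.mul_apply, ← pow_succ', pow_succ]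
    set X' := (Φ ^ L) X
    have h5 := le_norm_smul_one h2.isHermitian
    have h6 : ‖X'‖ ≠ 0 := norm_ne_zero_iff.2 (by
      intro h
      have := h2.trace_pos
      rw [h] at this
      simp at this)
    have h7 : (κ / ‖X'‖) • X' ≤ κ • 1 := by
      calc (κ / ‖X'‖) • X' ≤ (κ / ‖X'‖) • (‖X'‖ • 1) := real_smul_le_smul (by positivity) h5
        _ = _ := by rw [smul_smul, div_mul_cancel₀ _ h6]
    have h8 : (r + κ / ‖X'‖) • X' ≤ Φ X' := by
      rw [add_smul, ← le_sub_iff_add_le', h4]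
      exact h7.trans h3
    have h9 := hmax' _ X' (by have := hr.1; positivity) (nonneg_iff.2 h2.posSemidef) (norm_ne_zero_iff.1 h6) h8
    have : 0 < κ / ‖X'‖ := by positivity
    linarith
  have hpow : ∀ n : ℕ, (Φ ^ n) X = (r ^ n) • X := by
    intro n
    induction n with
    | zero => simp
    | succ n ih => rw [pow_succ', Module.End.mul_apply, ih, hsmul, heq, smul_smul, pow_succ]
  have h2 := hprim X hX.1 hX0
  rw [hpow] at h2
  have hr0 : 0 < r := by
    rcases hr.1.eq_or_lt with h | h
    · rw [← h, zero_pow hL.ne', zero_smul] at h2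
      simpa using h2.trace_pos
    · exact h
  refine ⟨r, hr0, X, ?_, heq⟩
  have := h2.smul (a := (r ^ L)⁻¹) (by positivity)
  rwa [smul_smul, inv_mul_cancel₀ (by positivity), one_smul] at this

end Perron

/-! ### Spectral radius and geometric decay of powers -/

section Gelfand

/-- An eventual geometric bound holds from the start with a larger constant. -/
theorem exists_le_mul_pow {f : ℕ → ℝ} {γ c : ℝ} (hγ : 0 < γ) {N : ℕ}
    (h : ∀ m, N ≤ m → f m ≤ c * γ ^ m) : ∃ c' : ℝ, 0 < c' ∧ ∀ m, f m ≤ c' * γ ^ m := by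
  refine ⟨1 + |c| + ∑ m ∈ Finset.range N, |f m| / γ ^ m, by positivity, fun m => ?_⟩
  have h1 : 0 ≤ ∑ m ∈ Finset.range N, |f m| / γ ^ m := by positivity
  rcases le_or_gt N m with hm | hm
  · refine (h m hm).trans ?_
    gcongr
    linarith [le_abs_self c]
  · have h2 : |f m| / γ ^ m ≤ ∑ m ∈ Finset.range N, |f m| / γ ^ m :=
      Finset.single_le_sum (f := fun m => |f m| / γ ^ m) (fun _ _ => by positivity)
        (Finset.mem_range.2 hm)
    rw [← div_le_iff₀ (by positivity)]
    have h3 : f m / γ ^ m ≤ |f m| / γ ^ m := by gcongr; exact le_abs_self _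
    linarith [abs_nonneg c]

variable {A : Type*} [NormedRing A] [NormedAlgebra ℂ A] [CompleteSpace A]

/-- For any rate strictly between the spectral radius and 1, Gelfand's formula gives the bound for
large powers; the constant absorbs the others. -/
theorem exists_norm_pow_le_of_spectralRadius_lt_one {a : A} (h : spectralRadius ℂ a < 1) :
    ∃ c γ : ℝ, 0 < c ∧ 0 < γ ∧ γ < 1 ∧ ∀ m : ℕ, ‖a ^ m‖ ≤ c * γ ^ m := by
  obtain ⟨γ', h1, h2⟩ := exists_between h
  lift γ' to NNReal using (h2.trans ENNReal.one_lt_top).ne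
  have hγ0 : 0 < (γ' : ℝ) := by
    have := (zero_le.trans_lt h1)
    exact_mod_cast this
  have hγ1 : (γ' : ℝ) < 1 := by exact_mod_cast h2
  have h3 := (spectrum.pow_nnnorm_pow_one_div_tendsto_nhds_spectralRadius a).eventually_lt_const h1
  obtain ⟨M, hM⟩ := eventually_atTop.1 h3
  have h4 : ∀ m, M + 1 ≤ m → ‖a ^ m‖ ≤ (γ' : ℝ) ^ m := by
    intro m hm
    have h5 := (hM m (by omega)).le
    have hm0 : (m : ℝ) ≠ 0 := by
      have : m ≠ 0 := by omega
      exact_mod_cast this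
    have h6 := ENNReal.rpow_le_rpow h5 (Nat.cast_nonneg m)
    rw [← ENNReal.rpow_mul, one_div_mul_cancel hm0, ENNReal.rpow_one, ENNReal.rpow_natCast] at h6
    exact_mod_cast h6
  obtain ⟨c, hc, h5⟩ := exists_le_mul_pow (f := fun m => ‖a ^ m‖) hγ0 (N := M + 1) (c := 1)
    fun m hm => by simpa using h4 m hm
  exact ⟨c, γ', hc, hγ0, hγ1, h5⟩

end Gelfand

/-! ### From eigenvalues in the open disc to decay in finite dimension -/

section Endomorphisms

variable {E : Type*} [NormedAddCommGroup E] [NormedSpace ℂ E] [FiniteDimensional ℂ E]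

/-- A linear map all of whose eigenvalues lie in the open unit disc has exponentially decaying
powers. -/
theorem exists_pow_decay (G : Module.End ℂ E) (hG : ∀ z, G.HasEigenvalue z → ‖z‖ < 1) :
    ∃ c γ : ℝ, 0 < c ∧ 0 < γ ∧ γ < 1 ∧
      ∀ m : ℕ, ‖Module.End.toContinuousLinearMap E (G ^ m)‖ ≤ c * γ ^ m := by
  have : CompleteSpace E := FiniteDimensional.complete ℂ E
  have h : spectralRadius ℂ (Module.End.toContinuousLinearMap E G) < 1 := by
    rcases subsingleton_or_nontrivial E with h0 | h0
    · simp [spectrum.SpectralRadius.of_subsingleton]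
    obtain ⟨z, hz, h1⟩ := spectrum.exists_nnnorm_eq_spectralRadius
      (Module.End.toContinuousLinearMap E G)
    rw [AlgEquiv.spectrum_eq, ← Module.End.hasEigenvalue_iff_mem_spectrum] at hz
    rw [← h1]
    exact_mod_cast hG z hz
  simpa only [map_pow] using exists_norm_pow_le_of_spectralRadius_lt_one h

end Endomorphisms

/-! ### Primitivity of the transfer operators, the unital gauge and the stationary state -/

section Primitivity

variable {ι : Type} [Fintype ι] {D : ℕ}

theorem posDef_sum_conjTranspose_mul_mul {κ : Type} [Fintype κ]
    (A : κ → Matrix (Fin D) (Fin D) ℂ) {f : Matrix (Fin D) (Fin D) ℂ} (hf : 0 ≤ f)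
    (h : ∀ x : Fin D → ℂ, (∀ s, f *ᵥ (A s *ᵥ x) = 0) → x = 0) :
    (∑ s, (A s)ᴴ * f * A s).PosDef := by
  have hf' := nonneg_iff.1 hf
  have hpsd : ∀ s, ((A s)ᴴ * f * A s).PosSemidef := fun s => hf'.conjTranspose_mul_mul_same _
  refine PosDef.of_dotProduct_mulVec_pos (posSemidef_sum _ fun s _ => hpsd s).isHermitian ?_
  intro x hx
  have hterm : ∀ s, star x ⬝ᵥ (((A s)ᴴ * f * A s) *ᵥ x) = star (A s *ᵥ x) ⬝ᵥ (f *ᵥ (A s *ᵥ x)) := by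
    intro s
    rw [star_mulVec, ← mulVec_mulVec, ← mulVec_mulVec, dotProduct_mulVec (star x)]
  rw [sum_mulVec, dotProduct_sum]
  refine lt_of_le_of_ne (Finset.sum_nonneg fun s _ => (hpsd s).dotProduct_mulVec_nonneg x) fun h0 => ?_
  refine hx (h x fun s => ?_)
  have := (Finset.sum_eq_zero_iff_of_nonneg fun s _ => (hpsd s).dotProduct_mulVec_nonneg x).1 h0.symm s
    (Finset.mem_univ s)
  rw [hterm] at this
  exact (hf'.dotProduct_mulVec_zero_iff _).1 this

/-- If `x` is a null vector of the image, then `f A x = 0` for all chain tensors `A`, hence for all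
matrices `A` by spanning. Matrix units then show that every entry of `f` times every entry of `x`
vanishes. -/
theorem InjectiveOn.dualOp_pow_posDef {T : ι → Matrix (Fin D) (Fin D) ℂ} {L : ℕ}
    (hT : InjectiveOn T L) (f : Matrix (Fin D) (Fin D) ℂ) (hf : 0 ≤ f) (hf0 : f ≠ 0) :
    ((dualOp T ^ L) f).PosDef := by
  rw [dualOp_pow_apply]
  refine posDef_sum_conjTranspose_mul_mul _ hf fun x hx => ?_
  have h := hT.linearMap_matrix_eq_zero
    (LinearMap.mulRight ℂ (replicateCol (Fin D) x) ∘ₗ LinearMap.mulLeft ℂ f)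
    (fun s => by
      ext i j
      have := congrFun (hx s) i
      rw [mulVec_mulVec] at this
      exact this)
  by_contra hx0
  obtain ⟨j, hj⟩ := Function.ne_iff.1 hx0
  refine hf0 ?_
  ext a i
  have := congrFun (congrFun (h (Matrix.single i j 1)) a) a
  simp [Matrix.mul_apply, Matrix.single_apply, ite_and] at this
  exact this.resolve_right hj

theorem InjectiveOn.transferOp_pow_posDef {T : ι → Matrix (Fin D) (Fin D) ℂ} {L : ℕ}
    (hT : InjectiveOn T L) (f : Matrix (Fin D) (Fin D) ℂ) (hf : 0 ≤ f) (hf0 : f ≠ 0) :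
    ((transferOp T ^ L) f).PosDef := by
  rw [transferOp_pow_apply]
  have := posDef_sum_conjTranspose_mul_mul (fun s => (chainTensor T L s)ᴴ) hf fun x hx => ?_
  · simpa using this
  have h := hT.linearMap_matrix_eq_zero
    (LinearMap.mulRight ℂ f ∘ₗ LinearMap.mulLeft ℂ (replicateCol (Fin D) x)ᴴ)
    (fun s => by
      have h2 : f * ((chainTensor T L s)ᴴ * replicateCol (Fin D) x) = 0 := by
        ext i j
        exact congrFun (hx s) i
      have h3 := congrArg conjTranspose h2
      rw [conjTranspose_mul, conjTranspose_mul, conjTranspose_conjTranspose,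
        (nonneg_iff.1 hf).isHermitian.eq, conjTranspose_zero] at h3
      exact h3)
  by_contra hx0
  obtain ⟨j, hj⟩ := Function.ne_iff.1 hx0
  refine hf0 ?_
  ext i a
  have := congrFun (congrFun (h (Matrix.single j i 1)) j) a
  simp [Matrix.mul_apply, Matrix.single_apply, ite_and] at this
  exact this.resolve_left hj

theorem dualOp_nonneg (T : ι → Matrix (Fin D) (Fin D) ℂ) (f : Matrix (Fin D) (Fin D) ℂ)
    (hf : 0 ≤ f) : 0 ≤ dualOp T f := by
  rw [dualOp_apply]
  exact nonneg_iff.2 (posSemidef_sum _ fun s _ => (nonneg_iff.1 hf).conjTranspose_mul_mul_same _)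

theorem transferOp_nonneg (T : ι → Matrix (Fin D) (Fin D) ℂ) (f : Matrix (Fin D) (Fin D) ℂ)
    (hf : 0 ≤ f) : 0 ≤ transferOp T f := by
  rw [transferOp_apply]
  exact nonneg_iff.2 (posSemidef_sum _ fun s _ => (nonneg_iff.1 hf).mul_mul_conjTranspose_same _)

/-- An injective MPS has a gauge in which its transfer operator is trace preserving. -/
theorem InjectiveOn.exists_gauge_dualOp_one {T : ι → Matrix (Fin D) (Fin D) ℂ} {L : ℕ}
    (hD : 0 < D) (hL : 0 < L) (hT : InjectiveOn T L) :
    ∃ (Z : (Matrix (Fin D) (Fin D) ℂ)ˣ) (μ : ℝ), 0 < μ ∧ dualOp (MPS.gauge Z μ T) 1 = 1 := by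
  obtain ⟨r, hr, X, hX, h⟩ := exists_perron_eigenvector hD (dualOp T) (dualOp_nonneg T) hL
    hT.dualOp_pow_posDef
  -- With `Z = X^{1/2}` and `μ = r^{-1/2}` the eigenvalue equation `dualOp T X = r X` becomes
  -- unitality.
  refine ⟨⟨psdSqrt X, psdInvSqrt X, psdSqrt_mul_psdInvSqrt hX, psdInvSqrt_mul_psdSqrt hX⟩,
    (Real.sqrt r)⁻¹, by positivity, ?_⟩
  have h1 : ∀ j, (MPS.gauge ⟨psdSqrt X, psdInvSqrt X, psdSqrt_mul_psdInvSqrt hX,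
      psdInvSqrt_mul_psdSqrt hX⟩ (Real.sqrt r)⁻¹ T j)ᴴ * 1 * MPS.gauge ⟨psdSqrt X, psdInvSqrt X,
        psdSqrt_mul_psdInvSqrt hX, psdInvSqrt_mul_psdSqrt hX⟩ (Real.sqrt r)⁻¹ T j
      = r⁻¹ • (psdInvSqrt X * ((T j)ᴴ * X * T j) * psdInvSqrt X) := by
    intro j
    have h2 : (Real.sqrt r)⁻¹ * (Real.sqrt r)⁻¹ = r⁻¹ := by
      rw [← mul_inv, Real.mul_self_sqrt hr.le]
    conv_rhs => enter [2, 1, 2, 1, 2]; rw [← psdSqrt_mul_self hX.posSemidef]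
    simp only [MPS.gauge, Units.inv_mk, mul_one, conjTranspose_smul, conjTranspose_mul,
      (psdSqrt_isHermitian X).eq, (psdInvSqrt_isHermitian X).eq, smul_mul_assoc, mul_smul_comm,
      smul_smul, RCLike.star_def, conj_trivial, h2, Complex.coe_smul, mul_assoc]
  rw [dualOp_apply, Finset.sum_congr rfl fun j _ => h1 j, ← Finset.smul_sum, ← Finset.sum_mul,
    ← Finset.mul_sum, ← dualOp_apply, h, mul_smul_comm, smul_mul_assoc, smul_smul,
    inv_mul_cancel₀ hr.ne', one_smul, psdInvSqrt_mul_mul_psdInvSqrt hX]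

theorem trace_mul_dualOp (T : ι → Matrix (Fin D) (Fin D) ℂ) (τ f : Matrix (Fin D) (Fin D) ℂ) :
    (τ * dualOp T f).trace = (transferOp T τ * f).trace := by
  rw [dualOp_apply, transferOp_apply, Finset.mul_sum, Finset.sum_mul, trace_sum, trace_sum]
  refine Finset.sum_congr rfl fun j _ => ?_
  rw [← mul_assoc, trace_mul_comm]
  simp only [mul_assoc]

theorem InjectiveOn.exists_fixedPoint {T : ι → Matrix (Fin D) (Fin D) ℂ} {L : ℕ}
    (hD : 0 < D) (hL : 0 < L) (hT : InjectiveOn T L) (h1 : dualOp T 1 = 1) :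
    ∃ τ : Matrix (Fin D) (Fin D) ℂ, τ.PosDef ∧ τ.trace = 1 ∧ transferOp T τ = τ := by
  have : NeZero D := ⟨hD.ne'⟩
  obtain ⟨r, hr, X, hX, h⟩ := exists_perron_eigenvector hD (transferOp T) (transferOp_nonneg T) hL
    hT.transferOp_pow_posDef
  -- Unitality of the dual is trace preservation of the transfer operator, so its Perron eigenvalue
  -- must be 1.
  have ht := trace_mul_dualOp T X 1
  have htX := trace_eq_re (nonneg_iff.2 hX.posSemidef)
  have hpos : 0 < X.trace.re := (Complex.lt_def.1 hX.trace_pos).1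
  rw [h1, h, mul_one, mul_one, trace_smul, htX, ← Complex.coe_smul, smul_eq_mul,
    ← Complex.ofReal_mul, Complex.ofReal_inj] at ht
  have hr1 : r = 1 := by
    rwa [eq_comm, mul_eq_right₀ hpos.ne'] at ht
  refine ⟨(X.trace.re)⁻¹ • X, hX.smul (by positivity), ?_, ?_⟩
  · rw [trace_smul, htX, ← Complex.coe_smul]
    have : (X.trace.re : ℂ) ≠ 0 := by exact_mod_cast hpos.ne'
    simp [this]
  · rw [← Complex.coe_smul, map_smul, h, hr1, one_smul]

end Primitivity

/-! ### Spectral gap of the transfer operator and convergence of the boundary states -/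

section SpectralGap

variable {ι : Type} [Fintype ι] {D : ℕ}

theorem trace_mul_conjTranspose_mul_self_nonneg {τ : Matrix (Fin D) (Fin D) ℂ} (hτ : τ.PosDef)
    (g : Matrix (Fin D) (Fin D) ℂ) : 0 ≤ (τ * (gᴴ * g)).trace.re := by
  have h := (hτ.posSemidef.mul_mul_conjTranspose_same g).trace_nonneg
  rw [trace_mul_comm, ← mul_assoc, trace_mul_comm] at h
  exact (Complex.le_def.1 h).1

theorem trace_mul_conjTranspose_mul_self_eq_zero {τ : Matrix (Fin D) (Fin D) ℂ} (hτ : τ.PosDef)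
    {g : Matrix (Fin D) (Fin D) ℂ} (h : (τ * (gᴴ * g)).trace.re = 0) : g = 0 := by
  by_contra hg
  have h0 : 0 ≤ g * τ * gᴴ := nonneg_iff.2 (hτ.posSemidef.mul_mul_conjTranspose_same g)
  have h1 : g * τ * gᴴ = 0 := by
    by_contra h2
    have := trace_re_pos h0 h2
    rw [trace_mul_comm, ← mul_assoc, trace_mul_comm, h] at this
    exact this.false
  have h2 : (g * psdSqrt τ) * (g * psdSqrt τ)ᴴ = 0 := by
    rw [conjTranspose_mul, (psdSqrt_isHermitian τ).eq, ← h1]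
    conv_rhs => rw [← psdSqrt_mul_self hτ.posSemidef]
    simp only [mul_assoc]
  have h3 : g * psdSqrt τ = 0 := self_mul_conjTranspose_eq_zero.1 h2
  have h4 := congrArg (· * psdInvSqrt τ) h3
  simp only [mul_assoc, psdSqrt_mul_psdInvSqrt hτ, mul_one, zero_mul] at h4
  exact hg h4

theorem dualOp_pow_one {T : ι → Matrix (Fin D) (Fin D) ℂ} (h1 : dualOp T 1 = 1) (m : ℕ) :
    (dualOp T ^ m) 1 = 1 := by
  induction m with
  | zero => simp
  | succ m ih => rw [pow_succ, Module.End.mul_apply, h1, ih]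

theorem trace_mul_dualOp_pow {T : ι → Matrix (Fin D) (Fin D) ℂ} {τ : Matrix (Fin D) (Fin D) ℂ}
    (hτ : transferOp T τ = τ) (m : ℕ) (f : Matrix (Fin D) (Fin D) ℂ) :
    (τ * (dualOp T ^ m) f).trace = (τ * f).trace := by
  induction m with
  | zero => simp
  | succ m ih => rw [pow_succ', Module.End.mul_apply, trace_mul_dualOp, hτ, ih]

/-- The defect in the Kadison–Schwarz inequality for a unital map in Kraus form. -/
theorem sum_trace_kadisonSchwarz {T : ι → Matrix (Fin D) (Fin D) ℂ}
    {τ : Matrix (Fin D) (Fin D) ℂ} (h1 : dualOp T 1 = 1) (hτ : transferOp T τ = τ) (m : ℕ)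
    (f : Matrix (Fin D) (Fin D) ℂ) :
    ∑ s, (τ * ((f * chainTensor T m s - chainTensor T m s * (dualOp T ^ m) f)ᴴ *
        (f * chainTensor T m s - chainTensor T m s * (dualOp T ^ m) f))).trace =
      (τ * (fᴴ * f)).trace - (τ * (((dualOp T ^ m) f)ᴴ * (dualOp T ^ m) f)).trace := by
  set g := (dualOp T ^ m) f with hg
  have hf : ∑ s, (chainTensor T m s)ᴴ * f * chainTensor T m s = g := (dualOp_pow_apply T m f).symm
  have hfs : ∑ s, (chainTensor T m s)ᴴ * fᴴ * chainTensor T m s = gᴴ := by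
    rw [← hf, conjTranspose_sum]
    simp [conjTranspose_mul, mul_assoc]
  have h1' : ∑ s, (chainTensor T m s)ᴴ * 1 * chainTensor T m s = 1 := by
    rw [← dualOp_pow_apply, dualOp_pow_one h1]
  have hff : ∑ s, (chainTensor T m s)ᴴ * (fᴴ * f) * chainTensor T m s = (dualOp T ^ m) (fᴴ * f) :=
    (dualOp_pow_apply T m _).symm
  rw [← trace_mul_dualOp_pow hτ m (fᴴ * f), ← trace_sub, ← mul_sub, ← trace_sum, ← Finset.mul_sum]
  congr 2
  have expand : ∀ A : Matrix (Fin D) (Fin D) ℂ, (f * A - A * g)ᴴ * (f * A - A * g) =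
      Aᴴ * (fᴴ * f) * A - Aᴴ * fᴴ * A * g - gᴴ * (Aᴴ * f * A) + gᴴ * (Aᴴ * 1 * A) * g := by
    intro A
    simp only [conjTranspose_sub, conjTranspose_mul]
    noncomm_ring
  simp only [expand, Finset.sum_add_distrib, Finset.sum_sub_distrib, ← Finset.sum_mul,
    ← Finset.mul_sum, hf, hfs, h1', hff]
  noncomm_ring

/-- On observables of zero mean, all eigenvalues of a primitive unital transfer operator lie in the
open unit disc. -/
theorem InjectiveOn.norm_eigenvalue_lt_one {T : ι → Matrix (Fin D) (Fin D) ℂ} {L : ℕ}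
    (hT : InjectiveOn T L) {τ : Matrix (Fin D) (Fin D) ℂ} (h1 : dualOp T 1 = 1) (hτ : τ.PosDef)
    (htr : τ.trace = 1) (hfix : transferOp T τ = τ) {z : ℂ} {f : Matrix (Fin D) (Fin D) ℂ}
    (hf0 : f ≠ 0) (hf : (τ * f).trace = 0) (hz : dualOp T f = z • f) : ‖z‖ < 1 := by
  by_contra! hz1
  have hpow : ∀ n : ℕ, (dualOp T ^ n) f = z ^ n • f := by
    intro n
    induction n with
    | zero => simp
    | succ n ih => rw [pow_succ', Module.End.mul_apply, ih, map_smul, hz, smul_smul, pow_succ]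
  have key := congrArg Complex.re (sum_trace_kadisonSchwarz h1 hfix L f)
  have h2 : (τ * (((dualOp T ^ L) f)ᴴ * (dualOp T ^ L) f)).trace.re
      = (‖z‖ ^ L) ^ 2 * (τ * (fᴴ * f)).trace.re := by
    rw [hpow, conjTranspose_smul, smul_mul_smul_comm, mul_smul_comm, trace_smul, RCLike.star_def,
      Complex.conj_mul', norm_pow, smul_eq_mul, ← Complex.ofReal_pow, Complex.re_ofReal_mul]
  rw [Complex.sub_re, h2, Complex.re_sum] at key
  have hN := trace_mul_conjTranspose_mul_self_nonneg hτ f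
  -- The Kadison–Schwarz defect is a sum of nonnegative terms; for `‖z‖ ≥ 1` it is also nonpositive,
  -- so every term vanishes.
  have hle : (τ * (fᴴ * f)).trace.re - (‖z‖ ^ L) ^ 2 * (τ * (fᴴ * f)).trace.re ≤ 0 := by
    have : 1 ≤ (‖z‖ ^ L) ^ 2 := one_le_pow₀ (one_le_pow₀ hz1)
    nlinarith
  have hzero := (Finset.sum_eq_zero_iff_of_nonneg fun s _ =>
    trace_mul_conjTranspose_mul_self_nonneg hτ _).1 (le_antisymm (key.trans_le hle)
      (Finset.sum_nonneg fun s _ => trace_mul_conjTranspose_mul_self_nonneg hτ _))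
  set g := (dualOp T ^ L) f
  -- The relation `f A = A g` is linear in `A`, so it extends from chain tensors to all matrices. At
  -- `A = 1` it gives `f = g`, and then `f` is central.
  have hcomm := hT.linearMap_matrix_eq_zero (LinearMap.mulLeft ℂ f - LinearMap.mulRight ℂ g)
    fun s => trace_mul_conjTranspose_mul_self_eq_zero hτ (hzero s (Finset.mem_univ s))
  have hfg : f = g := by simpa [sub_eq_zero] using hcomm 1
  have hmem : f ∈ Set.range (Matrix.scalar (Fin D)) := by
    refine Matrix.mem_range_scalar_of_commute_single fun i j _ => ?_
    have := hcomm (Matrix.single i j 1)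
    rw [← hfg] at this
    exact (sub_eq_zero.1 this).symm
  obtain ⟨c, hc⟩ := hmem
  rw [← hc, Matrix.scalar_apply, ← smul_one_eq_diagonal, mul_smul_comm, mul_one, trace_smul, htr,
    smul_eq_mul, mul_one] at hf
  rw [hf, map_zero] at hc
  exact hf0 hc.symm

/-- The projection `f ↦ tr(τ f) 1` onto the constants. -/
def meanProj (τ : Matrix (Fin D) (Fin D) ℂ) : Module.End ℂ (Matrix (Fin D) (Fin D) ℂ) :=
  (Matrix.traceLinearMap (Fin D) ℂ ℂ ∘ₗ LinearMap.mulLeft ℂ τ).smulRight 1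

theorem meanProj_apply (τ f : Matrix (Fin D) (Fin D) ℂ) :
    meanProj τ f = (τ * f).trace • 1 := rfl

/-- Subtracting the projection `p` onto the constants removes the eigenvalue 1: an eigenvector of `Φ
- p` with nonzero eigenvalue is killed by `p`, so it is an eigenvector of `Φ` of zero mean. -/
theorem InjectiveOn.exists_dualOp_pow_sub_le {T : ι → Matrix (Fin D) (Fin D) ℂ} {L : ℕ}
    (hT : InjectiveOn T L) {τ : Matrix (Fin D) (Fin D) ℂ} (h1 : dualOp T 1 = 1) (hτ : τ.PosDef)
    (htr : τ.trace = 1) (hfix : transferOp T τ = τ) :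
    ∃ c γ : ℝ, 0 < c ∧ 0 < γ ∧ γ < 1 ∧ ∀ m : ℕ,
      ‖Module.End.toContinuousLinearMap _ (dualOp T ^ m - meanProj τ)‖ ≤ c * γ ^ m := by
  set Φ := dualOp T with hΦ
  set p := meanProj τ
  have hΦp : Φ * p = p := by
    ext1 f
    rw [Module.End.mul_apply, meanProj_apply, map_smul, h1]
  have hpΦ : ∀ m : ℕ, p * Φ ^ m = p := by
    intro m
    ext1 f
    rw [Module.End.mul_apply, meanProj_apply, trace_mul_dualOp_pow hfix, ← meanProj_apply]
  have hpp : p * p = p := by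
    ext1 f
    rw [Module.End.mul_apply, meanProj_apply, meanProj_apply, mul_smul_comm, mul_one, trace_smul,
      htr, smul_eq_mul, mul_one]
  have hev : ∀ z, (Φ - p).HasEigenvalue z → ‖z‖ < 1 := by
    intro z hz
    rcases eq_or_ne z 0 with rfl | hz0
    · simp
    obtain ⟨f, hf⟩ := hz.exists_hasEigenvector
    have h2 := hf.apply_eq_smul
    have h3 : p (z • f) = 0 := by
      rw [← h2, ← Module.End.mul_apply, mul_sub, hpp]
      have := hpΦ 1
      rw [pow_one] at this
      rw [this, sub_self, LinearMap.zero_apply]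
    have h4 : p f = 0 := by
      rw [map_smul, smul_eq_zero] at h3
      exact h3.resolve_left hz0
    refine hT.norm_eigenvalue_lt_one h1 hτ htr hfix hf.2 ?_ (z := z) ?_
    · rw [meanProj_apply, smul_eq_zero] at h4
      refine h4.resolve_right fun h5 => ?_
      have : f = 1 * f := (one_mul f).symm
      rw [h5, zero_mul] at this
      exact hf.2 this
    · rwa [LinearMap.sub_apply, h4, sub_zero] at h2
  obtain ⟨c, γ, hc, h0, hγ1, hb⟩ := exists_pow_decay (Φ - p) hev
  -- The factor `1 - p` makes the identity valid at `m = 0` too.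
  have hpow : ∀ m : ℕ, (Φ - p) ^ m * (1 - p) = Φ ^ m - p := by
    intro m
    induction m with
    | zero => simp
    | succ m ih =>
      rw [pow_succ', mul_assoc, ih, sub_mul, mul_sub, mul_sub, hpΦ, hpp, hΦp, ← pow_succ']
      simp
  refine ⟨c * (‖Module.End.toContinuousLinearMap _ (1 - p)‖ + 1), γ, by positivity, h0, hγ1,
    fun m => ?_⟩
  rw [← hpow, map_mul]
  refine (norm_mul_le _ _).trans ?_
  have := hb m
  calc _ ≤ (c * γ ^ m) * (‖Module.End.toContinuousLinearMap _ (1 - p)‖ + 1) := by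
        gcongr
        linarith
    _ = _ := by ring

/-- The boundary states of an injective MPS in the trace-preserving gauge converge exponentially
fast to a product. -/
theorem InjectiveOn.exists_boundaryState_sub_le {T : ι → Matrix (Fin D) (Fin D) ℂ} {L : ℕ}
    (hT : InjectiveOn T L) {τ : Matrix (Fin D) (Fin D) ℂ} (h1 : dualOp T 1 = 1) (hτ : τ.PosDef)
    (htr : τ.trace = 1) (hfix : transferOp T τ = τ) :
    ∃ c γ : ℝ, 0 < c ∧ 0 < γ ∧ γ < 1 ∧ ∀ m : ℕ,
      ‖boundaryState T m - τᵀ ⊗ₖ (1 : Matrix (Fin D) (Fin D) ℂ)‖ ≤ c * γ ^ m := by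
  obtain ⟨c, γ, hc, h0, hγ1, hb⟩ := hT.exists_dualOp_pow_sub_le h1 hτ htr hfix
  let R : (Matrix (Fin D) (Fin D) ℂ →L[ℂ] Matrix (Fin D) (Fin D) ℂ) →ₗ[ℂ]
      Matrix (Fin D × Fin D) (Fin D × Fin D) ℂ :=
    { toFun := fun Ψ => Matrix.of fun p q => Ψ (Matrix.single p.1 q.1 1) p.2 q.2
      map_add' := fun _ _ => rfl
      map_smul' := fun _ _ => rfl }
  have hR : ∀ m, boundaryState T m - τᵀ ⊗ₖ (1 : Matrix (Fin D) (Fin D) ℂ)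
      = R (Module.End.toContinuousLinearMap _ (dualOp T ^ m - meanProj τ)) := by
    intro m
    ext p q
    change boundaryState T m p q - _ =
      ((dualOp T ^ m) (Matrix.single p.1 q.1 1) - meanProj τ (Matrix.single p.1 q.1 1)) p.2 q.2
    rw [boundaryState_apply, Matrix.sub_apply, meanProj_apply, trace_mul_single]
    simp [kroneckerMap_apply]
  set R' := LinearMap.toContinuousLinearMap R
  refine ⟨(‖R'‖ + 1) * c, γ, by positivity, h0, hγ1, fun m => ?_⟩
  rw [hR]
  refine (R'.le_opNorm _).trans ?_
  calc _ ≤ (‖R'‖ + 1) * (c * γ ^ m) := by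
        gcongr
        · linarith
        · exact hb m
    _ = _ := by ring

end SpectralGap

/-! ### Uniform bounds on boundary states and approximate factorization -/

section BoundaryStates

variable {ι : Type} [Fintype ι] {D : ℕ}

theorem InjectiveOn.exists_gauge_boundaryState_sub_le {T : ι → Matrix (Fin D) (Fin D) ℂ} {L : ℕ}
    (hD : 0 < D) (hL : 0 < L) (hT : InjectiveOn T L) :
    ∃ (Z : (Matrix (Fin D) (Fin D) ℂ)ˣ) (μ : ℝ) (σ : Matrix (Fin D) (Fin D) ℂ) (c γ : ℝ),
      0 < μ ∧ σ.PosDef ∧ σ.trace = 1 ∧ 0 < c ∧ 0 < γ ∧ γ < 1 ∧ ∀ m : ℕ,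
        ‖boundaryState (MPS.gauge Z μ T) m - σ ⊗ₖ (1 : Matrix (Fin D) (Fin D) ℂ)‖ ≤ c * γ ^ m := by
  obtain ⟨Z, μ, hμ, h1⟩ := hT.exists_gauge_dualOp_one hD hL
  have hT' := hT.gauge Z hμ.ne'
  obtain ⟨τ, hτ, htr, hfix⟩ := hT'.exists_fixedPoint hD hL h1
  obtain ⟨c, γ, hc, h0, hγ1, hb⟩ := hT'.exists_boundaryState_sub_le h1 hτ htr hfix
  exact ⟨Z, μ, τᵀ, c, γ, hμ, hτ.transpose, by rw [trace_transpose, htr], hc, h0, hγ1, hb⟩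

theorem tendsto_of_norm_sub_le {E : Type*} [NormedAddCommGroup E] {u : ℕ → E} {a : E} {c γ : ℝ}
    (h0 : 0 < γ) (h1 : γ < 1) (h : ∀ m, ‖u m - a‖ ≤ c * γ ^ m) : Tendsto u atTop (𝓝 a) := by
  rw [tendsto_iff_norm_sub_tendsto_zero]
  refine squeeze_zero (fun _ => norm_nonneg _) h ?_
  simpa using (tendsto_pow_atTop_nhds_zero_of_lt_one h0.le h1).const_mul c

theorem exists_norm_le_of_tendsto {E : Type*} [NormedAddCommGroup E] {u : ℕ → E} {a : E}
    (h : Tendsto u atTop (𝓝 a)) : ∃ M : ℝ, 0 < M ∧ ∀ m, ‖u m‖ ≤ M := by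
  obtain ⟨M, hM⟩ := (Metric.isBounded_range_of_tendsto u h).exists_norm_le
  exact ⟨|M| + 1, by positivity, fun m => (hM _ ⟨m, rfl⟩).trans (by linarith [le_abs_self M])⟩

/-- Inversion is continuous at the invertible limit. Singular members of the sequence do no harm, as
their inverse is 0 by convention. -/
theorem exists_norm_inv_le_of_tendsto {n : Type} [Fintype n] [DecidableEq n]
    {u : ℕ → Matrix n n ℂ} {S : Matrix n n ℂ} (hS : IsUnit S) (h : Tendsto u atTop (𝓝 S)) :
    ∃ K : ℝ, 0 < K ∧ ∀ m, ‖(u m)⁻¹‖ ≤ K := by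
  refine exists_norm_le_of_tendsto (a := S⁻¹) ?_
  have h1 := NormedRing.inverse_continuousAt hS.unit
  have h2 : Tendsto (fun m => Ring.inverse (u m)) atTop (𝓝 (Ring.inverse S)) :=
    Tendsto.comp h1 h
  simpa only [← nonsing_inv_eq_ringInverse] using h2

theorem InjectiveOn.exists_sqrt_bounds {T : ι → Matrix (Fin D) (Fin D) ℂ} {L : ℕ}
    (hL : 0 < L) (hT : InjectiveOn T L) {S : Matrix (Fin D × Fin D) (Fin D × Fin D) ℂ}
    (hS : IsUnit S) {c γ : ℝ} (hc : 0 < c) (h0 : 0 < γ) (h1 : γ < 1)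
    (hb : ∀ m : ℕ, ‖boundaryState T m - S‖ ≤ c * γ ^ m) :
    ∃ c₁ c₂ : ℝ, 0 < c₁ ∧ 0 < c₂ ∧
      (∀ m, opNorm (psdSqrt (boundaryState T m) * S⁻¹ * psdSqrt (boundaryState T m) - 1)
        ≤ c₁ * γ ^ m) ∧
      (∀ m, L ≤ m → opNorm (psdInvSqrt (boundaryState T m) * S * psdInvSqrt (boundaryState T m) - 1)
        ≤ c₂ * γ ^ m) := by
  have ht := tendsto_of_norm_sub_le h0 h1 hb
  obtain ⟨M, hM0, hM⟩ := exists_norm_le_of_tendsto ht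
  obtain ⟨K, hK0, hK⟩ := exists_norm_inv_le_of_tendsto hS ht
  have hpos : ∀ m, L ≤ m → (boundaryState T m).PosDef := fun m hm =>
    (hT.mono hL hm).boundaryState_posDef
  -- Below length `L` the boundary state may be singular, so the perturbation bound starts at `L`
  -- and the constant absorbs the finitely many shorter lengths.
  obtain ⟨c₁, hc₁, h₁⟩ := exists_le_mul_pow
    (f := fun m => opNorm (psdSqrt (boundaryState T m) * S⁻¹ * psdSqrt (boundaryState T m) - 1))
    (c := M * K * ‖S⁻¹‖ * c) h0 (N := L) fun m hm => by
      refine (norm_psdSqrt_mul_inv_mul_sub_one_le (hpos m hm) hS).trans ?_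
      calc _ ≤ M * K * ‖S⁻¹‖ * (c * γ ^ m) := by
            gcongr
            · exact hM m
            · exact hK m
            · exact hb m
        _ = _ := by ring
  refine ⟨c₁, K * c, hc₁, by positivity, h₁, fun m hm => ?_⟩
  refine (norm_psdInvSqrt_mul_mul_sub_one_le (hpos m hm) S).trans ?_
  calc _ ≤ K * (c * γ ^ m) := by
        gcongr
        · exact hK m
        · exact hb m
    _ = _ := by ring

theorem approxFactorizable_of_bounds {T : ι → Matrix (Fin D) (Fin D) ℂ} {L : ℕ}
    {σ : Matrix (Fin D) (Fin D) ℂ} (hσ : IsUnit σ) {c' γ : ℝ} (hc : 0 ≤ c') (h0 : 0 < γ)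
    (h1 : γ < 1)
    (h₁ : ∀ m, opNorm (psdSqrt (boundaryState T m) * (σ ⊗ₖ (1 : Matrix (Fin D) (Fin D) ℂ))⁻¹ *
      psdSqrt (boundaryState T m) - 1) ≤ c' * γ ^ m)
    (h₂ : ∀ m, L ≤ m → opNorm (psdInvSqrt (boundaryState T m) *
      (σ ⊗ₖ (1 : Matrix (Fin D) (Fin D) ℂ)) * psdInvSqrt (boundaryState T m) - 1) ≤ c' * γ ^ m)
    {k m n : ℕ} (hm : L ≤ m) : ApproxFactorizable T k m n (c' * γ ^ m) := by
  have hmono : ∀ l, m ≤ l → c' * γ ^ l ≤ c' * γ ^ m := fun l hl =>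
    mul_le_mul_of_nonneg_left (pow_le_pow_of_le_one h0.le h1.le hl) hc
  -- With this choice all four reference operators equal `σ ⊗ 1`. The regions larger than `B` have
  -- smaller errors, by monotonicity of `γ ^ l`.
  exact ⟨σ, 1, 1, σ, hσ, isUnit_one, isUnit_one, hσ, (h₁ _).trans (hmono _ (by omega)),
    (h₁ _).trans (hmono _ (by omega)), (h₁ _).trans (hmono _ (by omega)), h₂ m hm⟩

theorem kronecker_one_isUnit {σ : Matrix (Fin D) (Fin D) ℂ} (hσ : σ.PosDef) :
    IsUnit (σ ⊗ₖ (1 : Matrix (Fin D) (Fin D) ℂ)) :=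
  (hσ.kronecker PosDef.one).isUnit

theorem InjectiveOn.exists_gauge_approxFactorizable {T : ι → Matrix (Fin D) (Fin D) ℂ} {L : ℕ}
    (hD : 0 < D) (hL : 0 < L) (hT : InjectiveOn T L) :
    ∃ (Z : (Matrix (Fin D) (Fin D) ℂ)ˣ) (μ : ℝ) (σ : Matrix (Fin D) (Fin D) ℂ) (c γ : ℝ),
      0 < μ ∧ σ.PosDef ∧ σ.trace = 1 ∧ 0 < c ∧ 0 < γ ∧ γ < 1 ∧
      (∀ m : ℕ, traceNorm
        (boundaryState (MPS.gauge Z μ T) m - σ ⊗ₖ (1 : Matrix (Fin D) (Fin D) ℂ))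
          ≤ c * γ ^ m) ∧
      (∀ m : ℕ, opNorm
        (psdSqrt (boundaryState (MPS.gauge Z μ T) m)
          * (σ⁻¹ ⊗ₖ (1 : Matrix (Fin D) (Fin D) ℂ))
          * psdSqrt (boundaryState (MPS.gauge Z μ T) m) - 1)
          ≤ c * (minEigenvalue σ)⁻¹ * γ ^ m) ∧
      ∃ c' : ℝ, 0 < c' ∧
        (∀ m : ℕ, L ≤ m → opNorm
          (psdInvSqrt (boundaryState (MPS.gauge Z μ T) m)
            * (σ ⊗ₖ (1 : Matrix (Fin D) (Fin D) ℂ))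
            * psdInvSqrt (boundaryState (MPS.gauge Z μ T) m) - 1)
            ≤ c' * (minEigenvalue σ)⁻¹ * γ ^ m) ∧
        (∀ k m n : ℕ, L ≤ m →
          ApproxFactorizable (MPS.gauge Z μ T) k m n (c' * (minEigenvalue σ)⁻¹ * γ ^ m)) := by
  obtain ⟨Z, μ, σ, c, γ, hμ, hσ, htr, hc, h0, h1, hb⟩ := hT.exists_gauge_boundaryState_sub_le hD hL
  have hS := kronecker_one_isUnit hσ
  obtain ⟨c₁, c₂, hc₁, hc₂, h₁, h₂⟩ := (hT.gauge Z hμ.ne').exists_sqrt_bounds hL hS hc h0 h1 hb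
  have : Nonempty (Fin D) := ⟨⟨0, hD⟩⟩
  set s := minEigenvalue σ with hs
  have hs0 : 0 < s := minEigenvalue_pos hσ
  have hle : ∀ {a b : ℝ}, a ≤ b → a ≤ b * s * s⁻¹ := fun {a b} h => by
    rwa [mul_assoc, mul_inv_cancel₀ hs0.ne', mul_one]
  have hinv : (σ ⊗ₖ (1 : Matrix (Fin D) (Fin D) ℂ))⁻¹ = σ⁻¹ ⊗ₖ (1 : Matrix (Fin D) (Fin D) ℂ) := by
    rw [inv_kronecker, inv_one]
  -- The factors `s` cancel the inverse smallest eigenvalue in the required bounds. The first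
  -- constant must serve both the trace-norm bound and the square-root bound.
  refine ⟨Z, μ, σ, Fintype.card (Fin D × Fin D) * c + c₁ * s, γ, hμ, hσ, htr, by positivity, h0, h1,
    fun m => ?_, fun m => ?_, (c₁ + c₂) * s, by positivity, fun m hm => ?_, fun k m n hm => ?_⟩
  · refine (traceNorm_le_card_mul_norm _).trans ?_
    calc _ ≤ (Fintype.card (Fin D × Fin D) : ℝ) * (c * γ ^ m) := by gcongr; exact hb m
      _ ≤ _ := by
        rw [← mul_assoc]
        gcongr
        exact le_add_of_nonneg_right (by positivity)
  · rw [← hinv]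
    refine (h₁ m).trans ?_
    gcongr
    refine (hle le_rfl).trans ?_
    gcongr
    exact le_add_of_nonneg_left (by positivity)
  · refine (h₂ m hm).trans ?_
    gcongr
    refine (hle le_rfl).trans ?_
    gcongr
    exact le_add_of_nonneg_left (by positivity)
  · refine approxFactorizable_of_bounds (L := L) hσ.isUnit (by positivity) h0 h1
      (fun m => ?_) (fun m hm => ?_) hm
    · refine (h₁ m).trans ?_
      gcongr
      refine (hle le_rfl).trans ?_
      gcongr
      exact le_add_of_nonneg_right (by positivity)
    · refine (h₂ m hm).trans ?_
      gcongr
      refine (hle le_rfl).trans ?_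
      gcongr
      exact le_add_of_nonneg_left (by positivity)

end BoundaryStates

/-! ### Operators on a set of sites, extended to a larger system -/

section Embedding

variable {ι : Type} [Fintype ι] {κ Λ Λ' : Type} [Fintype κ] [Fintype Λ] [Fintype Λ']
  [DecidableEq κ] [DecidableEq Λ] [DecidableEq Λ']

/-- The configurations `s` and `t` agree off the range of `f`. -/
def Agree (f : κ → Λ) (s t : Λ → ι) : Prop := ∀ x, x ∉ Set.range f → s x = t x

open Classical in
/-- An operator on the sites `κ`, acting on the sites `f '' κ` of a larger system `Λ`. -/
def emb (f : κ → Λ) (M : Matrix (κ → ι) (κ → ι) ℂ) : Matrix (Λ → ι) (Λ → ι) ℂ :=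
  Matrix.of fun s t => if Agree f s t then M (s ∘ f) (t ∘ f) else 0

open Classical in
theorem emb_apply (f : κ → Λ) (M : Matrix (κ → ι) (κ → ι) ℂ) (s t : Λ → ι) :
    emb f M s t = if Agree f s t then M (s ∘ f) (t ∘ f) else 0 := rfl

theorem extend_comp_self {f : κ → Λ} (hf : Function.Injective f) (r : κ → ι) (s : Λ → ι) :
    Function.extend f r s ∘ f = r := funext fun x => hf.extend_apply r s x

theorem extend_off_range {f : κ → Λ} (r : κ → ι) (s : Λ → ι) {x : Λ} (hx : x ∉ Set.range f) :
    Function.extend f r s x = s x := Function.extend_apply' r s x hx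

theorem extend_eq_of_agree {f : κ → Λ} (hf : Function.Injective f) {s t : Λ → ι}
    (h : Agree f s t) : Function.extend f (t ∘ f) s = t := by
  ext x
  by_cases hx : x ∈ Set.range f
  · obtain ⟨y, rfl⟩ := hx
    rw [hf.extend_apply]; rfl
  · rw [extend_off_range _ _ hx, h x hx]

open Classical in
-- A configuration agreeing with `s` off the range of `f` is determined by its restriction along
-- `f`, which is arbitrary.
theorem sum_ite_agree {M : Type*} [AddCommMonoid M] {f : κ → Λ} (hf : Function.Injective f)
    (s : Λ → ι) (g : (Λ → ι) → M) :
    (∑ t, if Agree f s t then g t else 0) =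
      ∑ r : κ → ι, g (Function.extend f r s) := by
  rw [← Finset.sum_filter]
  refine Finset.sum_bij' (fun t _ => t ∘ f) (fun r _ => Function.extend f r s) (fun _ _ => Finset.mem_univ _)
    (fun r _ => ?_) (fun t ht => ?_) (fun r _ => extend_comp_self hf r s) (fun t ht => ?_)
  · simp only [Finset.mem_filter, Finset.mem_univ, true_and]
    exact fun x hx => (extend_off_range r s hx).symm
  · exact extend_eq_of_agree hf (by simpa using ht)
  · rw [extend_eq_of_agree hf (by simpa using ht)]

theorem emb_mul_apply {f : κ → Λ} (hf : Function.Injective f) (M : Matrix (κ → ι) (κ → ι) ℂ)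
    {β : Type} (N : Matrix (Λ → ι) β ℂ) (s : Λ → ι) (b : β) :
    (emb f M * N) s b = ∑ r, M (s ∘ f) r * N (Function.extend f r s) b := by
  classical
  rw [Matrix.mul_apply]
  simp only [emb_apply, ite_mul, zero_mul]
  rw [sum_ite_agree hf s fun t => M (s ∘ f) (t ∘ f) * N t b]
  simp only [extend_comp_self hf]

theorem emb_mulVec {f : κ → Λ} (hf : Function.Injective f) (M : Matrix (κ → ι) (κ → ι) ℂ)
    (u : (Λ → ι) → ℂ) (s : Λ → ι) :
    (emb f M *ᵥ u) s = ∑ r, M (s ∘ f) r * u (Function.extend f r s) := by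
  have := emb_mul_apply hf M (replicateCol Unit u) s ()
  rwa [← replicateCol_mulVec] at this

theorem agree_extend_iff {f : κ → Λ} (r : κ → ι) (s t : Λ → ι) :
    Agree f (Function.extend f r s) t ↔ Agree f s t := by
  refine forall₂_congr fun x hx => ?_
  rw [extend_off_range r s hx]

theorem agree_comm (f : κ → Λ) (s t : Λ → ι) : Agree f s t ↔ Agree f t s :=
  forall₂_congr fun _ _ => eq_comm

theorem emb_mul {f : κ → Λ} (hf : Function.Injective f) (M N : Matrix (κ → ι) (κ → ι) ℂ) :
    emb f (M * N) = emb f M * emb f N := by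
  classical
  ext s t
  rw [emb_mul_apply hf]
  simp only [emb_apply, agree_extend_iff, extend_comp_self hf]
  split_ifs
  · rw [Matrix.mul_apply]
  · simp

theorem emb_conjTranspose (f : κ → Λ) (M : Matrix (κ → ι) (κ → ι) ℂ) :
    emb f Mᴴ = (emb f M)ᴴ := by
  classical
  ext s t
  simp only [emb_apply, conjTranspose_apply, agree_comm f t s]
  split_ifs <;> simp

theorem emb_add (f : κ → Λ) (M N : Matrix (κ → ι) (κ → ι) ℂ) :
    emb f (M + N) = emb f M + emb f N := by
  ext s t
  simp only [emb_apply, Matrix.add_apply]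
  split_ifs <;> simp

theorem emb_smul (f : κ → Λ) (r : ℝ) (M : Matrix (κ → ι) (κ → ι) ℂ) :
    emb f (r • M) = r • emb f M := by
  ext s t
  simp only [emb_apply, Matrix.smul_apply]
  split_ifs <;> simp

theorem emb_sub (f : κ → Λ) (M N : Matrix (κ → ι) (κ → ι) ℂ) :
    emb f (M - N) = emb f M - emb f N := by
  ext s t
  simp only [emb_apply, Matrix.sub_apply]
  split_ifs <;> simp

theorem emb_sum (f : κ → Λ) {α : Type} (A : Finset α) (M : α → Matrix (κ → ι) (κ → ι) ℂ) :
    emb f (∑ a ∈ A, M a) = ∑ a ∈ A, emb f (M a) :=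
  map_sum (⟨⟨emb f, by ext; simp [emb_apply]⟩, emb_add f⟩ :
    Matrix (κ → ι) (κ → ι) ℂ →+ Matrix (Λ → ι) (Λ → ι) ℂ) M A

theorem emb_comp {f : κ → Λ} {g : Λ → Λ'} (hg : Function.Injective g)
    (M : Matrix (κ → ι) (κ → ι) ℂ) : emb g (emb f M) = emb (g ∘ f) M := by
  classical
  ext s t
  simp only [emb_apply]
  rw [← ite_and]
  refine if_congr ?_ rfl rfl
  constructor
  · rintro ⟨h1, h2⟩ x hx
    by_cases hxg : x ∈ Set.range g
    · obtain ⟨y, rfl⟩ := hxg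
      exact h2 y fun ⟨z, hz⟩ => hx ⟨z, congrArg g hz⟩
    · exact h1 x hxg
  · intro h
    refine ⟨fun x hx => h x fun ⟨z, hz⟩ => hx ⟨f z, hz⟩, fun y hy => h _ fun ⟨z, hz⟩ => hy ⟨z, hg hz⟩⟩

/-- For disjoint supports the entries of the product are given by a formula symmetric in the two
factors. -/
theorem emb_commute {f : κ → Λ} {g : Λ' → Λ} (hf : Function.Injective f)
    (hg : Function.Injective g) (hd : ∀ x y, f x ≠ g y) (M : Matrix (κ → ι) (κ → ι) ℂ)
    (N : Matrix (Λ' → ι) (Λ' → ι) ℂ) : emb f M * emb g N = emb g N * emb f M := by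
  classical
  have key : ∀ {κ Λ' : Type} [Fintype κ] [Fintype Λ'] [DecidableEq κ] [DecidableEq Λ'] {f : κ → Λ}
      {g : Λ' → Λ} (hf : Function.Injective f) (hd : ∀ x y, f x ≠ g y)
      (M : Matrix (κ → ι) (κ → ι) ℂ) (N : Matrix (Λ' → ι) (Λ' → ι) ℂ) (s t : Λ → ι),
      (emb f M * emb g N) s t = if ∀ x, x ∉ Set.range f → x ∉ Set.range g → s x = t x then
        M (s ∘ f) (t ∘ f) * N (s ∘ g) (t ∘ g) else 0 := by
    intro κ Λ' _ _ _ _ f g hf hd M N s t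
    rw [emb_mul_apply hf]
    have h1 : ∀ r, Function.extend f r s ∘ g = s ∘ g := fun r => by
      ext y
      exact extend_off_range r s fun ⟨x, hx⟩ => hd x y hx
    simp only [emb_apply, h1]
    rw [Finset.sum_eq_single (t ∘ f)]
    · rw [mul_ite, mul_zero]
      refine if_congr ?_ rfl rfl
      refine forall_congr' fun x => ?_
      by_cases hx : x ∈ Set.range f
      · obtain ⟨y, rfl⟩ := hx
        simp [hf.extend_apply]
      · rw [extend_off_range _ _ hx]
        simp [hx]
    · intro r _ hr
      rw [if_neg, mul_zero]
      intro h
      refine hr ?_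
      ext y
      have := h (f y) fun ⟨x, hx⟩ => hd y x hx.symm
      rwa [hf.extend_apply] at this
    · simp
  ext s t
  rw [key hf hd, key hg fun x y h => hd y x h.symm, mul_comm]
  refine if_congr (forall_congr' fun x => ⟨fun h a b => h b a, fun h a b => h b a⟩) rfl rfl

theorem emb_nonneg {f : κ → Λ} (hf : Function.Injective f) [DecidableEq ι]
    {M : Matrix (κ → ι) (κ → ι) ℂ} (hM : 0 ≤ M) : 0 ≤ emb f M := by
  have h := nonneg_iff.1 hM
  have h2 : emb f M = (emb f (psdSqrt M))ᴴ * emb f (psdSqrt M) := by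
    rw [← emb_conjTranspose, (psdSqrt_isHermitian M).eq, ← emb_mul hf, psdSqrt_mul_self h]
  rw [h2]
  exact nonneg_iff.2 (posSemidef_conjTranspose_mul_self _)

theorem emb_mono {f : κ → Λ} (hf : Function.Injective f) [DecidableEq ι]
    {M N : Matrix (κ → ι) (κ → ι) ℂ} (h : M ≤ N) : emb f M ≤ emb f N := by
  have := emb_nonneg hf (sub_nonneg.2 h)
  rwa [emb_sub, sub_nonneg] at this

end Embedding

/-! ### Projectors onto the complement of the ground space -/

section GroundSpaces

variable {ι : Type} [Fintype ι] [DecidableEq ι] {D : ℕ}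

/-- The orthogonal projector onto the orthogonal complement of the range of `V_ℓ`. -/
def excProj (T : ι → Matrix (Fin D) (Fin D) ℂ) (ℓ : ℕ) : Matrix (Fin ℓ → ι) (Fin ℓ → ι) ℂ :=
  (Matrix.toEuclideanCLM (n := Fin ℓ → ι) (𝕜 := ℂ)).symm
    (LinearMap.range (Matrix.toEuclideanLin (boundaryMap T ℓ)))ᗮ.starProjection

theorem localTerm_eq_excProj (T : ι → Matrix (Fin D) (Fin D) ℂ) : localTerm T = excProj T 2 := rfl

variable (T : ι → Matrix (Fin D) (Fin D) ℂ) (ℓ : ℕ)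

theorem excProj_isHermitian : (excProj T ℓ).IsHermitian := by
  have h := (isStarProjection_starProjection
    (U := (LinearMap.range (Matrix.toEuclideanLin (boundaryMap T ℓ)))ᗮ)).isSelfAdjoint
  refine EquivLike.injective (Matrix.toEuclideanCLM (n := Fin ℓ → ι) (𝕜 := ℂ)) ?_
  rw [← star_eq_conjTranspose, map_star, excProj, StarAlgEquiv.apply_symm_apply]
  exact h

theorem excProj_mul_self : excProj T ℓ * excProj T ℓ = excProj T ℓ := by
  have h := (isStarProjection_starProjection
    (U := (LinearMap.range (Matrix.toEuclideanLin (boundaryMap T ℓ)))ᗮ)).isIdempotentElem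
  refine EquivLike.injective (Matrix.toEuclideanCLM (n := Fin ℓ → ι) (𝕜 := ℂ)) ?_
  rw [map_mul, excProj, StarAlgEquiv.apply_symm_apply]
  exact h

theorem toLp_excProj_mulVec (x : (Fin ℓ → ι) → ℂ) :
    WithLp.toLp 2 (excProj T ℓ *ᵥ x) =
      (LinearMap.range (Matrix.toEuclideanLin (boundaryMap T ℓ)))ᗮ.starProjection
        (WithLp.toLp 2 x) := by
  rw [← Matrix.toEuclideanCLM_toLp, excProj, StarAlgEquiv.apply_symm_apply]

theorem excProj_mulVec_eq_zero_iff (x : (Fin ℓ → ι) → ℂ) :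
    excProj T ℓ *ᵥ x = 0 ↔ ∃ X, boundaryMap T ℓ *ᵥ X = x := by
  have h := toLp_excProj_mulVec T ℓ x
  rw [← WithLp.toLp_eq_zero 2, h, Submodule.starProjection_apply_eq_zero_iff,
    Submodule.orthogonal_orthogonal]
  constructor
  · rintro ⟨X, hX⟩
    exact ⟨X.ofLp, congrArg WithLp.ofLp hX⟩
  · rintro ⟨X, rfl⟩
    exact ⟨WithLp.toLp 2 X, rfl⟩

theorem excProj_nonneg : 0 ≤ excProj T ℓ := by
  rw [← excProj_mul_self]
  nth_rw 1 [← (excProj_isHermitian T ℓ).eq]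
  exact nonneg_iff.2 (posSemidef_conjTranspose_mul_self _)

end GroundSpaces

/-! ### Intervals of a chain and the intersection property -/

section Intervals

variable {ι : Type} [Fintype ι] [DecidableEq ι] {D : ℕ}

/-- The inclusion of the sites `x, …, x + ℓ - 1` into a chain of `n` sites. -/
def shift {ℓ n : ℕ} (x : ℕ) (h : x + ℓ ≤ n) : Fin ℓ → Fin n := fun i => ⟨x + i, by omega⟩

theorem shift_injective {ℓ n : ℕ} (x : ℕ) (h : x + ℓ ≤ n) : Function.Injective (shift x h) := by
  intro i j hij
  have := congrArg Fin.val hij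
  simp only [shift] at this
  exact Fin.ext (by omega)

theorem shift_comp_shift {ℓ n N : ℕ} (x y : ℕ) (h : x + ℓ ≤ n) (h' : y + n ≤ N) :
    shift y h' ∘ shift x h = shift (y + x) (by omega) := by
  ext i
  simp [shift, add_assoc]

theorem extend_eq_of_comp {κ Λ : Type} {f : κ → Λ} (hf : Function.Injective f) {r : κ → ι}
    {s t : Λ → ι} (h1 : t ∘ f = r) (h2 : Agree f s t) : Function.extend f r s = t := by
  rw [← h1]
  ext x
  by_cases hx : x ∈ Set.range f
  · obtain ⟨y, rfl⟩ := hx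
    rw [hf.extend_apply]; rfl
  · rw [Function.extend_apply' _ _ _ hx, h2 x hx]

theorem extend_shift_append {a ℓ b : ℕ} (h : a + ℓ ≤ a + ℓ + b) (s₁ : Fin a → ι) (r' r : Fin ℓ → ι)
    (s₃ : Fin b → ι) :
    Function.extend (shift a h) r (Fin.append (Fin.append s₁ r') s₃) =
      Fin.append (Fin.append s₁ r) s₃ := by
  have hs : ∀ i : Fin ℓ, shift a h i = Fin.castAdd b (Fin.natAdd a i) := fun i => rfl
  refine extend_eq_of_comp (shift_injective a h) ?_ fun x hx => ?_
  · ext i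
    simp [hs]
  · induction x using Fin.addCases with
    | left y =>
      induction y using Fin.addCases with
      | left z => simp
      | right z => exact absurd ⟨z, hs z⟩ hx
    | right y => simp

theorem exists_append {a b : ℕ} (s : Fin (a + b) → ι) :
    ∃ (s₁ : Fin a → ι) (s₂ : Fin b → ι), s = Fin.append s₁ s₂ :=
  ⟨fun i => s (Fin.castAdd b i), fun i => s (Fin.natAdd a i), by
    ext i; refine Fin.addCases (fun y => ?_) (fun y => ?_) i <;> simp⟩

theorem emb_shift_mul_boundaryMap (T : ι → Matrix (Fin D) (Fin D) ℂ) {ℓ n : ℕ} (x : ℕ)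
    (h : x + ℓ ≤ n) {M : Matrix (Fin ℓ → ι) (Fin ℓ → ι) ℂ} (hM : M * boundaryMap T ℓ = 0) :
    emb (shift x h) M * boundaryMap T n = 0 := by
  obtain ⟨b, rfl⟩ := Nat.exists_eq_add_of_le h
  ext s p
  obtain ⟨s', s₃, rfl⟩ := exists_append s
  obtain ⟨s₁, s₂, rfl⟩ := exists_append s'
  rw [emb_mul_apply (shift_injective x h)]
  simp only [extend_shift_append, boundaryMap, Matrix.of_apply, chainTensor_append,
    Matrix.mul_apply, Finset.mul_sum, Finset.sum_mul, Matrix.zero_apply]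
  rw [Finset.sum_comm]
  refine Finset.sum_eq_zero fun k _ => ?_
  rw [Finset.sum_comm]
  refine Finset.sum_eq_zero fun j _ => ?_
  have h0 := congrFun (congrFun hM ((Fin.append (Fin.append s₁ s₂) s₃) ∘ shift x h)) (j, k)
  rw [Matrix.mul_apply] at h0
  simp only [boundaryMap, Matrix.of_apply, Matrix.zero_apply] at h0
  calc _ = ∑ r, chainTensor T x s₁ p.1 j * (M ((Fin.append (Fin.append s₁ s₂) s₃) ∘ shift x h) r *
          chainTensor T ℓ r j k) * chainTensor T b s₃ k p.2 :=
        Finset.sum_congr rfl fun r _ => by ring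
    _ = 0 := by rw [← Finset.sum_mul, ← Finset.mul_sum, h0, mul_zero, zero_mul]

theorem excProj_mul_boundaryMap (T : ι → Matrix (Fin D) (Fin D) ℂ) (ℓ : ℕ) :
    excProj T ℓ * boundaryMap T ℓ = 0 := by
  ext s p
  have := (excProj_mulVec_eq_zero_iff T ℓ (boundaryMap T ℓ *ᵥ Pi.single p 1)).2 ⟨_, rfl⟩
  rw [mulVec_mulVec, mulVec_single_one] at this
  exact congrFun this s

/-- An embedded operator acts separately on each slice of `u` obtained by freezing the configuration
outside its support. -/
theorem emb_mulVec_eq_zero_iff {κ Λ : Type} [Fintype κ] [Fintype Λ] [DecidableEq κ]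
    [DecidableEq Λ] {f : κ → Λ} (hf : Function.Injective f)
    (M : Matrix (κ → ι) (κ → ι) ℂ) (u : (Λ → ι) → ℂ) :
    emb f M *ᵥ u = 0 ↔ ∀ s, M *ᵥ (fun r => u (Function.extend f r s)) = 0 := by
  constructor
  · intro h s
    ext r
    have h1 := congrFun h (Function.extend f r s)
    rw [emb_mulVec hf, extend_comp_self hf] at h1
    rw [Pi.zero_apply] at h1 ⊢
    rw [← h1]
    refine Finset.sum_congr rfl fun r' _ => ?_
    have h2 : Function.extend f r' (Function.extend f r s) = Function.extend f r' s := by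
      refine extend_eq_of_comp hf (extend_comp_self hf r' s) fun x hx => ?_
      rw [extend_off_range _ _ hx, extend_off_range _ _ hx]
    rw [h2]
  · intro h
    ext s
    rw [emb_mulVec hf]
    exact congrFun (h s) (s ∘ f)

theorem extend_shift_zero_append {k m n : ℕ} (h : 0 + (k + m) ≤ k + m + n) (r r' : Fin (k + m) → ι)
    (c : Fin n → ι) :
    Function.extend (shift 0 h) r (Fin.append r' c) = Fin.append r c := by
  have hs : ∀ i : Fin (k + m), shift 0 h i = Fin.castAdd n i := fun i => by
    ext; simp [shift]
  refine extend_eq_of_comp (shift_injective 0 h) ?_ fun x hx => ?_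
  · ext i
    simp [hs]
  · induction x using Fin.addCases with
    | left y => exact absurd ⟨y, hs y⟩ hx
    | right y => simp

theorem extend_shift_append_right {k m n : ℕ} (h : k + (m + n) ≤ k + m + n) (a : Fin k → ι)
    (b b' : Fin m → ι) (c c' : Fin n → ι) :
    Function.extend (shift k h) (Fin.append b c) (Fin.append (Fin.append a b') c') =
      Fin.append (Fin.append a b) c := by
  have hs₁ : ∀ i : Fin m, shift k h (Fin.castAdd n i) = Fin.castAdd n (Fin.natAdd k i) := fun i => by
    ext; simp [shift]
  have hs₂ : ∀ i : Fin n, shift k h (Fin.natAdd m i) = Fin.natAdd (k + m) i := fun i => by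
    ext; simp [shift, add_assoc]
  refine extend_eq_of_comp (shift_injective k h) ?_ fun x hx => ?_
  · ext i
    refine Fin.addCases (fun y => ?_) (fun y => ?_) i
    · simp [hs₁]
    · simp [hs₂]
  · induction x using Fin.addCases with
    | left y =>
      induction y using Fin.addCases with
      | left z => simp
      | right z => exact absurd ⟨_, hs₁ z⟩ hx
    | right y => exact absurd ⟨_, hs₂ y⟩ hx

variable (T : ι → Matrix (Fin D) (Fin D) ℂ) {k m n : ℕ}

/-- A vector of the ground space of the left part `AB` of a chain `ABC`. -/
theorem exists_left_boundary (h : 0 + (k + m) ≤ k + m + n) {u : (Fin (k + m + n) → ι) → ℂ}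
    (hu : emb (shift 0 h) (excProj T (k + m)) *ᵥ u = 0) :
    ∃ X : (Fin n → ι) → Fin D × Fin D → ℂ, ∀ ab c,
      u (Fin.append ab c) = (boundaryMap T (k + m) *ᵥ X c) ab := by
  rcases isEmpty_or_nonempty (Fin (k + m) → ι) with h0 | ⟨⟨r₀⟩⟩
  · exact ⟨0, fun ab => h0.elim ab⟩
  rw [emb_mulVec_eq_zero_iff (shift_injective 0 h)] at hu
  have h1 : ∀ c : Fin n → ι, ∃ X, boundaryMap T (k + m) *ᵥ X = fun ab => u (Fin.append ab c) := by
    intro c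
    have := hu (Fin.append r₀ c)
    simp only [extend_shift_zero_append] at this
    exact (excProj_mulVec_eq_zero_iff _ _ _).1 this
  choose X hX using h1
  exact ⟨X, fun ab c => (congrFun (hX c) ab).symm⟩

/-- A vector of the ground space of the right part `BC` of a chain `ABC`. -/
theorem exists_right_boundary (h : k + (m + n) ≤ k + m + n) {u : (Fin (k + m + n) → ι) → ℂ}
    (hu : emb (shift k h) (excProj T (m + n)) *ᵥ u = 0) :
    ∃ Y : (Fin k → ι) → Fin D × Fin D → ℂ, ∀ a b c,
      u (Fin.append (Fin.append a b) c) = (boundaryMap T (m + n) *ᵥ Y a) (Fin.append b c) := by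
  rcases isEmpty_or_nonempty (Fin (m + n) → ι) with h0 | ⟨⟨r₀⟩⟩
  · exact ⟨0, fun a b c => h0.elim (Fin.append b c)⟩
  obtain ⟨b₀, c₀, rfl⟩ := exists_append r₀
  rw [emb_mulVec_eq_zero_iff (shift_injective k h)] at hu
  have h1 : ∀ a : Fin k → ι, ∃ Y, boundaryMap T (m + n) *ᵥ Y =
      fun bc => u (Function.extend (shift k h) bc (Fin.append (Fin.append a b₀) c₀)) := fun a =>
    (excProj_mulVec_eq_zero_iff _ _ _).1 (hu (Fin.append (Fin.append a b₀) c₀))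
  choose Y hY using h1
  refine ⟨Y, fun a b c => ?_⟩
  rw [hY]
  simp only [extend_shift_append_right]

variable {T}

theorem InjectiveOn.exists_sum_smul_eq {m : ℕ} (hT : InjectiveOn T m)
    (M : Matrix (Fin D) (Fin D) ℂ) : ∃ w : (Fin m → ι) → ℂ, ∑ s, w s • chainTensor T m s = M := by
  have h : Submodule.span ℂ (Set.range (chainTensor T m)) = ⊤ := by
    by_contra h
    obtain ⟨F, hF, hle⟩ := Submodule.exists_le_ker_of_lt_top _ (lt_top_iff_ne_top.2 h)
    exact hF (hT.linearMap_eq_zero F fun s => hle (Submodule.subset_span ⟨s, rfl⟩))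
  exact Submodule.mem_span_range_iff_exists_fun ℂ |>.1 (h ▸ Submodule.mem_top)

theorem boundaryMap_mulVec_eq_trace (s : Fin m → ι) (X : Fin D × Fin D → ℂ) :
    (boundaryMap T m *ᵥ X) s =
      (chainTensor T m s * (Matrix.of fun i j => X (i, j))ᵀ).trace := by
  simp [mulVec, dotProduct, boundaryMap, Fintype.sum_prod_type, Matrix.trace, Matrix.mul_apply]

/-- The intersection property of the ground spaces of two overlapping chains. -/
theorem InjectiveOn.exists_boundaryMap_eq (hk : InjectiveOn T k) (hm : InjectiveOn T m)
    (h₁ : 0 + (k + m) ≤ k + m + n) (h₂ : k + (m + n) ≤ k + m + n) {u : (Fin (k + m + n) → ι) → ℂ}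
    (hu₁ : emb (shift 0 h₁) (excProj T (k + m)) *ᵥ u = 0)
    (hu₂ : emb (shift k h₂) (excProj T (m + n)) *ᵥ u = 0) :
    excProj T (k + m + n) *ᵥ u = 0 := by
  obtain ⟨X, hX⟩ := exists_left_boundary T h₁ hu₁
  obtain ⟨Y, hY⟩ := exists_right_boundary T h₂ hu₂
  let X' : (Fin n → ι) → Matrix (Fin D) (Fin D) ℂ := fun c => (Matrix.of fun i j => X c (i, j))ᵀ
  let Y' : (Fin k → ι) → Matrix (Fin D) (Fin D) ℂ := fun a => (Matrix.of fun i j => Y a (i, j))ᵀ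
  -- With `A_s` the chain tensors, the two descriptions of `u` give `tr(A_a A_b X'_c) = tr(A_b A_c
  -- Y'_a)` for all `b`. Injectivity on the middle chain removes `A_b`.
  have h1 : ∀ a c, X' c * chainTensor T k a = chainTensor T n c * Y' a := by
    intro a c
    have h2 := hm.linearMap_eq_zero (Matrix.traceLinearMap (Fin D) ℂ ℂ ∘ₗ
      LinearMap.mulLeft ℂ (X' c * chainTensor T k a - chainTensor T n c * Y' a)) fun b => by
        have h3 := (hX (Fin.append a b) c).symm.trans (hY a b c)
        rw [boundaryMap_mulVec_eq_trace, boundaryMap_mulVec_eq_trace, chainTensor_append,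
          chainTensor_append] at h3
        change (_ * chainTensor T m b).trace = 0
        rw [sub_mul, trace_sub, sub_eq_zero, mul_assoc, trace_mul_comm, h3, trace_mul_comm (_ * Y' a)]
        simp only [Y', mul_assoc]
    rw [← sub_eq_zero]
    refine Matrix.ext_iff_trace_mul_right.2 fun M => ?_
    rw [zero_mul, trace_zero]
    exact LinearMap.congr_fun h2 M
  -- Injectivity on the left chain allows `A_a` to be replaced by the identity, which gives `X'_c =
  -- A_c W` with `W` independent of `c`.
  obtain ⟨w, hw⟩ := hk.exists_sum_smul_eq 1
  rw [excProj_mulVec_eq_zero_iff]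
  set W := ∑ a, w a • Y' a
  have h2 : ∀ c, X' c = chainTensor T n c * W := by
    intro c
    calc X' c = X' c * ∑ a, w a • chainTensor T k a := by rw [hw, mul_one]
      _ = _ := by
        rw [Finset.mul_sum, Finset.mul_sum]
        refine Finset.sum_congr rfl fun a _ => ?_
        rw [mul_smul_comm, mul_smul_comm, h1]
  refine ⟨fun p => W p.2 p.1, ?_⟩
  ext s
  obtain ⟨ab, c, rfl⟩ := exists_append s
  rw [hX, boundaryMap_mulVec_eq_trace, boundaryMap_mulVec_eq_trace, chainTensor_append, mul_assoc]
  change _ = (_ * X' c).trace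
  rw [h2]
  rfl

end Intervals

/-! ### Cauchy–Schwarz estimates for families of vectors -/

section SquareSums

variable {α β β' : Type} [Fintype α] [Fintype β] [Fintype β']

/-- The squared norm of a family of vectors. -/
def sqSum (x : α → β → ℂ) : ℝ := ∑ a, ∑ b, ‖x a b‖ ^ 2

theorem sum_norm_sq_mulVec_le [DecidableEq β] [DecidableEq β'] (A : Matrix β' β ℂ) (x : β → ℂ) :
    ∑ b, ‖(A *ᵥ x) b‖ ^ 2 ≤ ‖A‖ ^ 2 * ∑ b, ‖x b‖ ^ 2 := by
  have h := l2_opNorm_mulVec A (WithLp.toLp 2 x)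
  have h2 := pow_le_pow_left₀ (norm_nonneg _) h 2
  rw [mul_pow, EuclideanSpace.norm_sq_eq, EuclideanSpace.norm_sq_eq] at h2
  exact h2

theorem sqSum_mulVec_le [DecidableEq β] [DecidableEq β'] (A : Matrix β' β ℂ) (x : α → β → ℂ) :
    sqSum (fun a => A *ᵥ x a) ≤ ‖A‖ ^ 2 * sqSum x := by
  unfold sqSum
  rw [Finset.mul_sum]
  exact Finset.sum_le_sum fun a _ => sum_norm_sq_mulVec_le A (x a)

theorem norm_sum_dotProduct_le (x y : α → β → ℂ) :
    ‖∑ a, star (x a) ⬝ᵥ y a‖ ≤ √(sqSum x) * √(sqSum y) := by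
  have h1 : ∑ a, star (x a) ⬝ᵥ y a = ∑ p : α × β, star (x p.1 p.2) * y p.1 p.2 := by
    rw [Fintype.sum_prod_type]; rfl
  have h2 : ∀ z : α → β → ℂ, sqSum z = ∑ p : α × β, ‖z p.1 p.2‖ ^ 2 := fun z => by
    rw [Fintype.sum_prod_type]; rfl
  rw [h1, h2, h2]
  refine (norm_sum_le _ _).trans ?_
  simp only [norm_mul, norm_star]
  exact Real.sum_mul_le_sqrt_mul_sqrt _ _ _

theorem norm_sum_dotProduct_mulVec_le [DecidableEq β] (A : Matrix β β ℂ) (x y : α → β → ℂ) :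
    ‖∑ a, star (x a) ⬝ᵥ (A *ᵥ y a)‖ ≤ ‖A‖ * (√(sqSum x) * √(sqSum y)) := by
  refine (norm_sum_dotProduct_le x fun a => A *ᵥ y a).trans ?_
  have h := Real.sqrt_le_sqrt (sqSum_mulVec_le A y)
  rw [Real.sqrt_mul (by positivity), Real.sqrt_sq (norm_nonneg _)] at h
  calc _ ≤ √(sqSum x) * (‖A‖ * √(sqSum y)) := by gcongr
    _ = _ := by ring

/-- With `ρ = V† V`, the left inverse `ρ⁻¹ V†` of `V` has squared norm `‖ρ⁻¹‖`. -/
theorem sum_norm_sq_le_of_posDef [DecidableEq β] [DecidableEq β'] {V : Matrix β' β ℂ}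
    (hV : (Vᴴ * V).PosDef) (x : β → ℂ) :
    ∑ b, ‖x b‖ ^ 2 ≤ ‖(Vᴴ * V)⁻¹‖ * ∑ b, ‖(V *ᵥ x) b‖ ^ 2 := by
  set ρ := Vᴴ * V with hρ
  have hdet := (Matrix.isUnit_iff_isUnit_det ρ).1 hV.isUnit
  have h1 : ρ⁻¹ * Vᴴ * V = 1 := by rw [Matrix.mul_assoc, ← hρ, nonsing_inv_mul _ hdet]
  have h2 : ‖ρ⁻¹ * Vᴴ‖ ^ 2 = ‖ρ⁻¹‖ := by
    rw [← l2_opNorm_conjTranspose (ρ⁻¹ * Vᴴ), sq, ← l2_opNorm_conjTranspose_mul_self,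
      conjTranspose_conjTranspose, conjTranspose_mul, conjTranspose_conjTranspose,
      hV.isHermitian.inv.eq, ← Matrix.mul_assoc, h1, Matrix.one_mul]
  have h3 := sum_norm_sq_mulVec_le (ρ⁻¹ * Vᴴ) (V *ᵥ x)
  rwa [mulVec_mulVec, h1, one_mulVec, h2] at h3

end SquareSums

/-! ### Overlap of the ground spaces of two overlapping chains -/

section Overlap

variable {ι : Type} [Fintype ι] [DecidableEq ι] {D : ℕ} {T : ι → Matrix (Fin D) (Fin D) ℂ}

/-- A matrix as a vector on the two boundary bonds. -/
def bondVec (B : Matrix (Fin D) (Fin D) ℂ) : Fin D × Fin D → ℂ := fun p => B p.1 p.2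

theorem star_bondVec_dotProduct (A B : Matrix (Fin D) (Fin D) ℂ) :
    star (bondVec A) ⬝ᵥ bondVec B = (Aᴴ * B).trace := by
  simp only [dotProduct, bondVec, Fintype.sum_prod_type, Matrix.trace, Matrix.diag,
    Matrix.mul_apply, conjTranspose_apply, Pi.star_apply]
  exact Finset.sum_comm

theorem kronecker_one_mulVec_bondVec (σ B : Matrix (Fin D) (Fin D) ℂ) :
    (σ ⊗ₖ (1 : Matrix (Fin D) (Fin D) ℂ)) *ᵥ bondVec B = bondVec (σ * B) := by
  ext p
  simp [mulVec, dotProduct, bondVec, Fintype.sum_prod_type, kroneckerMap_apply, Matrix.one_apply,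
    Matrix.mul_apply]

theorem norm_boundaryMap_sq (m : ℕ) : ‖boundaryMap T m‖ ^ 2 = ‖boundaryState T m‖ := by
  rw [sq, ← l2_opNorm_conjTranspose_mul_self]; rfl

/-- For fixed `j` and `l`, the `(j, l)` entries are the components of `V_k` applied to column `l` of
`B` placed at the value `j` of the right bond. Summing over the free index `j` costs the factor `D`.
-/
theorem sqSum_transpose_mul_le (k : ℕ) (B : Matrix (Fin D) (Fin D) ℂ) :
    sqSum (fun a => bondVec ((chainTensor T k a)ᵀ * B)) ≤
      D * ‖boundaryState T k‖ * ∑ p, ‖bondVec B p‖ ^ 2 := by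
  have h : ∀ j l : Fin D, ∑ a, ‖((chainTensor T k a)ᵀ * B) j l‖ ^ 2 ≤
      ‖boundaryState T k‖ * ∑ i, ‖B i l‖ ^ 2 := by
    intro j l
    have h1 := sum_norm_sq_mulVec_le (boundaryMap T k)
      (fun p => if p.2 = j then B p.1 l else 0)
    rw [norm_boundaryMap_sq] at h1
    have h2 : ∀ a, (boundaryMap T k *ᵥ fun p => if p.2 = j then B p.1 l else 0) a =
        ((chainTensor T k a)ᵀ * B) j l := fun a => by
      simp [mulVec, dotProduct, boundaryMap, Fintype.sum_prod_type, Matrix.mul_apply]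
    have h3 : ∑ p : Fin D × Fin D, ‖if p.2 = j then B p.1 l else 0‖ ^ 2 = ∑ i, ‖B i l‖ ^ 2 := by
      simp [Fintype.sum_prod_type, apply_ite]
    simpa only [h2, h3] using h1
  unfold sqSum
  rw [Finset.sum_comm, Fintype.sum_prod_type]
  calc _ ≤ ∑ _j : Fin D, ∑ l, ‖boundaryState T k‖ * ∑ i, ‖B i l‖ ^ 2 :=
        Finset.sum_le_sum fun j _ => Finset.sum_le_sum fun l _ => h j l
    _ = _ := by
      rw [Finset.sum_const, Finset.card_univ, Fintype.card_fin, nsmul_eq_mul, ← Finset.mul_sum,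
        Finset.sum_comm, ← Fintype.sum_prod_type' (f := fun i l => ‖B i l‖ ^ 2), mul_assoc]
      rfl

theorem sqSum_mul_transpose_le (n : ℕ) (B : Matrix (Fin D) (Fin D) ℂ) :
    sqSum (fun c => bondVec (B * (chainTensor T n c)ᵀ)) ≤
      D * ‖boundaryState T n‖ * ∑ p, ‖bondVec B p‖ ^ 2 := by
  have h : ∀ j l : Fin D, ∑ c, ‖(B * (chainTensor T n c)ᵀ) j l‖ ^ 2 ≤
      ‖boundaryState T n‖ * ∑ i, ‖B j i‖ ^ 2 := by
    intro j l
    have h1 := sum_norm_sq_mulVec_le (boundaryMap T n)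
      (fun p => if p.1 = l then B j p.2 else 0)
    rw [norm_boundaryMap_sq] at h1
    have h2 : ∀ a, (boundaryMap T n *ᵥ fun p => if p.1 = l then B j p.2 else 0) a =
        (B * (chainTensor T n a)ᵀ) j l := fun a => by
      simp [mulVec, dotProduct, boundaryMap, Fintype.sum_prod_type, Matrix.mul_apply, mul_comm]
    have h3 : ∑ p : Fin D × Fin D, ‖if p.1 = l then B j p.2 else 0‖ ^ 2 = ∑ i, ‖B j i‖ ^ 2 := by
      simp [Fintype.sum_prod_type, apply_ite]
    simpa only [h2, h3] using h1
  unfold sqSum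
  rw [Finset.sum_comm, Fintype.sum_prod_type]
  calc _ ≤ ∑ j, ∑ _l : Fin D, ‖boundaryState T n‖ * ∑ i, ‖B j i‖ ^ 2 :=
        Finset.sum_le_sum fun j _ => Finset.sum_le_sum fun l _ => h j l
    _ = _ := by
      simp only [Finset.sum_const, Finset.card_univ, Fintype.card_fin, nsmul_eq_mul]
      rw [← Finset.mul_sum, ← Finset.mul_sum,
        ← Fintype.sum_prod_type' (f := fun i l => ‖B i l‖ ^ 2), mul_assoc]
      rfl

theorem sum_append {M : Type*} [AddCommMonoid M] {a b : ℕ} (f : (Fin (a + b) → ι) → M) :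
    ∑ s, f s = ∑ s₁ : Fin a → ι, ∑ s₂ : Fin b → ι, f (Fin.append s₁ s₂) := by
  rw [← (Fin.appendEquiv a b).sum_comp, Fintype.sum_prod_type]
  rfl

theorem boundaryMap_append_left (k m : ℕ) (a : Fin k → ι) (b : Fin m → ι)
    (B : Matrix (Fin D) (Fin D) ℂ) :
    (boundaryMap T (k + m) *ᵥ bondVec B) (Fin.append a b) =
      (boundaryMap T m *ᵥ bondVec ((chainTensor T k a)ᵀ * B)) b := by
  rw [boundaryMap_mulVec_eq_trace, boundaryMap_mulVec_eq_trace, chainTensor_append]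
  change (_ * _ * Bᵀ).trace = (_ * ((chainTensor T k a)ᵀ * B)ᵀ).trace
  rw [transpose_mul, transpose_transpose, mul_assoc, trace_mul_comm, mul_assoc]

theorem boundaryMap_append_right (k m : ℕ) (a : Fin k → ι) (b : Fin m → ι)
    (B : Matrix (Fin D) (Fin D) ℂ) :
    (boundaryMap T (k + m) *ᵥ bondVec B) (Fin.append a b) =
      (boundaryMap T k *ᵥ bondVec (B * (chainTensor T m b)ᵀ)) a := by
  rw [boundaryMap_mulVec_eq_trace, boundaryMap_mulVec_eq_trace, chainTensor_append]
  change (_ * _ * Bᵀ).trace = (_ * (B * (chainTensor T m b)ᵀ)ᵀ).trace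
  rw [transpose_mul, transpose_transpose, mul_assoc]

theorem star_mulVec_dotProduct_mulVec {α β : Type} [Fintype α] [Fintype β] (V : Matrix α β ℂ)
    (x y : β → ℂ) : star (V *ᵥ x) ⬝ᵥ (V *ᵥ y) = star x ⬝ᵥ ((Vᴴ * V) *ᵥ y) := by
  rw [star_mulVec, ← dotProduct_mulVec, mulVec_mulVec]

/-- The overlap of `u ∈ Im V_{AB} ⊗ H_C` and `v ∈ H_A ⊗ Im V_{BC}`, if `u ⟂ Im V_{ABC}`, is bounded
by the distance of the boundary states from a product. -/
theorem norm_overlap_le {σ : Matrix (Fin D) (Fin D) ℂ} (hσ : σ.PosDef) {M K ε : ℝ}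
    {k m n : ℕ} (hMk : ‖boundaryState T k‖ ≤ M) (hMn : ‖boundaryState T n‖ ≤ M)
    (hl : (boundaryState T (k + m)).PosDef) (hr : (boundaryState T (m + n)).PosDef)
    (hKl : ‖(boundaryState T (k + m))⁻¹‖ ≤ K) (hKr : ‖(boundaryState T (m + n))⁻¹‖ ≤ K)
    (hεm : ‖boundaryState T m - σ ⊗ₖ (1 : Matrix (Fin D) (Fin D) ℂ)‖ ≤ ε)
    (hεl : ‖boundaryState T (k + m) - σ ⊗ₖ (1 : Matrix (Fin D) (Fin D) ℂ)‖ ≤ ε)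
    (X : (Fin n → ι) → Matrix (Fin D) (Fin D) ℂ) (Y : (Fin k → ι) → Matrix (Fin D) (Fin D) ℂ)
    {u v : (Fin (k + m + n) → ι) → ℂ}
    (hu : ∀ ab c, u (Fin.append ab c) = (boundaryMap T (k + m) *ᵥ bondVec (X c)) ab)
    (hv : ∀ a b c, v (Fin.append (Fin.append a b) c) =
      (boundaryMap T (m + n) *ᵥ bondVec (Y a)) (Fin.append b c))
    (horth : ∀ W, star u ⬝ᵥ (boundaryMap T (k + m + n) *ᵥ W) = 0) :
    ‖star u ⬝ᵥ v‖ ≤ ε * (D * M * (1 + ‖σ ⊗ₖ (1 : Matrix (Fin D) (Fin D) ℂ)‖ *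
      ‖(σ ⊗ₖ (1 : Matrix (Fin D) (Fin D) ℂ))⁻¹‖) * K) *
        (√(∑ s, ‖u s‖ ^ 2) * √(∑ s, ‖v s‖ ^ 2)) := by
  set S := σ ⊗ₖ (1 : Matrix (Fin D) (Fin D) ℂ) with hS
  have hdet := (Matrix.isUnit_iff_isUnit_det σ).1 hσ.isUnit
  have hM : 0 ≤ M := (norm_nonneg _).trans hMk
  have hK : 0 ≤ K := (norm_nonneg _).trans hKl
  have hε : 0 ≤ ε := (norm_nonneg _).trans hεm
  set NX := √(sqSum fun c => bondVec (X c))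
  set NY := √(sqSum fun a => bondVec (Y a))
  have hNX0 : 0 ≤ NX := Real.sqrt_nonneg _
  have hNY0 : 0 ≤ NY := Real.sqrt_nonneg _
  -- lower bounds on the norms of `u` and `v`
  have hNX : NX ≤ √K * √(∑ s, ‖u s‖ ^ 2) := by
    rw [← Real.sqrt_mul hK]
    refine Real.sqrt_le_sqrt ?_
    rw [sum_append, Finset.sum_comm, Finset.mul_sum]
    refine Finset.sum_le_sum fun c _ => (sum_norm_sq_le_of_posDef hl _).trans ?_
    simp only [hu]
    gcongr
    exact hKl
  have hNY : NY ≤ √K * √(∑ s, ‖v s‖ ^ 2) := by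
    rw [← Real.sqrt_mul hK]
    refine Real.sqrt_le_sqrt ?_
    rw [sum_append, sum_append, Finset.mul_sum]
    refine Finset.sum_le_sum fun a _ => (sum_norm_sq_le_of_posDef hr _).trans ?_
    rw [sum_append]
    simp only [hv]
    gcongr
    exact hKr
  -- upper bounds
  have hx : √(sqSum fun p : (Fin k → ι) × (Fin n → ι) =>
      bondVec ((chainTensor T k p.1)ᵀ * X p.2)) ≤ √(D * M) * NX := by
    rw [← Real.sqrt_mul (by positivity)]
    refine Real.sqrt_le_sqrt ?_
    unfold sqSum
    rw [Fintype.sum_prod_type, Finset.sum_comm, Finset.mul_sum]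
    refine Finset.sum_le_sum fun c _ => (sqSum_transpose_mul_le k (X c)).trans ?_
    gcongr
  have hy : √(sqSum fun p : (Fin k → ι) × (Fin n → ι) =>
      bondVec (Y p.1 * (chainTensor T n p.2)ᵀ)) ≤ √(D * M) * NY := by
    rw [← Real.sqrt_mul (by positivity)]
    refine Real.sqrt_le_sqrt ?_
    unfold sqSum
    rw [Fintype.sum_prod_type, Finset.mul_sum]
    refine Finset.sum_le_sum fun c _ => (sqSum_mul_transpose_le n (Y c)).trans ?_
    gcongr
  -- `W` is chosen so that, when the relevant boundary states are replaced by `S`, the overlap of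
  -- `u` with `v` equals that of `u` with `V_{ABC} W`. The latter vanishes for the true boundary
  -- states.
  set η : Matrix (Fin D) (Fin D) ℂ := ∑ a, ((chainTensor T k a)ᵀ)ᴴ * σ * Y a with hη
  set W := σ⁻¹ * η with hW
  have hσW : σ * W = η := by rw [hW, ← mul_assoc, mul_nonsing_inv _ hdet, one_mul]
  set Nη := √(∑ p, ‖bondVec η p‖ ^ 2) with hNη
  -- By duality: pairing `η` with itself moves the tensors of `A` onto `η`, and Cauchy–Schwarz gives
  -- `Nη ^ 2` at most `Nη` times the claimed bound.
  have hη1 : Nη ≤ √(D * M) * ‖S‖ * NY := by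
    have h1 : Nη ^ 2 = ‖∑ a, star (bondVec ((chainTensor T k a)ᵀ * η)) ⬝ᵥ (S *ᵥ bondVec (Y a))‖ := by
      have h2 : ∑ a, star (bondVec ((chainTensor T k a)ᵀ * η)) ⬝ᵥ (S *ᵥ bondVec (Y a)) =
          star (bondVec η) ⬝ᵥ bondVec η := by
        have h3 : η = ∑ a, ((chainTensor T k a)ᵀ)ᴴ * (σ * Y a) := by simp only [hη, mul_assoc]
        simp only [hS, kronecker_one_mulVec_bondVec, star_bondVec_dotProduct, conjTranspose_mul,
          mul_assoc]
        rw [← trace_sum, ← Finset.mul_sum, ← h3]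
      rw [h2, Real.sq_sqrt (by positivity)]
      have h3 : star (bondVec η) ⬝ᵥ bondVec η = ((∑ p, ‖bondVec η p‖ ^ 2 : ℝ) : ℂ) := by
        simp [dotProduct, Complex.conj_mul']
      rw [h3, Complex.norm_real, Real.norm_of_nonneg (by positivity)]
    have h2 := norm_sum_dotProduct_mulVec_le S (fun a => bondVec ((chainTensor T k a)ᵀ * η))
      (fun a => bondVec (Y a))
    rw [← h1] at h2
    have h3 : √(sqSum fun a => bondVec ((chainTensor T k a)ᵀ * η)) ≤ √(D * M) * Nη := by
      rw [← Real.sqrt_mul (by positivity)]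
      refine Real.sqrt_le_sqrt ((sqSum_transpose_mul_le k η).trans ?_)
      gcongr
    have h4 : Nη ^ 2 ≤ Nη * (√(D * M) * ‖S‖ * NY) := by
      refine h2.trans ?_
      calc _ ≤ ‖S‖ * ((√(D * M) * Nη) * NY) := by gcongr
        _ = _ := by ring
    rcases (Real.sqrt_nonneg _ : 0 ≤ Nη).eq_or_lt with h5 | h5
    · rw [show Nη = 0 from h5.symm]; positivity
    · rw [sq] at h4
      exact le_of_mul_le_mul_left h4 h5
  have hw : √(sqSum fun c => bondVec (W * (chainTensor T n c)ᵀ)) ≤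
      √(D * M) * (‖S⁻¹‖ * Nη) := by
    have h1 : bondVec W = S⁻¹ *ᵥ bondVec η := by
      rw [hS, inv_kronecker, inv_one, kronecker_one_mulVec_bondVec]
    have h2 := sum_norm_sq_mulVec_le S⁻¹ (bondVec η)
    rw [← h1] at h2
    have h3 : ‖S⁻¹‖ * Nη = √(‖S⁻¹‖ ^ 2 * ∑ p, ‖bondVec η p‖ ^ 2) := by
      rw [Real.sqrt_mul (by positivity), Real.sqrt_sq (norm_nonneg _)]
    rw [h3, ← Real.sqrt_mul (by positivity)]
    refine Real.sqrt_le_sqrt ((sqSum_mul_transpose_le n W).trans ?_)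
    gcongr
  -- the overlap in terms of boundary states
  have huv : star u ⬝ᵥ v = ∑ p : (Fin k → ι) × (Fin n → ι),
      star (bondVec ((chainTensor T k p.1)ᵀ * X p.2)) ⬝ᵥ
        (boundaryState T m *ᵥ bondVec (Y p.1 * (chainTensor T n p.2)ᵀ)) := by
    rw [Fintype.sum_prod_type]
    simp only [boundaryState, ← star_mulVec_dotProduct_mulVec]
    simp only [dotProduct, Pi.star_apply]
    rw [sum_append, sum_append]
    refine Finset.sum_congr rfl fun a _ => ?_
    rw [Finset.sum_comm]
    have hv' : ∀ b c, v (Fin.append (Fin.append a b) c) =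
        (boundaryMap T m *ᵥ bondVec (Y a * (chainTensor T n c)ᵀ)) b := fun b c => by
      rw [hv, boundaryMap_append_right]
    simp only [hu, hv', boundaryMap_append_left]
  have huW : ∑ c, star (bondVec (X c)) ⬝ᵥ
      (boundaryState T (k + m) *ᵥ bondVec (W * (chainTensor T n c)ᵀ)) = 0 := by
    rw [← horth (bondVec W)]
    simp only [boundaryState, ← star_mulVec_dotProduct_mulVec]
    simp only [dotProduct, Pi.star_apply]
    rw [sum_append, Finset.sum_comm]
    simp only [hu, boundaryMap_append_right]
  have hmain : ∑ p : (Fin k → ι) × (Fin n → ι),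
      star (bondVec ((chainTensor T k p.1)ᵀ * X p.2)) ⬝ᵥ
        (S *ᵥ bondVec (Y p.1 * (chainTensor T n p.2)ᵀ)) =
      ∑ c, star (bondVec (X c)) ⬝ᵥ (S *ᵥ bondVec (W * (chainTensor T n c)ᵀ)) := by
    rw [Fintype.sum_prod_type_right]
    refine Finset.sum_congr rfl fun c _ => ?_
    simp only [hS, kronecker_one_mulVec_bondVec, star_bondVec_dotProduct]
    rw [← mul_assoc σ W, hσW, hη, ← trace_sum, Finset.sum_mul, Finset.mul_sum]
    simp only [conjTranspose_mul, mul_assoc]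
  -- The two terms containing `S` agree by `hmain`, so only the deviations from the product on `B`
  -- and on `AB` remain.
  have hdecomp : star u ⬝ᵥ v = ∑ p : (Fin k → ι) × (Fin n → ι),
      star (bondVec ((chainTensor T k p.1)ᵀ * X p.2)) ⬝ᵥ
        ((boundaryState T m - S) *ᵥ bondVec (Y p.1 * (chainTensor T n p.2)ᵀ)) -
      ∑ c, star (bondVec (X c)) ⬝ᵥ
        ((boundaryState T (k + m) - S) *ᵥ bondVec (W * (chainTensor T n c)ᵀ)) := by
    simp only [sub_mulVec, dotProduct_sub, Finset.sum_sub_distrib]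
    rw [← huv, huW, hmain]
    ring
  have hDM : √(D * M) * √(D * M) = D * M := Real.mul_self_sqrt (by positivity)
  have hKK : √K * √K = K := Real.mul_self_sqrt hK
  rw [hdecomp]
  refine (norm_sub_le _ _).trans ?_
  have e1 := norm_sum_dotProduct_mulVec_le (boundaryState T m - S)
    (fun p : (Fin k → ι) × (Fin n → ι) => bondVec ((chainTensor T k p.1)ᵀ * X p.2))
    (fun p => bondVec (Y p.1 * (chainTensor T n p.2)ᵀ))
  have e2 := norm_sum_dotProduct_mulVec_le (boundaryState T (k + m) - S)
    (fun c => bondVec (X c)) (fun c => bondVec (W * (chainTensor T n c)ᵀ))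
  have e1' : ‖boundaryState T m - S‖ *
      (√(sqSum fun p : (Fin k → ι) × (Fin n → ι) => bondVec ((chainTensor T k p.1)ᵀ * X p.2)) *
        √(sqSum fun p : (Fin k → ι) × (Fin n → ι) => bondVec (Y p.1 * (chainTensor T n p.2)ᵀ))) ≤
      ε * ((√(D * M) * NX) * (√(D * M) * NY)) := by gcongr
  have e2' : ‖boundaryState T (k + m) - S‖ * (√(sqSum fun c => bondVec (X c)) *
      √(sqSum fun c => bondVec (W * (chainTensor T n c)ᵀ))) ≤
      ε * (NX * (√(D * M) * (‖S⁻¹‖ * (√(D * M) * ‖S‖ * NY)))) := by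
    gcongr
    exact hw.trans (by gcongr)
  calc _ ≤ ε * ((√(D * M) * NX) * (√(D * M) * NY)) +
        ε * (NX * (√(D * M) * (‖S⁻¹‖ * (√(D * M) * ‖S‖ * NY)))) :=
        add_le_add (e1.trans e1') (e2.trans e2')
    _ = ε * (D * M * (1 + ‖S‖ * ‖S⁻¹‖)) * (NX * NY) := by
        linear_combination ε * NX * NY * (1 + ‖S‖ * ‖S⁻¹‖) * hDM
    _ ≤ ε * (D * M * (1 + ‖S‖ * ‖S⁻¹‖)) *
        ((√K * √(∑ s, ‖u s‖ ^ 2)) * (√K * √(∑ s, ‖v s‖ ^ 2))) := by gcongr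
    _ = _ := by
      linear_combination ε * (D * M * (1 + ‖S‖ * ‖S⁻¹‖)) * √(∑ s, ‖u s‖ ^ 2) *
        √(∑ s, ‖v s‖ ^ 2) * hKK

end Overlap

/-! ### Gaps of sums of projectors and comparison of Hamiltonians -/

section ProjectionSums

variable {n : Type} [Fintype n] [DecidableEq n]

theorem le_of_forall_re_dotProduct {A B : Matrix n n ℂ} (hA : A.IsHermitian) (hB : B.IsHermitian)
    (h : ∀ x : n → ℂ, (star x ⬝ᵥ (A *ᵥ x)).re ≤ (star x ⬝ᵥ (B *ᵥ x)).re) : A ≤ B := by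
  refine (Matrix.le_iff (A := A) (B := B)).2
    (PosSemidef.of_dotProduct_mulVec_nonneg (hB.sub hA) fun x => ?_)
  have him := (hB.sub hA).im_star_dotProduct_mulVec_self x
  rw [Complex.le_def]
  refine ⟨?_, him.symm⟩
  rw [sub_mulVec, dotProduct_sub, Complex.sub_re, Complex.zero_re, sub_nonneg]
  exact h x

/-- If `A ≥ a R` for a projector `R` with `A R = A`, then `A² ≥ a A`. -/
theorem smul_le_mul_self {A R : Matrix n n ℂ} (hA : 0 ≤ A)
    (hAR : A * R = A) {a : ℝ} (h : a • R ≤ A) : a • A ≤ A * A := by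
  have hA' := nonneg_iff.1 hA
  set W := psdSqrt A
  have hW : W.IsHermitian := psdSqrt_isHermitian A
  have hWW : W * W = A := psdSqrt_mul_self hA'
  have h1 : W * (1 - R) = 0 := by
    refine conjTranspose_mul_self_eq_zero.1 ?_
    rw [conjTranspose_mul, hW.eq, mul_assoc, ← mul_assoc W W, hWW, mul_sub, hAR, mul_one, sub_self,
      mul_zero]
  have h2 : W * R = W := by rwa [mul_sub, mul_one, sub_eq_zero, eq_comm] at h1
  have h3 := star_left_conjugate_le_conjugate h W
  rw [star_eq_conjTranspose, hW.eq, mul_smul_comm, smul_mul_assoc, h2, hWW] at h3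
  calc a • A ≤ W * A * W := h3
    _ = A * A := by rw [← hWW]; simp only [mul_assoc]

/-- The support projector of a matrix. -/
def suppProj (A : Matrix n n ℂ) : Matrix n n ℂ := cfc (fun x : ℝ => if x = 0 then 0 else 1) A

theorem mul_suppProj {A : Matrix n n ℂ} (hA : A.IsHermitian) : A * suppProj A = A := by
  unfold suppProj
  conv_lhs => enter [1]; rw [← cfc_id ℝ A hA.isSelfAdjoint]
  rw [← cfc_mul _ _ A (continuousOn_spectrum _ _) (continuousOn_spectrum _ _)]
  conv_rhs => rw [← cfc_id ℝ A hA.isSelfAdjoint]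
  refine cfc_congr fun x _ => ?_
  simp only [id]
  split_ifs with h <;> simp [h]

theorem le_sq_of_mem_spectrum {A : Matrix n n ℂ} (hA : A.IsHermitian) {a : ℝ}
    (h : a • A ≤ A * A) {x : ℝ} (hx : x ∈ spectrum ℝ A) : a * x ≤ x * x := by
  have h1 : cfc (fun x : ℝ => a * x) A = a • A := by
    rw [cfc_const_mul a (fun x => x) A (continuousOn_spectrum _ _), cfc_id' ℝ A hA.isSelfAdjoint]
  have h2 : cfc (fun x : ℝ => x * x) A = A * A := by
    rw [cfc_mul _ _ A (continuousOn_spectrum _ _) (continuousOn_spectrum _ _), cfc_id' ℝ A hA.isSelfAdjoint]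
  rw [← h1, ← h2] at h
  exact (cfc_le_iff _ _ A (continuousOn_spectrum _ _) (continuousOn_spectrum _ _) hA.isSelfAdjoint).1 h x hx

theorem smul_suppProj_le {A : Matrix n n ℂ} (hA : 0 ≤ A) {a : ℝ} (h : a • A ≤ A * A) :
    a • suppProj A ≤ A := by
  have hA' := (nonneg_iff.1 hA).isHermitian
  unfold suppProj
  rw [← cfc_const_mul a _ A (continuousOn_spectrum _ _)]
  conv_rhs => rw [← cfc_id' ℝ A hA'.isSelfAdjoint]
  refine (cfc_le_iff _ _ A (continuousOn_spectrum _ _) (continuousOn_spectrum _ _) hA'.isSelfAdjoint).2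
    fun x hx => ?_
  have h0 := spectrum_nonneg_of_nonneg hA hx
  have h1 := le_sq_of_mem_spectrum hA' h hx
  split_ifs with h2
  · simp [h2]
  · rw [mul_one]
    exact le_of_mul_le_mul_right h1 (lt_of_le_of_ne h0 (Ne.symm h2))

/-- The spectral gap of `H` is controlled by that of a Hamiltonian `H'` with smaller kernel. -/
theorem gap_of_comparison {H H' : Matrix n n ℂ} (hH : 0 ≤ H) (hH' : 0 ≤ H') {a C : ℝ} (hC : 0 < C)
    (h1 : a • H' ≤ H' * H') (h2 : H' ≤ C • H) (hker : ∀ x : n → ℂ, H' *ᵥ x = 0 → H *ᵥ x = 0) {E : ℝ}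
    (hE : E ∈ spectrum ℝ H) (hE0 : E ≠ 0) : a / C ≤ E := by
  -- The kernel inclusion places the support of `H` inside that of `H'`, so the lower bound on `H'`
  -- over its support transfers to `H`.
  have hsupp : H * suppProj H' = H := by
    have h3 : H' * (1 - suppProj H') = 0 := by
      rw [mul_sub, mul_suppProj (nonneg_iff.1 hH').isHermitian, mul_one, sub_self]
    have h4 : H * (1 - suppProj H') = 0 := by
      ext i j
      exact congrFun (hker (fun k => (1 - suppProj H') k j)
        (funext fun i => congrFun (congrFun h3 i) j)) i
    rwa [mul_sub, mul_one, sub_eq_zero, eq_comm] at h4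
  have h3 : (a / C) • suppProj H' ≤ H := by
    have h4 := real_smul_le_smul (inv_nonneg.2 hC.le) ((smul_suppProj_le hH' h1).trans h2)
    rwa [smul_smul, smul_smul, inv_mul_cancel₀ hC.ne', one_smul, inv_mul_eq_div] at h4
  have h4 := le_sq_of_mem_spectrum (nonneg_iff.1 hH).isHermitian
    (smul_le_mul_self hH hsupp h3) hE
  exact le_of_mul_le_mul_right h4 (lt_of_le_of_ne (spectrum_nonneg_of_nonneg hH hE) (Ne.symm hE0))

/-- Meant for two orthogonal projections `u`, `v` of `φ`. With `s = ‖u‖² + ‖v‖²`, one has `s ≤ ‖u +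
v‖ ‖φ‖` and, by the small overlap, `‖u + v‖² ≤ (1 + ε) s`. -/
theorem norm_sq_add_norm_sq_le {E : Type*} [NormedAddCommGroup E] [InnerProductSpace ℂ E]
    {u v φ : E} {ε : ℝ} (hu : RCLike.re (inner ℂ u φ) = ‖u‖ ^ 2)
    (hv : RCLike.re (inner ℂ v φ) = ‖v‖ ^ 2) (h : ‖inner ℂ u v‖ ≤ ε * (‖u‖ * ‖v‖)) (hε : 0 ≤ ε) :
    ‖u‖ ^ 2 + ‖v‖ ^ 2 ≤ (1 + ε) * ‖φ‖ ^ 2 := by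
  set s := ‖u‖ ^ 2 + ‖v‖ ^ 2 with hs
  have h1 : s ≤ ‖u + v‖ * ‖φ‖ := by
    rw [hs, ← hu, ← hv, ← map_add, ← inner_add_left]
    exact re_inner_le_norm _ _
  have h2 : ‖u + v‖ ^ 2 ≤ (1 + ε) * s := by
    rw [norm_add_sq (𝕜 := ℂ)]
    have h3 : RCLike.re (inner ℂ u v) ≤ ε * (‖u‖ * ‖v‖) := (RCLike.re_le_norm _).trans h
    have h4 : 2 * (‖u‖ * ‖v‖) ≤ s := by nlinarith [sq_nonneg (‖u‖ - ‖v‖)]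
    nlinarith
  have hs0 : 0 ≤ s := by positivity
  have h3 : s * s ≤ s * ((1 + ε) * ‖φ‖ ^ 2) := by
    calc s * s ≤ (‖u + v‖ * ‖φ‖) * (‖u + v‖ * ‖φ‖) := by gcongr
      _ = ‖u + v‖ ^ 2 * ‖φ‖ ^ 2 := by ring
      _ ≤ ((1 + ε) * s) * ‖φ‖ ^ 2 := by gcongr
      _ = _ := by ring
  rcases hs0.eq_or_lt with h4 | h4
  · rw [← h4]; positivity
  · exact le_of_mul_le_mul_left h3 h4

theorem inner_toLp (x y : n → ℂ) : inner ℂ (WithLp.toLp 2 x) (WithLp.toLp 2 y) = star x ⬝ᵥ y := by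
  rw [EuclideanSpace.inner_eq_star_dotProduct, dotProduct_comm]

theorem norm_toLp (x : n → ℂ) : ‖WithLp.toLp 2 x‖ = √(∑ i, ‖x i‖ ^ 2) :=
  EuclideanSpace.norm_eq _

/-- Two projectors whose kernels are almost orthogonal outside of a common subspace. -/
theorem smul_add_le_add_mul_add {P Q R : Matrix n n ℂ} (hP : P.IsHermitian) (hQ : Q.IsHermitian)
    (hR : R.IsHermitian) (hPP : P * P = P) (hQQ : Q * Q = Q) (hRR : R * R = R) (hPR : P * R = P)
    (hQR : Q * R = Q) {ε : ℝ} (hε : 0 ≤ ε)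
    (h : ∀ u v : n → ℂ, P *ᵥ u = 0 → Q *ᵥ v = 0 → R *ᵥ u = u →
      ‖star u ⬝ᵥ v‖ ≤ ε * (√(∑ s, ‖u s‖ ^ 2) * √(∑ s, ‖v s‖ ^ 2))) :
    (1 - ε) • (P + Q) ≤ (P + Q) * (P + Q) := by
  have hproj : ∀ {P : Matrix n n ℂ}, P.IsHermitian → P * P = P → ∀ x : n → ℂ,
      star (x - P *ᵥ x) ⬝ᵥ x = star (x - P *ᵥ x) ⬝ᵥ (x - P *ᵥ x) := by
    intro P hP hPP x
    rw [dotProduct_sub, eq_comm, sub_eq_self, star_sub, sub_dotProduct, star_mulVec, hP.eq,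
      ← dotProduct_mulVec, mulVec_mulVec, hPP, sub_self]
  have hself : ∀ x : n → ℂ, (star x ⬝ᵥ x).re = ‖WithLp.toLp 2 x‖ ^ 2 := fun x => by
    rw [← inner_toLp]
    exact (norm_sq_eq_re_inner (𝕜 := ℂ) _).symm
  have hz : ∀ {P : Matrix n n ℂ}, P * P = P → ∀ x : n → ℂ, P *ᵥ (x - P *ᵥ x) = 0 := by
    intro P hPP x
    rw [mulVec_sub, mulVec_mulVec, hPP, sub_self]
  have hnn : ∀ {P : Matrix n n ℂ}, P.IsHermitian → P * P = P → 0 ≤ P := fun {P} hP hPP => by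
    have h := posSemidef_conjTranspose_mul_self P
    rw [hP.eq, hPP] at h
    exact nonneg_iff.2 h
  refine smul_le_mul_self (add_nonneg (hnn hP hPP) (hnn hQ hQQ)) (by rw [add_mul, hPR, hQR]) ?_
  have hRP : R * P = P := by
    have := congrArg conjTranspose hPR
    rwa [conjTranspose_mul, hP.eq, hR.eq] at this
  have hRQ : R * Q = Q := by
    have := congrArg conjTranspose hQR
    rwa [conjTranspose_mul, hQ.eq, hR.eq] at this
  refine le_of_forall_re_dotProduct ?_ (hP.add hQ) fun x => ?_
  · rw [IsHermitian, conjTranspose_smul, hR.eq, star_trivial]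
  obtain ⟨φ, hφ⟩ : ∃ φ, φ = R *ᵥ x := ⟨_, rfl⟩
  have hRφ : R *ᵥ φ = φ := by rw [hφ, mulVec_mulVec, hRR]
  have hPφ : P *ᵥ φ = P *ᵥ x := by rw [hφ, mulVec_mulVec, hPR]
  have hQφ : Q *ᵥ φ = Q *ᵥ x := by rw [hφ, mulVec_mulVec, hQR]
  -- Applied to the components of `φ = R x` in the kernels of `P` and `Q`. Since `‖φ - P φ‖² = ‖φ‖²
  -- - ⟨φ, P φ⟩`, and likewise for `Q`, it yields `(1 - ε) ‖φ‖² ≤ ⟨φ, (P + Q) φ⟩`.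
  have h1 := norm_sq_add_norm_sq_le (u := WithLp.toLp 2 (φ - P *ᵥ φ))
    (v := WithLp.toLp 2 (φ - Q *ᵥ φ)) (φ := WithLp.toLp 2 φ) (ε := ε)
    (by rw [inner_toLp, hproj hP hPP, ← hself]; rfl) (by rw [inner_toLp, hproj hQ hQQ, ← hself]; rfl)
    (by
      rw [inner_toLp, norm_toLp, norm_toLp]
      refine h _ _ (hz hPP φ) (hz hQQ φ) ?_
      rw [mulVec_sub, hRφ, mulVec_mulVec, hRP]) hε
  rw [← hself, ← hself, ← hself, ← hproj hP hPP, ← hproj hQ hQQ, star_sub, star_sub, sub_dotProduct,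
    sub_dotProduct, star_mulVec, star_mulVec, hP.eq, hQ.eq, ← dotProduct_mulVec, ← dotProduct_mulVec,
    hPφ, hQφ] at h1
  have h2 : ∀ {P : Matrix n n ℂ}, R * P = P → star φ ⬝ᵥ (P *ᵥ x) = star x ⬝ᵥ (P *ᵥ x) := by
    intro P hRP
    rw [hφ, star_mulVec, hR.eq, ← dotProduct_mulVec, mulVec_mulVec, hRP]
  have h3 : star φ ⬝ᵥ φ = star x ⬝ᵥ (R *ᵥ x) := by rw [← h2 hRR, ← hφ]
  rw [h2 hRP, h2 hRQ, h3] at h1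
  simp only [Complex.sub_re] at h1
  rw [smul_mulVec, dotProduct_smul, Complex.smul_re, smul_eq_mul, add_mulVec, dotProduct_add,
    Complex.add_re]
  linarith

/-- A chain of projectors, commuting except for neighbours, which almost commute on the complement
of the common kernel. -/
theorem smul_sum_le_sum_mul_sum {P : ℕ → Matrix n n ℂ} {K : ℕ} {ε : ℝ} (hε : 0 ≤ ε)
    (hP : ∀ j, (P j).IsHermitian) (hPP : ∀ j, P j * P j = P j)
    (hcomm : ∀ i j, i + 2 ≤ j → j ≤ K → P i * P j = P j * P i)
    (hadj : ∀ j, j + 1 ≤ K → (1 - ε) • (P j + P (j + 1)) ≤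
      (P j + P (j + 1)) * (P j + P (j + 1))) :
    (1 - 2 * ε) • (∑ j ∈ Finset.range (K + 1), P j) ≤
      (∑ j ∈ Finset.range (K + 1), P j) * ∑ j ∈ Finset.range (K + 1), P j := by
  have hnn : ∀ j, 0 ≤ P j := fun j => by
    have h := posSemidef_conjTranspose_mul_self (P j)
    rw [(hP j).eq, hPP] at h
    exact nonneg_iff.2 h
  have hprod : ∀ i j, i + 2 ≤ j → j ≤ K → 0 ≤ P i * P j := by
    intro i j hij hj
    have h := posSemidef_conjTranspose_mul_self (P i * P j)
    have h2 : (P i * P j)ᴴ * (P i * P j) = P i * P j := by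
      rw [conjTranspose_mul, (hP i).eq, (hP j).eq, mul_assoc, ← mul_assoc (P i), hPP,
        hcomm i j hij hj, ← mul_assoc, hPP]
    rw [h2] at h
    exact nonneg_iff.2 h
  -- The cross terms of neighbours cost `ε (P k + P (k + 1))`. An inner projector pays twice, the
  -- last one so far only once; the surplus `ε • P k` pays for its next neighbour.
  have key : ∀ k ≤ K, (1 - 2 * ε) • (∑ j ∈ Finset.range (k + 1), P j) + ε • P k ≤
      (∑ j ∈ Finset.range (k + 1), P j) * ∑ j ∈ Finset.range (k + 1), P j := by
    intro k
    induction k with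
    | zero =>
      intro _
      rw [zero_add, Finset.sum_range_one, hPP, ← add_smul]
      have := real_smul_nonneg hε (hnn 0)
      have h2 : P 0 - (1 - 2 * ε + ε) • P 0 = ε • P 0 := by module
      rw [← sub_nonneg, h2]
      exact this
    | succ k ih =>
      intro hk
      have ih := ih (by omega)
      have h1 := hadj k hk
      rw [Finset.sum_range_succ _ (k + 1)]
      set S := ∑ j ∈ Finset.range (k + 1), P j with hS
      have h2 : 0 ≤ (S - P k) * P (k + 1) := by
        rw [hS, Finset.sum_range_succ, add_sub_cancel_right, Finset.sum_mul]
        exact Finset.sum_nonneg fun j hj => hprod _ _ (by have := Finset.mem_range.1 hj; omega) hk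
      have h3 : 0 ≤ P (k + 1) * (S - P k) := by
        rw [hS, Finset.sum_range_succ, add_sub_cancel_right, Finset.mul_sum]
        refine Finset.sum_nonneg fun j hj => ?_
        have hj' := Finset.mem_range.1 hj
        rw [← hcomm j (k + 1) (by omega) hk]
        exact hprod _ _ (by omega) hk
      have h4 := add_nonneg (add_nonneg (sub_nonneg.2 ih) (sub_nonneg.2 h1)) (add_nonneg h2 h3)
      rw [← sub_nonneg]
      refine h4.trans_eq ?_
      have e1 : (P k + P (k + 1)) * (P k + P (k + 1)) =
          P k + P (k + 1) + (P k * P (k + 1) + P (k + 1) * P k) := by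
        rw [add_mul, mul_add, mul_add, hPP, hPP]; abel
      have e2 : (S + P (k + 1)) * (S + P (k + 1)) =
          S * S + P (k + 1) + (S * P (k + 1) + P (k + 1) * S) := by
        rw [add_mul, mul_add, mul_add, hPP]; abel
      rw [e1, e2, sub_mul, mul_sub]
      module
  refine le_trans ?_ (key K le_rfl)
  exact le_add_of_nonneg_right (real_smul_nonneg hε (hnn K))

end ProjectionSums

/-! ### Ground-space projectors of blocks and the parent Hamiltonian -/

section Blocks

variable {ι : Type} [Fintype ι] [DecidableEq ι] {D : ℕ} (T : ι → Matrix (Fin D) (Fin D) ℂ)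

theorem mulVec_eq_zero_of_sum {n α : Type} [Fintype n] [DecidableEq n] {s : Finset α}
    {A : α → Matrix n n ℂ} (hA : ∀ a ∈ s, 0 ≤ A a) {u : n → ℂ} (h : (∑ a ∈ s, A a) *ᵥ u = 0) :
    ∀ a ∈ s, A a *ᵥ u = 0 := by
  intro a ha
  have h1 : ∑ a ∈ s, star u ⬝ᵥ (A a *ᵥ u) = 0 := by
    rw [← dotProduct_sum, ← sum_mulVec, h, dotProduct_zero]
  have h2 := (Finset.sum_eq_zero_iff_of_nonneg fun a ha =>
    (nonneg_iff.1 (hA a ha)).dotProduct_mulVec_nonneg u).1 h1 a ha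
  exact ((nonneg_iff.1 (hA a ha)).dotProduct_mulVec_zero_iff u).1 h2

/-- The projector `excProj T ℓ` acting on the sites `x, …, x + ℓ - 1` of a chain of `n` sites. -/
def blk (n x ℓ : ℕ) : Matrix (Fin n → ι) (Fin n → ι) ℂ :=
  if h : x + ℓ ≤ n then emb (shift x h) (excProj T ℓ) else 0

theorem blk_of_le {n x ℓ : ℕ} (h : x + ℓ ≤ n) : blk T n x ℓ = emb (shift x h) (excProj T ℓ) :=
  dif_pos h

theorem blk_isHermitian (n x ℓ : ℕ) : (blk T n x ℓ).IsHermitian := by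
  unfold blk
  split_ifs
  · rw [IsHermitian, ← emb_conjTranspose, (excProj_isHermitian T ℓ).eq]
  · exact isHermitian_zero

theorem blk_mul_self (n x ℓ : ℕ) : blk T n x ℓ * blk T n x ℓ = blk T n x ℓ := by
  unfold blk
  split_ifs
  · rw [← emb_mul (shift_injective _ _), excProj_mul_self]
  · simp

theorem blk_nonneg (n x ℓ : ℕ) : 0 ≤ blk T n x ℓ := by
  unfold blk
  split_ifs
  · exact emb_nonneg (shift_injective _ _) (excProj_nonneg T ℓ)
  · exact le_rfl

theorem blk_commute {n x ℓ y ℓ' : ℕ} (h : x + ℓ ≤ y) :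
    blk T n x ℓ * blk T n y ℓ' = blk T n y ℓ' * blk T n x ℓ := by
  unfold blk
  split_ifs
  · refine emb_commute (shift_injective _ _) (shift_injective _ _) (fun i j hij => ?_) _ _
    have h1 := congrArg Fin.val hij
    simp only [shift] at h1
    omega
  all_goals simp

theorem blk_mul_boundaryMap (n x ℓ : ℕ) : blk T n x ℓ * boundaryMap T n = 0 := by
  unfold blk
  split_ifs with h
  · exact emb_shift_mul_boundaryMap T x h (excProj_mul_boundaryMap T ℓ)
  · exact Matrix.zero_mul _

theorem blk_mulVec_eq_zero {n x ℓ : ℕ} {u : (Fin n → ι) → ℂ} (hu : excProj T n *ᵥ u = 0) :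
    blk T n x ℓ *ᵥ u = 0 := by
  obtain ⟨X, rfl⟩ := (excProj_mulVec_eq_zero_iff T n u).1 hu
  rw [mulVec_mulVec, blk_mul_boundaryMap, zero_mulVec]

theorem blk_mul_excProj (n x ℓ : ℕ) : blk T n x ℓ * excProj T n = blk T n x ℓ := by
  have h : blk T n x ℓ * (1 - excProj T n) = 0 := by
    ext s t
    have h1 : excProj T n *ᵥ ((1 - excProj T n) *ᵥ Pi.single t 1) = 0 := by
      rw [mulVec_mulVec, mul_sub, excProj_mul_self, mul_one, sub_self, zero_mulVec]
    have h2 := blk_mulVec_eq_zero T (x := x) (ℓ := ℓ) h1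
    rw [mulVec_mulVec, mulVec_single_one] at h2
    exact congrFun h2 s
  rwa [mul_sub, mul_one, sub_eq_zero, eq_comm] at h

theorem emb_shift_blk {n N x y ℓ : ℕ} (h : x + ℓ ≤ n) (h' : y + n ≤ N) :
    emb (shift y h') (blk T n x ℓ) = blk T N (y + x) ℓ := by
  rw [blk_of_le T h, blk_of_le T (by omega), emb_comp (shift_injective _ _), shift_comp_shift]

theorem emb_shift_zero {n : ℕ} (h : 0 + n ≤ n) (M : Matrix (Fin n → ι) (Fin n → ι) ℂ) :
    emb (shift 0 h) M = M := by
  have hs : shift 0 h = id := by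
    ext i; simp [shift]
  ext s t
  rw [emb_apply, hs, if_pos]
  · rfl
  · intro x hx
    exact absurd ⟨x, rfl⟩ hx

theorem blk_self (n : ℕ) : blk T n 0 n = excProj T n := by
  rw [blk_of_le T (by omega), emb_shift_zero]

/-- A ground state of an interval is a ground state of each subinterval, since on every slice it is
in the range of `V`. -/
theorem blk_mulVec_eq_zero_of_le {n x ℓ y ℓ' : ℕ} (h : x + ℓ ≤ n) (hxy : x ≤ y)
    (hy : y + ℓ' ≤ x + ℓ) {u : (Fin n → ι) → ℂ} (hu : blk T n x ℓ *ᵥ u = 0) :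
    blk T n y ℓ' *ᵥ u = 0 := by
  obtain ⟨z, rfl⟩ := Nat.exists_eq_add_of_le hxy
  rw [← emb_shift_blk T (n := ℓ) (by omega) h, emb_mulVec_eq_zero_iff (shift_injective _ _)]
  rw [blk_of_le T h, emb_mulVec_eq_zero_iff (shift_injective _ _)] at hu
  exact fun s => blk_mulVec_eq_zero T (hu s)

/-- The parent Hamiltonian of a chain of `n` sites. -/
def ham (n : ℕ) : Matrix (Fin n → ι) (Fin n → ι) ℂ := ∑ i ∈ Finset.range (n - 1), blk T n i 2

theorem ham_nonneg (n : ℕ) : 0 ≤ ham T n := Finset.sum_nonneg fun _ _ => blk_nonneg T _ _ _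

theorem onEdge_eq_emb (h : Matrix (Fin 2 → ι) (Fin 2 → ι) ℂ) {N : ℕ} (i : Fin N) :
    onEdge h i = emb (shift (i : ℕ) (by omega : (i : ℕ) + 2 ≤ N + 1)) h := by
  have h1 : ∀ x : Fin (N + 1), x ∉ Set.range (shift (i : ℕ) (by omega : (i : ℕ) + 2 ≤ N + 1)) ↔
      (x ≠ i.castSucc ∧ x ≠ i.succ) := by
    intro x
    simp only [Set.mem_range, Fin.exists_fin_two, shift, Fin.ext_iff]
    simp only [Fin.val_zero, Fin.val_one, Fin.val_castSucc, Fin.val_succ, ne_eq, Fin.ext_iff, not_or]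
    omega
  have h2 : ∀ s : Fin (N + 1) → ι, s ∘ shift (i : ℕ) (by omega : (i : ℕ) + 2 ≤ N + 1) =
      ![s i.castSucc, s i.succ] := by
    intro s
    ext j
    fin_cases j <;> rfl
  classical
  ext s t
  rw [emb_apply, onEdge, Matrix.of_apply, h2, h2]
  refine if_congr (forall_congr' fun x => ?_) rfl rfl
  rw [h1]
  exact ⟨fun h a => h a.1 a.2, fun h a b => h ⟨a, b⟩⟩

theorem parentHamiltonian_eq_ham (N : ℕ) : parentHamiltonian T N = ham T (N + 1) := by
  unfold parentHamiltonian ham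
  rw [Nat.add_sub_cancel, Finset.sum_range]
  refine Finset.sum_congr rfl fun i _ => ?_
  rw [onEdge_eq_emb, localTerm_eq_excProj, blk_of_le]

theorem emb_shift_ham {n N y : ℕ} (h' : y + n ≤ N) :
    emb (shift y h') (ham T n) = ∑ i ∈ Finset.range (n - 1), blk T N (y + i) 2 := by
  rw [ham, emb_sum]
  refine Finset.sum_congr rfl fun i hi => ?_
  have := Finset.mem_range.1 hi
  exact emb_shift_blk T (by omega) h'

variable {T}

/-- The ground space of the parent Hamiltonian is the range of `V`. -/
theorem InjectiveOn.excProj_mulVec_eq_zero (hT : InjectiveOn T 1) {n : ℕ} (hn : 2 ≤ n)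
    {u : (Fin n → ι) → ℂ} (hu : ham T n *ᵥ u = 0) : excProj T n *ᵥ u = 0 := by
  induction n, hn using Nat.le_induction with
  | base =>
    rw [ham] at hu
    simpa [blk_self] using hu
  | succ n hn ih =>
    obtain ⟨k, rfl⟩ : ∃ k, n = k + 1 := ⟨n - 1, by omega⟩
    have h1 := mulVec_eq_zero_of_sum (fun i _ => blk_nonneg T _ i 2) hu
    have h2 : emb (shift 0 (by omega : 0 + (k + 1) ≤ k + 1 + 1)) (excProj T (k + 1)) *ᵥ u = 0 := by
      have h3 : emb (shift 0 (by omega : 0 + (k + 1) ≤ k + 1 + 1)) (ham T (k + 1)) *ᵥ u = 0 := by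
        rw [emb_shift_ham, sum_mulVec]
        refine Finset.sum_eq_zero fun i hi => ?_
        have := Finset.mem_range.1 hi
        rw [zero_add]
        exact h1 i (Finset.mem_range.2 (by omega))
      rw [emb_mulVec_eq_zero_iff (shift_injective _ _)] at h3 ⊢
      exact fun s => ih (h3 s)
    have h4 := h1 k (Finset.mem_range.2 (by omega))
    rw [blk_of_le T (by omega)] at h4
    -- The intersection property for lengths `k`, 1, 1: the chain of `k + 1` sites and the last edge
    -- share one site.
    exact (hT.mono one_pos (by omega : 1 ≤ k)).exists_boundaryMap_eq hT (n := 1) _ _ h2 h4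

/-- Both operators have the same kernel at each length, which gives a constant for that length. Only
finitely many lengths are involved, so no uniformity in the length is needed. -/
theorem InjectiveOn.exists_excProj_le (hT : InjectiveOn T 1) (B : ℕ) :
    ∃ C : ℝ, 0 < C ∧ ∀ ℓ, 2 ≤ ℓ → ℓ ≤ B → excProj T ℓ ≤ C • ham T ℓ := by
  have h : ∀ ℓ, ∃ C : ℝ, 0 < C ∧ (2 ≤ ℓ → excProj T ℓ ≤ C • ham T ℓ) := by
    intro ℓ
    by_cases hℓ : 2 ≤ ℓ
    · obtain ⟨C, hC, h⟩ := exists_le_smul_of_ker_le (nonneg_iff.1 (ham_nonneg T ℓ))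
        (excProj_isHermitian T ℓ) fun u hu => hT.excProj_mulVec_eq_zero hℓ hu
      exact ⟨C, hC, fun _ => h⟩
    · exact ⟨1, one_pos, fun h => absurd h hℓ⟩
  choose C hC h using h
  refine ⟨∑ ℓ ∈ Finset.range (B + 1), C ℓ,
    Finset.sum_pos (fun ℓ _ => hC ℓ) ⟨0, Finset.mem_range.2 (by omega)⟩, fun ℓ h2 hB => ?_⟩
  refine (h ℓ h2).trans ?_
  have h1 : C ℓ ≤ ∑ ℓ ∈ Finset.range (B + 1), C ℓ :=
    Finset.single_le_sum (fun ℓ _ => (hC ℓ).le) (Finset.mem_range.2 (by omega))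
  rw [← sub_nonneg, ← sub_smul]
  exact real_smul_nonneg (sub_nonneg.2 h1) (ham_nonneg T ℓ)

/-- Ground-space projectors of overlapping chains almost commute. -/
theorem InjectiveOn.exists_add_blk_le (hT : InjectiveOn T 1) {σ : Matrix (Fin D) (Fin D) ℂ}
    (hσ : σ.PosDef) {c γ : ℝ} (hc : 0 < c) (h0 : 0 < γ) (h1 : γ < 1)
    (hb : ∀ m : ℕ, ‖boundaryState T m - σ ⊗ₖ (1 : Matrix (Fin D) (Fin D) ℂ)‖ ≤ c * γ ^ m) :
    ∃ C : ℝ, 0 ≤ C ∧ ∀ k m n N x : ℕ, 1 ≤ m → x + (k + m + n) ≤ N →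
      (1 - C * γ ^ m) • (blk T N x (k + m) + blk T N (x + k) (m + n)) ≤
        (blk T N x (k + m) + blk T N (x + k) (m + n)) *
          (blk T N x (k + m) + blk T N (x + k) (m + n)) := by
  have ht := tendsto_of_norm_sub_le h0 h1 hb
  obtain ⟨M, hM0, hM⟩ := exists_norm_le_of_tendsto ht
  obtain ⟨K, hK0, hK⟩ := exists_norm_inv_le_of_tendsto (kronecker_one_isUnit hσ) ht
  have hpos : ∀ m, 1 ≤ m → (boundaryState T m).PosDef := fun m hm =>
    (hT.mono one_pos hm).boundaryState_posDef
  set C' := D * M * (1 + ‖σ ⊗ₖ (1 : Matrix (Fin D) (Fin D) ℂ)‖ *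
      ‖(σ ⊗ₖ (1 : Matrix (Fin D) (Fin D) ℂ))⁻¹‖) * K with hC'
  refine ⟨c * C', by positivity, fun k m n N x hm hN => ?_⟩
  have hε : c * C' * γ ^ m = (c * γ ^ m) * C' := by ring
  have hloc : (1 - c * C' * γ ^ m) •
      (blk T (k + m + n) 0 (k + m) + blk T (k + m + n) k (m + n)) ≤
        (blk T (k + m + n) 0 (k + m) + blk T (k + m + n) k (m + n)) *
          (blk T (k + m + n) 0 (k + m) + blk T (k + m + n) k (m + n)) := by
    refine smul_add_le_add_mul_add (blk_isHermitian T _ _ _) (blk_isHermitian T _ _ _)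
      (excProj_isHermitian T _) (blk_mul_self T _ _ _) (blk_mul_self T _ _ _)
      (excProj_mul_self T _) (blk_mul_excProj T _ _ _) (blk_mul_excProj T _ _ _) (by positivity) ?_
    intro u v hu hv huR
    rw [blk_of_le T (by omega)] at hu hv
    obtain ⟨X, hX⟩ := exists_left_boundary T _ hu
    obtain ⟨Y, hY⟩ := exists_right_boundary T _ hv
    rw [hε]
    refine norm_overlap_le hσ (hM k) (hM n) (hpos _ (by omega)) (hpos _ (by omega)) (hK _) (hK _)
      (hb m) ((hb (k + m)).trans ?_) (fun c => Matrix.of fun i j => X c (i, j))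
      (fun a => Matrix.of fun i j => Y a (i, j)) hX hY fun W => ?_
    · exact mul_le_mul_of_nonneg_left (pow_le_pow_of_le_one h0.le h1.le (by omega)) hc.le
    · rw [← huR, star_mulVec, (excProj_isHermitian T _).eq, ← dotProduct_mulVec, mulVec_mulVec,
        excProj_mul_boundaryMap, zero_mulVec, dotProduct_zero]
  have h2 := emb_mono (shift_injective x hN) hloc
  rw [emb_smul, emb_mul (shift_injective _ _), emb_add, emb_shift_blk T (by omega),
    emb_shift_blk T (by omega), add_zero] at h2
  exact h2

end Blocks

/-! ### The gap of the parent Hamiltonian -/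

section Gap

variable {ι : Type} [Fintype ι] [DecidableEq ι] {D : ℕ} {T : ι → Matrix (Fin D) (Fin D) ℂ}

/-- The length of the `j`-th of `K + 1` overlapping blocks that cover a chain of
`(K + 2) * m + r` sites. -/
def blkLen (m r K j : ℕ) : ℕ := if j < K then 2 * m else 2 * m + r

theorem blkLen_add_le {m r K j : ℕ} (hj : j ≤ K) : j * m + blkLen m r K j ≤ (K + 2) * m + r := by
  obtain ⟨t, rfl⟩ := Nat.exists_eq_add_of_le hj
  unfold blkLen
  split_ifs <;> nlinarith [Nat.zero_le (t * m)]

theorem le_blkLen (m r K j : ℕ) : 2 * m ≤ blkLen m r K j := by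
  unfold blkLen
  split_ifs <;> omega

theorem blkLen_le {m r : ℕ} (hr : r < m) (K j : ℕ) : blkLen m r K j ≤ 3 * m := by
  unfold blkLen
  split_ifs <;> omega

/-- Blocks start at multiples of `m` and have length at least `2 * m`, so the edge at `i` lies in
block `i / m`, or in the last block if that index exceeds `K`. -/
theorem exists_blk_covering {m r K i : ℕ} (hm : 0 < m) (hi : i < (K + 2) * m + r - 1) :
    ∃ j ≤ K, j * m ≤ i ∧ i + 2 ≤ j * m + blkLen m r K j := by
  have h1 := Nat.div_mul_le_self i m
  have h2 := Nat.lt_div_mul_add (a := i) hm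
  rcases lt_or_ge (i / m) K with h | h
  · refine ⟨i / m, h.le, h1, ?_⟩
    have := le_blkLen m r K (i / m)
    omega
  · refine ⟨K, le_rfl, (Nat.mul_le_mul_right m h).trans h1, ?_⟩
    rw [blkLen, if_neg (lt_irrefl K)]
    have : (K + 2) * m = K * m + 2 * m := by ring
    omega

/-- An edge lies in at most two blocks of length `2 * m`, namely `i / m - 1` and `i / m`, and
possibly in the longer last block. -/
theorem card_covering_le {m r K i : ℕ} (hm : 0 < m) :
    ((Finset.range (K + 1)).filter fun j => j * m ≤ i ∧ i + 2 ≤ j * m + blkLen m r K j).card ≤ 3 := by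
  refine (Finset.card_le_card (t := {i / m - 1, i / m, K}) fun j hj => ?_).trans Finset.card_le_three
  simp only [Finset.mem_filter, Finset.mem_range, Finset.mem_insert, Finset.mem_singleton] at hj ⊢
  obtain ⟨hjK, h1, h2⟩ := hj
  rcases Nat.lt_succ_iff_lt_or_eq.1 hjK with h | h
  · rw [blkLen, if_pos h] at h2
    have h3 := (Nat.le_div_iff_mul_le hm).2 h1
    have h4 : i / m < j + 2 := (Nat.div_lt_iff_lt_mul hm).2 (by linarith)
    omega
  · exact Or.inr (Or.inr h)

theorem blk_le_smul_sum {C : ℝ} {n x ℓ : ℕ} (h : x + ℓ ≤ n)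
    (hle : excProj T ℓ ≤ C • ham T ℓ) :
    blk T n x ℓ ≤ C • ∑ i ∈ Finset.range (n - 1),
      if x ≤ i ∧ i + 2 ≤ x + ℓ then blk T n i 2 else 0 := by
  have h1 := emb_mono (shift_injective x h) hle
  rw [emb_smul, emb_shift_ham, ← blk_of_le] at h1
  refine h1.trans (le_of_eq (congrArg (C • ·) ?_))
  rw [← Finset.sum_filter (s := Finset.range (n - 1))]
  refine Finset.sum_bij (fun i _ => x + i) (fun i hi => ?_) (fun a _ b _ hab => by omega)
    (fun i hi => ?_) fun _ _ => rfl
  · rw [Finset.mem_range] at hi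
    rw [Finset.mem_filter, Finset.mem_range]
    omega
  · rw [Finset.mem_filter, Finset.mem_range] at hi
    exact ⟨i - x, Finset.mem_range.2 (by omega), by omega⟩

theorem sum_blk_le {C : ℝ} (hC : 0 ≤ C) {m r K : ℕ} (hm : 0 < m) (hr : r < m)
    (hle : ∀ ℓ, 2 ≤ ℓ → ℓ ≤ 3 * m → excProj T ℓ ≤ C • ham T ℓ) :
    ∑ j ∈ Finset.range (K + 1), blk T ((K + 2) * m + r) (j * m) (blkLen m r K j) ≤
      (3 * C) • ham T ((K + 2) * m + r) := by
  have h1 : ∀ j ∈ Finset.range (K + 1), blk T ((K + 2) * m + r) (j * m) (blkLen m r K j) ≤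
      C • ∑ i ∈ Finset.range ((K + 2) * m + r - 1),
        if j * m ≤ i ∧ i + 2 ≤ j * m + blkLen m r K j then blk T ((K + 2) * m + r) i 2 else 0 := by
    intro j hj
    have := le_blkLen m r K j
    exact blk_le_smul_sum (blkLen_add_le (Nat.lt_succ_iff.1 (Finset.mem_range.1 hj)))
      (hle _ (by omega) (blkLen_le hr K j))
  refine (Finset.sum_le_sum h1).trans ?_
  rw [← Finset.smul_sum, mul_comm 3 C, mul_smul]
  refine real_smul_le_smul hC ?_
  rw [Finset.sum_comm, ham, Finset.smul_sum]
  refine Finset.sum_le_sum fun i _ => ?_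
  rw [← Finset.sum_filter, Finset.sum_const, ← Nat.cast_smul_eq_nsmul ℝ]
  rw [← sub_nonneg, ← sub_smul]
  refine real_smul_nonneg (sub_nonneg.2 ?_) (blk_nonneg T _ _ _)
  exact_mod_cast card_covering_le hm

/-- In long chains, the nonzero eigenvalues of the parent Hamiltonian are bounded from below. -/
theorem InjectiveOn.exists_le_of_mem_spectrum_ham_of_le (hT : InjectiveOn T 1)
    {σ : Matrix (Fin D) (Fin D) ℂ} (hσ : σ.PosDef) {c γ : ℝ} (hc : 0 < c) (h0 : 0 < γ) (h1 : γ < 1)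
    (hb : ∀ m : ℕ, ‖boundaryState T m - σ ⊗ₖ (1 : Matrix (Fin D) (Fin D) ℂ)‖ ≤ c * γ ^ m) :
    ∃ (n₀ : ℕ) (δ : ℝ), 0 < δ ∧ ∀ n, n₀ ≤ n → ∀ E ∈ spectrum ℝ (ham T n), E ≠ 0 → δ ≤ E := by
  obtain ⟨C₀, hC₀, hadj⟩ := hT.exists_add_blk_le hσ hc h0 h1 hb
  -- The threshold 1/2 makes the coarse gap `1 - 2ε` positive.
  obtain ⟨m, hm1, hm⟩ : ∃ m, 1 ≤ m ∧ C₀ * γ ^ m < 1 / 2 := by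
    have ht : Tendsto (fun m : ℕ => C₀ * γ ^ m) atTop (𝓝 0) := by
      simpa using (tendsto_pow_atTop_nhds_zero_of_lt_one h0.le h1).const_mul C₀
    exact ((eventually_ge_atTop 1).and (ht.eventually (gt_mem_nhds (by norm_num)))).exists
  obtain ⟨C, hC, hle⟩ := hT.exists_excProj_le (3 * m)
  refine ⟨2 * m, (1 - 2 * (C₀ * γ ^ m)) / (3 * C), div_pos (by linarith) (by positivity),
    fun n hn E hE hE0 => ?_⟩
  obtain ⟨K, r, hr, rfl⟩ : ∃ K r, r < m ∧ n = (K + 2) * m + r := by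
    refine ⟨n / m - 2, n % m, Nat.mod_lt _ hm1, ?_⟩
    have := (Nat.le_div_iff_mul_le hm1).2 hn
    rw [Nat.sub_add_cancel this, Nat.div_add_mod']
  refine gap_of_comparison (ham_nonneg T _) (Finset.sum_nonneg fun j _ => blk_nonneg T _ _ _)
    (by positivity) (smul_sum_le_sum_mul_sum (by positivity) (fun j => blk_isHermitian T _ _ _)
      (fun j => blk_mul_self T _ _ _) (fun i j hij hj => blk_commute T ?_) fun j hj => ?_)
    (sum_blk_le hC.le hm1 hr hle) (fun u hu => ?_) hE hE0
  · rw [blkLen, if_pos (by omega), ← add_mul]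
    exact Nat.mul_le_mul_right m hij
  -- Neighbouring blocks share exactly `m` sites; only the last block absorbs the remainder `r`.
  · have h2 := hadj m m (if j + 1 < K then m else m + r) ((K + 2) * m + r) (j * m) hm1 (by
      obtain ⟨t, rfl⟩ := Nat.exists_eq_add_of_le hj
      split_ifs with h
      · have : 1 ≤ t := by omega
        nlinarith
      · have : t = 0 := by omega
        subst this
        nlinarith)
    have h3 : blkLen m r K j = m + m := by rw [blkLen, if_pos (by omega)]; ring
    have h4 : blkLen m r K (j + 1) = m + if j + 1 < K then m else m + r := by
      unfold blkLen
      split_ifs <;> ring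
    rw [h3, h4, Nat.succ_mul j m]
    exact h2
  · have h2 := mulVec_eq_zero_of_sum (fun j _ => blk_nonneg T _ _ _) hu
    rw [ham, sum_mulVec]
    refine Finset.sum_eq_zero fun i hi => ?_
    obtain ⟨j, hj, hji, hij⟩ := exists_blk_covering (m := m) (r := r) hm1 (Finset.mem_range.1 hi)
    exact blk_mulVec_eq_zero_of_le T (blkLen_add_le hj) hji hij
      (h2 j (Finset.mem_range.2 (by omega)))

theorem exists_le_of_mem_spectrum_ham (T : ι → Matrix (Fin D) (Fin D) ℂ) (n : ℕ) :
    ∃ δ : ℝ, 0 < δ ∧ ∀ E ∈ spectrum ℝ (ham T n), E ≠ 0 → δ ≤ E := by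
  have hfin : (spectrum ℝ (ham T n) \ {0}).Finite := Matrix.finite_real_spectrum.sdiff
  rcases (spectrum ℝ (ham T n) \ {0}).eq_empty_or_nonempty with h | h
  · exact ⟨1, one_pos, fun E hE hE0 => absurd (h.subset ⟨hE, hE0⟩) (Set.notMem_empty E)⟩
  · obtain ⟨δ, ⟨hδ, hδ0⟩, hmin⟩ := hfin.exists_minimal h
    refine ⟨δ, lt_of_le_of_ne (spectrum_nonneg_of_nonneg (ham_nonneg T n) hδ) (Ne.symm hδ0),
      fun E hE hE0 => ?_⟩
    rcases le_total δ E with h | h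
    · exact h
    · exact hmin ⟨hE, hE0⟩ h

/-- The Hamiltonian annihilates the range of `V`, which is nonzero by injectivity. So the model is
frustration free with ground energy 0. -/
theorem InjectiveOn.zero_mem_spectrum_ham (hT : InjectiveOn T 1) (hD : 0 < D) {n : ℕ} (hn : 1 ≤ n) :
    (0 : ℝ) ∈ spectrum ℝ (ham T n) := by
  rw [spectrum.zero_mem_iff]
  rintro ⟨U, hU⟩
  have h1 : ham T n * boundaryMap T n = 0 := by
    rw [ham, Matrix.sum_mul]
    exact Finset.sum_eq_zero fun i _ => blk_mul_boundaryMap T _ _ _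
  have h2 : boundaryMap T n = 0 := by
    rw [← Matrix.one_mul (boundaryMap T n), ← U.inv_mul, Matrix.mul_assoc, hU, h1, Matrix.mul_zero]
  have h3 : (Pi.single (⟨0, hD⟩, ⟨0, hD⟩) 1 : Fin D × Fin D → ℂ) = 0 :=
    hT.mono one_pos hn (by rw [h2, zero_mulVec, zero_mulVec])
  simpa using congrFun h3 (⟨0, hD⟩, ⟨0, hD⟩)

theorem InjectiveOn.parentGapped_of_norm_sub_le (hT : InjectiveOn T 1) (hD : 0 < D)
    {σ : Matrix (Fin D) (Fin D) ℂ} (hσ : σ.PosDef) {c γ : ℝ} (hc : 0 < c) (h0 : 0 < γ) (h1 : γ < 1)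
    (hb : ∀ m : ℕ, ‖boundaryState T m - σ ⊗ₖ (1 : Matrix (Fin D) (Fin D) ℂ)‖ ≤ c * γ ^ m) :
    ParentGapped T := by
  obtain ⟨n₀, δ, hδ, h⟩ := hT.exists_le_of_mem_spectrum_ham_of_le hσ hc h0 h1 hb
  -- The uniform bound covers long chains; the finitely many others contribute the minimum of their
  -- individual gaps.
  choose δ' hδ' h' using exists_le_of_mem_spectrum_ham T
  have hne : ((Finset.range (n₀ + 1)).image δ').Nonempty := by simp
  set δ₁ := ((Finset.range (n₀ + 1)).image δ').min' hne
  have hδ₁ : 0 < δ₁ := by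
    rw [Finset.lt_min'_iff]
    simp only [Finset.mem_image, forall_exists_index, and_imp]
    rintro _ n _ rfl
    exact hδ' n
  refine ⟨min δ δ₁, lt_min hδ hδ₁, fun N E₀ E₁ hE₀ hE₁ => ?_⟩
  rw [parentHamiltonian_eq_ham] at hE₀ hE₁
  have hE₀0 : E₀ = 0 := le_antisymm (hE₀.2 (hT.zero_mem_spectrum_ham hD (by omega)))
    (spectrum_nonneg_of_nonneg (ham_nonneg T _) hE₀.1)
  subst hE₀0
  rw [sub_zero]
  rcases le_total n₀ (N + 1) with hN | hN
  · exact (min_le_left _ _).trans (h _ hN E₁ hE₁.1.1 hE₁.1.2)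
  · refine (min_le_right _ _).trans (le_trans (Finset.min'_le _ _ ?_) (h' (N + 1) E₁ hE₁.1.1 hE₁.1.2))
    exact Finset.mem_image_of_mem _ (Finset.mem_range.2 (by omega))

theorem gauge_inv_gauge (Z : (Matrix (Fin D) (Fin D) ℂ)ˣ) {μ : ℝ} (hμ : μ ≠ 0) :
    gauge Z⁻¹ μ⁻¹ (gauge Z μ T) = T := by
  funext j
  have h : ((μ⁻¹ : ℝ) : ℂ) * (μ : ℂ) = 1 := by
    rw [← Complex.ofReal_mul, inv_mul_cancel₀ hμ, Complex.ofReal_one]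
  simp only [gauge, inv_inv, Matrix.mul_smul, Matrix.smul_mul, smul_smul, h, one_smul]
  rw [← Matrix.mul_assoc, ← Matrix.mul_assoc, Units.inv_mul, Matrix.one_mul, Matrix.mul_assoc,
    Units.inv_mul, Matrix.mul_one]

/-- By cyclicity of the trace the gauge is absorbed into the boundary matrix. Equality of the ranges
follows by applying this to the inverse gauge. -/
theorem range_boundaryMap_gauge_le (T : ι → Matrix (Fin D) (Fin D) ℂ)
    (Z : (Matrix (Fin D) (Fin D) ℂ)ˣ) (μ : ℝ) (ℓ : ℕ) :
    LinearMap.range (Matrix.toEuclideanLin (boundaryMap (gauge Z μ T) ℓ)) ≤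
      LinearMap.range (Matrix.toEuclideanLin (boundaryMap T ℓ)) := by
  rintro _ ⟨X, rfl⟩
  set W : Matrix (Fin D) (Fin D) ℂ := (Matrix.of fun i j => X (i, j))ᵀ with hW
  refine ⟨WithLp.toLp 2 fun p =>
    (((μ ^ ℓ : ℝ) : ℂ) • ((↑Z⁻¹ : Matrix (Fin D) (Fin D) ℂ) * W * (Z : Matrix (Fin D) (Fin D) ℂ)))
      p.2 p.1, ?_⟩
  ext s
  simp only [Matrix.ofLp_toLpLin, Matrix.toLin'_apply]
  rw [boundaryMap_mulVec_eq_trace, boundaryMap_mulVec_eq_trace, chainTensor_gauge]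
  change (chainTensor T ℓ s * (((μ ^ ℓ : ℝ) : ℂ) • ((↑Z⁻¹ : Matrix (Fin D) (Fin D) ℂ) * W *
    (Z : Matrix (Fin D) (Fin D) ℂ)))).trace = (_ * W).trace
  rw [Matrix.mul_smul, Matrix.smul_mul, trace_smul, trace_smul, ← Matrix.mul_assoc,
    trace_mul_comm, ← Matrix.mul_assoc, ← Matrix.mul_assoc]

theorem parentHamiltonian_gauge (T : ι → Matrix (Fin D) (Fin D) ℂ)
    (Z : (Matrix (Fin D) (Fin D) ℂ)ˣ) {μ : ℝ} (hμ : μ ≠ 0) (N : ℕ) :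
    parentHamiltonian (gauge Z μ T) N = parentHamiltonian T N := by
  have h := range_boundaryMap_gauge_le (gauge Z μ T) Z⁻¹ μ⁻¹ 2
  rw [gauge_inv_gauge Z hμ] at h
  simp only [parentHamiltonian, localTerm, le_antisymm (range_boundaryMap_gauge_le T Z μ 2) h]

/-- The parent Hamiltonian of an injective MPS is gapped. -/
theorem InjectiveOn.parentGapped (hT : InjectiveOn T 1) (hD : 0 < D) : ParentGapped T := by
  obtain ⟨Z, μ, σ, c, γ, hμ, hσ, -, hc, h0, h1, hb⟩ :=
    hT.exists_gauge_boundaryState_sub_le hD one_pos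
  have h := (hT.gauge Z hμ.ne').parentGapped_of_norm_sub_le hD hσ hc h0 h1 hb
  simpa only [ParentGapped, parentHamiltonian_gauge T Z hμ.ne'] using h

theorem InjectiveOn.chainTensor {m : ℕ} (hT : InjectiveOn T m) :
    InjectiveOn (MPS.chainTensor T m) 1 :=
  injectiveOn_of_linearMap fun F hF => hT.linearMap_eq_zero F fun s => by
    simpa [chainTensor_one] using hF fun _ => s

end Gap

end MPS

end

theorem lemma3p4 {d D L : ℕ} (hD : 0 < D) (hL : 0 < L)
    (T : Fin d → Matrix (Fin D) (Fin D) ℂ) (hT : MPS.InjectiveOn T L) :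
    (∃ (Z : (Matrix (Fin D) (Fin D) ℂ)ˣ) (μ : ℝ) (σ : Matrix (Fin D) (Fin D) ℂ) (c γ : ℝ),
      0 < μ ∧ σ.PosDef ∧ σ.trace = 1 ∧ 0 < c ∧ 0 < γ ∧ γ < 1 ∧
      (∀ m : ℕ, MPS.traceNorm
        (MPS.boundaryState (MPS.gauge Z μ T) m - σ ⊗ₖ (1 : Matrix (Fin D) (Fin D) ℂ))
          ≤ c * γ ^ m) ∧
      (∀ m : ℕ, MPS.opNorm
        (MPS.psdSqrt (MPS.boundaryState (MPS.gauge Z μ T) m)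
          * (σ⁻¹ ⊗ₖ (1 : Matrix (Fin D) (Fin D) ℂ))
          * MPS.psdSqrt (MPS.boundaryState (MPS.gauge Z μ T) m) - 1)
          ≤ c * (MPS.minEigenvalue σ)⁻¹ * γ ^ m) ∧
      ∃ c' : ℝ, 0 < c' ∧
        (∀ m : ℕ, L ≤ m → MPS.opNorm
          (MPS.psdInvSqrt (MPS.boundaryState (MPS.gauge Z μ T) m)
            * (σ ⊗ₖ (1 : Matrix (Fin D) (Fin D) ℂ))
            * MPS.psdInvSqrt (MPS.boundaryState (MPS.gauge Z μ T) m) - 1)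
            ≤ c' * (MPS.minEigenvalue σ)⁻¹ * γ ^ m) ∧
        (∀ k m n : ℕ, L ≤ m →
          MPS.ApproxFactorizable (MPS.gauge Z μ T) k m n
            (c' * (MPS.minEigenvalue σ)⁻¹ * γ ^ m))) ∧
    MPS.ParentGapped (MPS.chainTensor T L) :=
  ⟨hT.exists_gauge_approxFactorizable hD hL, hT.chainTensor.parentGapped hD⟩
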